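/- Let $n\ge 2$, $k=n-1$, and let $R(T)=\mathbb Z[e^{\pm a_1},\dots,e^{\pm a_n}]/(e^{a_1+\cdots+a_n}-1)$ be the representation ring of the maximal torus of $SL_n$. Put $b_i=1-e^{-a_i}$, $\theta=a_1-a_n$, and let $R(T)^\Delta$ be the localization of $R(T)$ at the elements $1-e^{a_i-a_j}$, $i\ne j$. **Phase space.** For $0\le m\le i\le n$ let $$F^{(i)}_m=\sum_{J\subset\{1,\dots,i\},\,|J|=m}\ \prod_{j\in J,\ j+1\notin J}(1-Q_j)\prod_{j\in J}z_j\qquad(Q_n=0),$$ let $\mathscr O(\mathscr Y)$ be the quotient of $R(T)[z_1,\dots,z_n,Q_1,\dots,Q_{n-1}]$ by the elements $F^{(n)}_i-e_i(e^{-a_1},\dots,e^{-a_n})$ for $1\le i\le n$ ($e_i$ the elementary symmetric polynomial), and $\mathscr O(\mathscr Y^\circ)=\mathscr O(\mathscr Y)[Q_1^{-1},\dots,Q_{n-1}^{-1}]$. Put $Q^{-\theta^\vee}=(Q_1\cdots Q_{n-1})^{-1}$. **Quantum double Grothendieck polynomials.** $\mathfrak G^Q_w(z|\eta)\in\mathbb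 Z[Q][z,\eta]$ ($w\in S_n$) is determined by $\mathfrak G^Q_{w_\circ}=\prod_{i=1}^{n-1}\sum_{j=0}^i(-1)^j(1-\eta_{n-i})^jF^{(i)}_j$ for the longest element $w_\circ$, and $\mathfrak G^Q_{w}=D^Q_i\,\mathfrak G^Q_{s_iw}$ if $s_iw>w$, where $$D_i^Q=1+\frac{1-\eta_i}{\eta_{i+1}-\eta_i}\,(s_i^{(\eta)}-1)$$ and $s_i^{(\eta)}$ exchanges $\eta_i$ and $\eta_{i+1}$. It is regarded as an element of $\mathscr O(\mathscr Y)$ by the substitution $\eta_i=1-e^{a_{n-i+1}}$. Let $s_\theta\in S_n$ be the transposition of $1$ and $n$. **Centralizer family.** Let $A$ be the upper triangular $n\times n$ matrix with diagonal entries $e^{-a_1},\dots,e^{-a_n}$, entries $-1$ just above the diagonal and $0$ elsewhere, and let $\mathscr O(\tilde{\mathscr Z})$ be the universal commutative $R(T)$-algebra with an upper triangular matrix $Z=(z_{ij})$ whose diagonal entries are invertible and such that $AZ=ZA$. Let $P$ be the lower triangular matrix with entries $P_{ij}=e_{i-j}(e^{-a_1},\dots,e^{-a_{i-1}})$ for $j\le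 i$. Let $\tau_i$ and $\sigma_i$ be the leading principal $i\times i$ minors of $ZAP$ and $ZP$ ($\tau_0=\sigma_0=1$), and let $\mathscr O(\tilde{\mathscr Z}^\circ)=\mathscr O(\tilde{\mathscr Z})[\tau_i^{-1},\sigma_i^{-1}\mid 1\le i\le n-1]$. Let $\sigma$ be the $R(T)$-algebra automorphism of $\mathscr O(\tilde{\mathscr Z})$ with $\sigma(Z)=ZA^{-1}$; one has $\sigma(\tau_i)=\sigma_i$. **Symmetric power series.** Let $\hat\Lambda$ be the ring of symmetric formal power series in $y=(y_1,y_2,\dots)$ with coefficients in $R(T)^\Delta$, and $\Omega(b_i|y)=\prod_{j\ge1}(1-b_iy_j)^{-1}$. For $1\le i\le n-1$ let $s_i$ act on $\hat\Lambda$ by exchanging $a_i$ and $a_{i+1}$ in the coefficients, and let $s_0(f)=\frac{\Omega(b_1|y)}{\Omega(b_n|y)}s_\theta(f)$, where $s_\theta$ exchanges $a_1$ and $a_n$ in the coefficients. With $\alpha_i=a_i-a_{i+1}$ ($i\neq0$) and $\alpha_0=-\theta$, put $T_i=(1-e^{\alpha_i})^{-1}(s_i-1)$ and $D_i=T_i+1$.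 The closed $K$-theoretic double $k$-Schur function of $s_0$ is $\tilde g^{(k)}_{s_0}(y|b)=D_0(1)$. With $\rho_l=s_{l-1}\cdots s_1s_0$, put $g^{(k)}_{\rho_l}(y|b)=T_{l-1}\cdots T_1T_0(1)$; for $0\le i\le n$ let $g^{(k)}_{\rho_l}(y|\omega^ib)$ be obtained from it by the $i$-fold cyclic shift $a_j\mapsto a_{j+1}$ ($a_{n+1}=a_1$) of the coefficients. Let $\beta:\mathscr O(\tilde{\mathscr Z})\to\hat\Lambda$ be the $R(T)$-algebra homomorphism with $$\beta(z_{ij})=e^{a_i+\cdots+a_{j-1}}\,\Omega(b_i|y)\,g^{(k)}_{\rho_{j-i}}(y|\omega^ib)\qquad(1\le i\le j\le n).$$ **Proposition.** There is a unique homomorphism of $R(T)$-algebras $\Phi_n:\mathscr O(\mathscr Y^\circ)\to\mathscr O(\tilde{\mathscr Z}^\circ)$ with $$\Phi_n(z_i)=\frac{\tau_i\,\sigma_{i-1}}{\sigma_i\,\tau_{i-1}}\ (1\le i\le n),\qquad \Phi_n(Q_i)=\frac{\tau_{i-1}\,\tau_{i+1}}{\tau_i^2}\ (1\le i\le n-1).$$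 Let $\tilde\Phi_n=\sigma\circ\Phi_n$, with values read in $\hat\Lambda\bigl[\sigma_i^{-1},\sigma(\sigma_i)^{-1}\mid 1\le i\le n-1\bigr]$ through $\beta$. Then $$\tilde\Phi_n\bigl(Q^{-\theta^\vee}\,\mathfrak G^Q_{s_\theta}(z|\eta)\bigr)=\tilde g^{(k)}_{s_0}(y|b).$$ -/

import Mathlib

noncomputable section

namespace KPeterson

/-- The character lattice `ℤⁿ / ℤ(1, …, 1)` of the maximal torus of `SL_n`. -/
abbrev Wt (n : ℕ) : Type :=
  (Fin n → ℤ) ⧸ AddSubgroup.zmultiples (fun _ : Fin n => (1 : ℤ))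

/-- `R(T) = ℤ[e^{±a_1}, …, e^{±a_n}] / (e^{a_1 + ⋯ + a_n} - 1)`, written as the group ring of the
character lattice. -/
def RT (n : ℕ) : Type := AddMonoidAlgebra ℤ (Wt n)

instance instCommRingRT (n : ℕ) : CommRing (RT n) :=
  inferInstanceAs (CommRing (AddMonoidAlgebra ℤ (Wt n)))

/-- The weight `a_{i+1}` (indices in `Fin n` start at `0`, the weights `a_1, …, a_n` at `1`). -/
def wt {n : ℕ} (i : Fin n) : Wt n := QuotientAddGroup.mk (Pi.single i 1)

/-- The element `e^μ` of `R(T)`. -/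
def ee {n : ℕ} (μ : Wt n) : RT n := AddMonoidAlgebra.single μ (1 : ℤ)

theorem ee_add {n : ℕ} (μ ν : Wt n) : ee (μ + ν) = ee μ * ee ν :=
  (AddMonoidAlgebra.single_mul_single (R := ℤ) μ ν 1 1).symm

theorem ee_zero {n : ℕ} : ee (0 : Wt n) = 1 := rfl

theorem ee_mul_neg {n : ℕ} (μ : Wt n) : ee μ * ee (-μ) = 1 := by
  rw [← ee_add, add_neg_cancel, ee_zero]

/-- `b_i = 1 - e^{-a_i}`. -/
def bb {n : ℕ} (i : Fin n) : RT n := 1 - ee (-wt i)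

/-- A permutation acts on weights by `a_i ↦ a_{π(i)}`. -/
def permWt {n : ℕ} (π : Equiv.Perm (Fin n)) : Wt n →+ Wt n :=
  QuotientAddGroup.map _ _
    (AddMonoidHom.mk' (fun v : Fin n → ℤ => fun i => v (π.symm i)) (fun _ _ => rfl)) (by
      rw [AddSubgroup.zmultiples_le]
      exact AddSubgroup.mem_zmultiples_iff.2 ⟨1, by ext; simp⟩)

theorem permWt_wt {n : ℕ} (π : Equiv.Perm (Fin n)) (i : Fin n) :
    permWt π (wt i) = wt (π i) := by
  change QuotientAddGroup.mk _ = QuotientAddGroup.mk _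
  congr 1
  ext j
  simp [Pi.single_apply, Equiv.symm_apply_eq]

/-- The action of the symmetric group on `R(T)`. -/
def permRT {n : ℕ} (π : Equiv.Perm (Fin n)) : RT n →+* RT n :=
  AddMonoidAlgebra.mapDomainRingHom ℤ (permWt π)

theorem permRT_ee {n : ℕ} (π : Equiv.Perm (Fin n)) (μ : Wt n) :
    permRT π (ee μ) = ee (permWt π μ) :=
  AddMonoidAlgebra.mapDomain_single

/-- The multiplicative set generated by the `1 - e^α`, where `α = a_i - a_j` (`i ≠ j`) runs over
the roots. -/
def rootSet (n : ℕ) : Submonoid (RT n) :=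
  Submonoid.closure {x | ∃ i j : Fin n, i ≠ j ∧ x = 1 - ee (wt i - wt j)}

/-- `R(T)^Δ`, the localization of `R(T)` at the elements `1 - e^α`, `α` a root. -/
def RTΔ (n : ℕ) : Type := Localization (rootSet n)

instance instCommRingRTΔ (n : ℕ) : CommRing (RTΔ n) :=
  inferInstanceAs (CommRing (Localization (rootSet n)))

instance instAlgebraRTΔ (n : ℕ) : Algebra (RT n) (RTΔ n) :=
  inferInstanceAs (Algebra (RT n) (Localization (rootSet n)))

instance instIsLocalizationRTΔ (n : ℕ) : IsLocalization (rootSet n) (RTΔ n) :=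
  inferInstanceAs (IsLocalization (rootSet n) (Localization (rootSet n)))

theorem rootSet_le_comap {n : ℕ} (π : Equiv.Perm (Fin n)) :
    rootSet n ≤ (rootSet n).comap (permRT π) := by
  rw [rootSet, Submonoid.closure_le]
  rintro _ ⟨i, j, hij, rfl⟩
  refine Submonoid.subset_closure ⟨π i, π j, π.injective.ne hij, ?_⟩
  simp [permRT_ee, permWt_wt]

/-- The level zero action of the symmetric group on `R(T)^Δ`. -/
def permRTΔ {n : ℕ} (π : Equiv.Perm (Fin n)) : RTΔ n →+* RTΔ n :=
  IsLocalization.map (RTΔ n) (permRT π) (rootSet_le_comap π)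

theorem permRTΔ_algebraMap {n : ℕ} (π : Equiv.Perm (Fin n)) (r : RT n) :
    permRTΔ π (algebraMap _ _ r) = algebraMap _ _ (permRT π r) :=
  IsLocalization.map_eq _ r

/-- The ring of symmetric formal power series in infinitely many variables `y_0, y_1, …`, with
coefficients in `R(T)^Δ` (so that division by `1 - e^α` makes sense). It contains the symmetric
formal power series with coefficients in `R(T)`. -/
def Lam (n : ℕ) : Subalgebra (RT n) (MvPowerSeries ℕ (RTΔ n)) where
  carrier := {f | ∀ e : Equiv.Perm ℕ, MvPowerSeries.rename e f = f}
  mul_mem' ha hb e := by rw [map_mul, ha e, hb e]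
  add_mem' ha hb e := by rw [map_add, ha e, hb e]
  algebraMap_mem' r e := by
    rw [IsScalarTower.algebraMap_apply (RT n) (RTΔ n) (MvPowerSeries ℕ (RTΔ n))]
    exact AlgHom.commutes _ _

/-- Constants in the ring of symmetric power series. -/
def constLam {n : ℕ} : RTΔ n →+* Lam n :=
  (MvPowerSeries.C (σ := ℕ) (R := RTΔ n)).codRestrict (Lam n)
    (fun r _ => MvPowerSeries.rename_C _ r)

theorem constLam_algebraMap {n : ℕ} (r : RT n) :
    constLam (algebraMap (RT n) (RTΔ n) r) = algebraMap (RT n) (Lam n) r := by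
  refine Subtype.ext ?_
  change MvPowerSeries.C (algebraMap (RT n) (RTΔ n) r) =
    algebraMap (RT n) (MvPowerSeries ℕ (RTΔ n)) r
  rw [IsScalarTower.algebraMap_apply (RT n) (RTΔ n) (MvPowerSeries ℕ (RTΔ n)),
    MvPowerSeries.algebraMap_apply, Algebra.algebraMap_self, RingHom.id_apply]

/-- `Ω(b|y) = ∏_j 1 / (1 - b y_j)`: expanding the geometric series, the coefficient of a monomial
of degree `d` is `b ^ d`. -/
def OmegaSeries {n : ℕ} (b : RTΔ n) : MvPowerSeries ℕ (RTΔ n) := fun m => b ^ m.degree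

theorem coeff_OmegaSeries {n : ℕ} (b : RTΔ n) (m : ℕ →₀ ℕ) :
    MvPowerSeries.coeff m (OmegaSeries b) = b ^ m.degree := rfl

/-- `Ω(b_i|y)`. -/
def Omega {n : ℕ} (i : Fin n) : Lam n :=
  ⟨OmegaSeries (algebraMap _ _ (bb i)), fun e => by
    ext m
    obtain ⟨m, rfl⟩ : ∃ m', Finsupp.embDomain e.toEmbedding m' = m :=
      ⟨m.mapDomain e.symm, by
        rw [Finsupp.embDomain_eq_mapDomain, ← Finsupp.mapDomain_comp]; simp⟩
    rw [coeff_OmegaSeries]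
    refine (MvPowerSeries.coeff_embDomain_rename e.toEmbedding _ m).trans ?_
    rw [coeff_OmegaSeries, Finsupp.embDomain_eq_mapDomain, Finsupp.degree_mapDomain]⟩

theorem isUnit_Omega {n : ℕ} (i : Fin n) : IsUnit (Omega i) := by
  have h : IsUnit (Omega i : MvPowerSeries ℕ (RTΔ n)) := by
    rw [MvPowerSeries.isUnit_iff_constantCoeff]
    have : MvPowerSeries.constantCoeff (Omega i : MvPowerSeries ℕ (RTΔ n)) = 1 := by
      rw [← MvPowerSeries.coeff_zero_eq_constantCoeff_apply]
      exact (coeff_OmegaSeries _ _).trans (by simp)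
    rw [this]; exact isUnit_one
  obtain ⟨v, hv⟩ := h.exists_right_inv
  have hsym : ∀ e : Equiv.Perm ℕ, MvPowerSeries.rename e v = v := fun e => by
    have h2 := congrArg (MvPowerSeries.rename (R := RTΔ n) e) hv
    rw [map_mul, map_one, (Omega i).2 e, ← hv] at h2
    exact h.mul_left_cancel h2
  exact IsUnit.of_mul_eq_one ⟨v, hsym⟩ (Subtype.ext hv)

/-- The action of a permutation on the coefficients of a symmetric power series. -/
def act {n : ℕ} (π : Equiv.Perm (Fin n)) : Lam n →+* Lam n :=
  ((MvPowerSeries.map (σ := ℕ) (permRTΔ π)).comp (Lam n).val.toRingHom).codRestrict (Lam n)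
    (fun f e => by
      refine (MvPowerSeries.rename_map e (permRTΔ π) (f : MvPowerSeries ℕ (RTΔ n))).trans ?_
      rw [f.2 e]; rfl)

theorem act_constLam {n : ℕ} (π : Equiv.Perm (Fin n)) (r : RTΔ n) :
    act π (constLam r) = constLam (permRTΔ π r) :=
  Subtype.ext (MvPowerSeries.map_C (σ := ℕ) (permRTΔ π) r)

theorem act_Omega {n : ℕ} (π : Equiv.Perm (Fin n)) (i : Fin n) :
    act π (Omega i) = Omega (π i) := by
  refine Subtype.ext (MvPowerSeries.ext fun m => ?_)
  refine (MvPowerSeries.coeff_map (permRTΔ π) m (OmegaSeries (algebraMap _ _ (bb i)))).trans ?_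
  change permRTΔ π (algebraMap _ _ (bb i) ^ m.degree) = algebraMap _ _ (bb (π i)) ^ m.degree
  rw [map_pow, permRTΔ_algebraMap]
  simp [bb, permRT_ee, permWt_wt]

/-- The transposition by which the affine simple reflection `s_i` acts at level zero. For
`i = 1, …, n-1` it exchanges `a_i` and `a_{i+1}`; for `i = 0` it is the reflection `s_θ`,
exchanging `a_n` and `a_1`. (Subtraction in `Fin n` is cyclic.) -/
def refl {n : ℕ} [NeZero n] (i : Fin n) : Equiv.Perm (Fin n) := Equiv.swap (i - 1) i

/-- The simple root `α_i = a_i - a_{i+1}` for `i = 1, …, n-1`, and `α_0 = -θ = a_n - a_1`. -/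
def simpleRoot {n : ℕ} [NeZero n] (i : Fin n) : Wt n := wt (i - 1) - wt i

/-- The action of the affine simple reflection `s_i` on symmetric power series: on the
coefficients for `i ≠ 0`, and `s_0 (f) = Ω(b_1|y) / Ω(b_n|y) · s_θ (f)`. -/
def affineRefl {n : ℕ} [NeZero n] (i : Fin n) (f : Lam n) : Lam n :=
  if i = 0 then Omega 0 * Ring.inverse (Omega (0 - 1)) * act (refl 0) f else act (refl i) f

/-- `T_i = (1 - e^{α_i})⁻¹ (s_i - 1)`. -/
def TT {n : ℕ} [NeZero n] (i : Fin n) (f : Lam n) : Lam n :=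
  constLam (Ring.inverse (algebraMap _ _ (1 - ee (simpleRoot i)))) * (affineRefl i f - f)

/-- The Demazure operator `D_i = T_i + 1`. -/
def DD {n : ℕ} [NeZero n] (i : Fin n) (f : Lam n) : Lam n := TT i f + f

/-- `g_x^{(k)}(y|b) = T_x (1)` (with `k = n - 1`), where `x = s_{i_1} ⋯ s_{i_l}` is given by a
reduced word `[i_1, …, i_l]`. -/
def kSchur {n : ℕ} [NeZero n] (x : List (Fin n)) : Lam n := x.foldr TT 1

/-- `g̃_x^{(k)}(y|b) = D_x (1)` (with `k = n - 1`), where `x = s_{i_1} ⋯ s_{i_l}` is given by a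
reduced word `[i_1, …, i_l]`. -/
def kSchurClosed {n : ℕ} [NeZero n] (x : List (Fin n)) : Lam n := x.foldr DD 1

/-- The reduced word of `ρ_l = s_{l-1} ⋯ s_1 s_0`. -/
def rhoWord (n : ℕ) [NeZero n] (l : ℕ) : List (Fin n) :=
  (List.range l).reverse.map (Fin.ofNat n)

/-- The cyclic permutation `ω : i ↦ i + 1` (with `n + 1 = 1`), raised to the power `m`. -/
def cyc (n : ℕ) [NeZero n] (m : ℕ) : Equiv.Perm (Fin n) := Equiv.addRight (Fin.ofNat n m)

/-- The element `e^{a_i + ⋯ + a_{j-1}} Ω(b_i|y) g_{ρ_{j-i}}(y|ω^i b)`, for `1 ≤ i ≤ j ≤ n`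
(here `i` and `j` are the numbers `i + 1` and `j + 1`), and `0` for `i > j`. -/
def betaMat (n : ℕ) [NeZero n] : Matrix (Fin n) (Fin n) (Lam n) := fun i j =>
  if i ≤ j then
    algebraMap (RT n) (Lam n) (ee (∑ k ∈ Finset.Ico i j, wt k)) * Omega i *
      act (cyc n (i + 1)) (kSchur (rhoWord n (j - i)))
  else 0

/-- The upper triangular matrix `A` with diagonal entries `e^{-a_i}` and entries `-1` just above
the diagonal. -/
def matA (n : ℕ) : Matrix (Fin n) (Fin n) (RT n) := fun i j =>
  if i = j then ee (-wt i) else if (i : ℕ) + 1 = j then -1 else 0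

/-- The lower unitriangular matrix `P`, whose `(i, j)` entry (indices starting at `1`) is the
elementary symmetric polynomial `e_{i-j}(e^{-a_1}, …, e^{-a_{i-1}})` for `j ≤ i`. -/
def matP (n : ℕ) : Matrix (Fin n) (Fin n) (RT n) := fun i j =>
  if j ≤ i then ((Finset.Iio i).val.map fun k => ee (-wt k)).esymm ((i : ℕ) - j) else 0

/-- Generators of the coordinate ring of the centralizer family: `z_{ij}` for `i ≤ j`, and
`z_{ii}⁻¹`. -/
inductive ZVar (n : ℕ) : Type
  | z (i j : Fin n) (h : i ≤ j) : ZVar n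
  | inv (i : Fin n) : ZVar n

/-- The generic upper triangular matrix. -/
def genZ (n : ℕ) : Matrix (Fin n) (Fin n) (MvPolynomial (ZVar n) (RT n)) := fun i j =>
  if h : i ≤ j then MvPolynomial.X (ZVar.z i j h) else 0

/-- The commutator `[A, Z]` of `A` with the generic upper triangular matrix. -/
def genComm (n : ℕ) : Matrix (Fin n) (Fin n) (MvPolynomial (ZVar n) (RT n)) :=
  (matA n).map MvPolynomial.C * genZ n - genZ n * (matA n).map MvPolynomial.C

/-- The relations `[A, Z] = 0` and `z_{ii} z_{ii}⁻¹ = 1`. -/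
def relZ (n : ℕ) : Ideal (MvPolynomial (ZVar n) (RT n)) :=
  Ideal.span
    ({f | ∃ i j : Fin n, f = genComm n i j} ∪
      {f | ∃ i : Fin n, f = genZ n i i * MvPolynomial.X (ZVar.inv i) - 1})

/-- The coordinate ring of the centralizer family: the universal `R(T)`-algebra with an
invertible upper triangular matrix `Z` commuting with `A`. -/
def OZ (n : ℕ) : Type := MvPolynomial (ZVar n) (RT n) ⧸ relZ n

instance instCommRingOZ (n : ℕ) : CommRing (OZ n) :=
  inferInstanceAs (CommRing (MvPolynomial (ZVar n) (RT n) ⧸ relZ n))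

instance instAlgebraOZ (n : ℕ) : Algebra (RT n) (OZ n) :=
  inferInstanceAs (Algebra (RT n) (MvPolynomial (ZVar n) (RT n) ⧸ relZ n))

/-- The quotient map onto the coordinate ring. -/
def mkZ (n : ℕ) : MvPolynomial (ZVar n) (RT n) →ₐ[RT n] OZ n := Ideal.Quotient.mkₐ (RT n) (relZ n)

/-- The matrix `Z` of coordinate functions. -/
def matZ (n : ℕ) : Matrix (Fin n) (Fin n) (OZ n) := (genZ n).map (mkZ n)

/-- The matrix `A` with entries in an `R(T)`-algebra. -/
def matAin (n : ℕ) (S : Type*) [CommRing S] [Algebra (RT n) S] : Matrix (Fin n) (Fin n) S :=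
  (matA n).map (algebraMap (RT n) S)

theorem matZ_comm (n : ℕ) : matAin n (OZ n) * matZ n = matZ n * matAin n (OZ n) := by
  ext i j
  have h : mkZ n (genComm n i j) = 0 :=
    Ideal.Quotient.eq_zero_iff_mem.2 (Ideal.subset_span (Or.inl ⟨i, j, rfl⟩))
  have hC : ∀ r : RT n, mkZ n (MvPolynomial.C r) = algebraMap (RT n) (OZ n) r :=
    fun r => (mkZ n).commutes r
  rw [genComm, Matrix.sub_apply, map_sub, sub_eq_zero] at h
  simpa [Matrix.mul_apply, matAin, matZ, hC] using h

theorem matZ_inv (n : ℕ) (i : Fin n) :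
    matZ n i i * mkZ n (MvPolynomial.X (ZVar.inv i)) = 1 := by
  have h : mkZ n (genZ n i i * MvPolynomial.X (ZVar.inv i) - 1) = 0 :=
    Ideal.Quotient.eq_zero_iff_mem.2 (Ideal.subset_span (Or.inr ⟨i, rfl⟩))
  rw [map_sub, sub_eq_zero, map_mul, map_one] at h
  exact h

theorem matZ_upper (n : ℕ) {i j : Fin n} (h : j < i) : matZ n i j = 0 := by
  simp [matZ, genZ, not_le.2 h]

/-- The universal property of the coordinate ring. -/
def liftZ {n : ℕ} {S : Type*} [CommRing S] [Algebra (RT n) S] (M : Matrix (Fin n) (Fin n) S)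
    (w : Fin n → S) (hup : ∀ i j : Fin n, j < i → M i j = 0)
    (hcomm : matAin n S * M = M * matAin n S) (hinv : ∀ i, M i i * w i = 1) :
    OZ n →ₐ[RT n] S :=
  Ideal.Quotient.liftₐ (relZ n)
    (MvPolynomial.aeval fun v : ZVar n => match v with
      | ZVar.z i j _ => M i j
      | ZVar.inv i => w i) (by
    have hM : ∀ i j, MvPolynomial.aeval (fun v : ZVar n => match v with
      | ZVar.z i j _ => M i j
      | ZVar.inv i => w i) (genZ n i j) = M i j := by
      intro i j
      by_cases h : i ≤ j
      · simp [genZ, h]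
      · simp [genZ, h, hup i j (not_le.1 h)]
    change ∀ a ∈ relZ n, _
    intro a ha
    rw [← RingHom.mem_ker]
    refine (Ideal.span_le (I := RingHom.ker (MvPolynomial.aeval (R := RT n) _))).2 ?_ ha
    rintro _ (⟨i, j, rfl⟩ | ⟨i, rfl⟩)
    · have := congrFun (congrFun hcomm i) j
      rw [← sub_eq_zero] at this
      simpa [RingHom.mem_ker, genComm, Matrix.mul_apply, hM, matAin] using this
    · simp [RingHom.mem_ker, hM, hinv])

theorem liftZ_matZ {n : ℕ} {S : Type*} [CommRing S] [Algebra (RT n) S]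
    (M : Matrix (Fin n) (Fin n) S) (w : Fin n → S) (hup : ∀ i j : Fin n, j < i → M i j = 0)
    (hcomm : matAin n S * M = M * matAin n S) (hinv : ∀ i, M i i * w i = 1) (i j : Fin n) :
    liftZ M w hup hcomm hinv (matZ n i j) = M i j := by
  by_cases h : i ≤ j
  · have : matZ n i j = mkZ n (MvPolynomial.X (ZVar.z i j h)) := by simp [matZ, genZ, h]
    rw [this]
    exact MvPolynomial.aeval_X _ _
  · rw [matZ_upper n (not_le.1 h), map_zero, hup i j (not_le.1 h)]

theorem det_matA_isUnit (n : ℕ) : IsUnit (matA n).det := by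
  have hup : (matA n).BlockTriangular id := fun i j (h : j < i) => by
    have h1 : i ≠ j := h.ne'
    have h2 : ¬ ((i : ℕ) + 1 = j) := by have : (j : ℕ) < i := h; omega
    simp [matA, h1, h2]
  rw [Matrix.det_of_isUpperTriangular hup]
  refine IsUnit.prod_univ_iff.2 fun i => ?_
  simpa [matA] using IsUnit.of_mul_eq_one _ (by rw [mul_comm]; exact ee_mul_neg (wt i))

theorem inv_matA_upper (n : ℕ) {i j : Fin n} (h : j < i) : (matA n)⁻¹ i j = 0 := by
  have := (matA n).invertibleOfIsUnitDet (det_matA_isUnit n)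
  have hup : (matA n).BlockTriangular id := fun i j (h : j < i) => by
    have h1 : i ≠ j := h.ne'
    have h2 : ¬ ((i : ℕ) + 1 = j) := by have : (j : ℕ) < i := h; omega
    simp [matA, h1, h2]
  exact Matrix.blockTriangular_inv_of_blockTriangular hup h

theorem inv_matA_diag (n : ℕ) (i : Fin n) : ee (-wt i) * (matA n)⁻¹ i i = 1 := by
  have h := congrFun (congrFun (Matrix.mul_nonsing_inv (matA n) (det_matA_isUnit n)) i) i
  rw [Matrix.mul_apply, Finset.sum_eq_single i, Matrix.one_apply_eq] at h
  · simpa [matA] using h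
  · intro k _ hk
    rcases lt_or_gt_of_ne hk with hk | hk
    · have h2 : ¬ ((i : ℕ) + 1 = k) := by have : (k : ℕ) < i := hk; omega
      simp [matA, hk.ne', h2]
    · rw [inv_matA_upper n hk, mul_zero]
  · simp

/-- The matrix `Z A⁻¹`. -/
def matZAinv (n : ℕ) : Matrix (Fin n) (Fin n) (OZ n) :=
  matZ n * (matA n)⁻¹.map (algebraMap (RT n) (OZ n))

/-- The automorphism `σ` of the coordinate ring, `σ(Z) = Z A⁻¹`. -/
def sigmaZ (n : ℕ) : OZ n →ₐ[RT n] OZ n :=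
  liftZ (matZAinv n)
    (fun i => mkZ n (MvPolynomial.X (ZVar.inv i)) * algebraMap (RT n) (OZ n) (ee (-wt i)))
    (fun i j h => by
      rw [matZAinv, Matrix.mul_apply]
      refine Finset.sum_eq_zero fun k _ => ?_
      rcases lt_or_ge k i with hk | hk
      · rw [matZ_upper n hk, zero_mul]
      · rw [Matrix.map_apply, inv_matA_upper n (h.trans_le hk), map_zero, mul_zero])
    (by
      have h1 : matAin n (OZ n) * (matA n)⁻¹.map (algebraMap (RT n) (OZ n)) = 1 := by
        rw [matAin, ← Matrix.map_mul, Matrix.mul_nonsing_inv _ (det_matA_isUnit n)]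
        simp
      have h2 : (matA n)⁻¹.map (algebraMap (RT n) (OZ n)) * matAin n (OZ n) = 1 := by
        rw [matAin, ← Matrix.map_mul, Matrix.nonsing_inv_mul _ (det_matA_isUnit n)]
        simp
      rw [matZAinv, ← Matrix.mul_assoc, matZ_comm, Matrix.mul_assoc, Matrix.mul_assoc, h1, h2])
    (fun i => by
      have h : matZAinv n i i = matZ n i i * algebraMap (RT n) (OZ n) ((matA n)⁻¹ i i) := by
        rw [matZAinv, Matrix.mul_apply, Finset.sum_eq_single i, Matrix.map_apply]
        · intro k _ hk
          rcases lt_or_gt_of_ne hk with hk | hk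
          · rw [matZ_upper n hk, zero_mul]
          · rw [Matrix.map_apply, inv_matA_upper n hk, map_zero, mul_zero]
        · simp
      have h2 := congrArg (algebraMap (RT n) (OZ n)) (inv_matA_diag n i)
      rw [map_mul, map_one] at h2
      rw [h]
      linear_combination
        (algebraMap (RT n) (OZ n) ((matA n)⁻¹ i i) * algebraMap (RT n) (OZ n) (ee (-wt i))) *
          matZ_inv n i + h2)

/-- Multiplication by `A` from the left. -/
theorem matAin_mul {n : ℕ} {S : Type*} [CommRing S] [Algebra (RT n) S]
    (M : Matrix (Fin n) (Fin n) S) (i j : Fin n) :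
    (matAin n S * M) i j = algebraMap (RT n) S (ee (-wt i)) * M i j -
      (if h : (i : ℕ) + 1 < n then M ⟨i + 1, h⟩ j else 0) := by
  have h1 : ∀ k, matAin n S i k * M k j =
      (if i = k then algebraMap (RT n) S (ee (-wt i)) * M i j else 0) -
        (if (i : ℕ) + 1 = k then M k j else 0) := by
    intro k
    rw [matAin, Matrix.map_apply, matA]
    by_cases h : i = k
    · subst h; simp
    · by_cases h' : (i : ℕ) + 1 = k <;> simp [h, h']
  rw [Matrix.mul_apply, Finset.sum_congr rfl fun k _ => h1 k, Finset.sum_sub_distrib]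
  congr 1
  · simp
  · split_ifs with h
    · rw [Finset.sum_eq_single ⟨i + 1, h⟩]
      · simp
      · intro k _ hk
        rw [if_neg]
        rintro h'
        exact hk (Fin.ext h'.symm)
      · simp
    · refine Finset.sum_eq_zero fun k _ => if_neg fun h' => h ?_
      rw [h']; exact k.2

/-- Multiplication by `A` from the right. -/
theorem mul_matAin {n : ℕ} {S : Type*} [CommRing S] [Algebra (RT n) S]
    (M : Matrix (Fin n) (Fin n) S) (i j : Fin n) :
    (M * matAin n S) i j = algebraMap (RT n) S (ee (-wt j)) * M i j -
      (if h : 0 < (j : ℕ) then M i ⟨j - 1, by omega⟩ else 0) := by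
  have h1 : ∀ k, M i k * matAin n S k j =
      (if k = j then algebraMap (RT n) S (ee (-wt j)) * M i j else 0) -
        (if (k : ℕ) + 1 = j then M i k else 0) := by
    intro k
    rw [matAin, Matrix.map_apply, matA]
    by_cases h : k = j
    · subst h; simp [mul_comm]
    · by_cases h' : (k : ℕ) + 1 = j <;> simp [h, h']
  rw [Matrix.mul_apply, Finset.sum_congr rfl fun k _ => h1 k, Finset.sum_sub_distrib]
  congr 1
  · simp
  · split_ifs with h
    · rw [Finset.sum_eq_single ⟨j - 1, by omega⟩]
      · rw [if_pos]; simp; omega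
      · intro k _ hk
        rw [if_neg]
        rintro h'
        exact hk (Fin.ext (by simp; omega))
      · simp
    · refine Finset.sum_eq_zero fun k _ => if_neg fun h' => h ?_
      omega

theorem isUnit_root {n : ℕ} {i j : Fin n} (h : i ≠ j) :
    IsUnit (algebraMap (RT n) (RTΔ n) (1 - ee (wt i - wt j))) :=
  IsLocalization.map_units (RTΔ n)
    (⟨_, Submonoid.subset_closure ⟨i, j, h, rfl⟩⟩ : rootSet n)

/-- The constant `e^{-a_i}`. -/
def uu {n : ℕ} (i : Fin n) : Lam n := algebraMap (RT n) (Lam n) (ee (-wt i))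

theorem act_algebraMap {n : ℕ} (π : Equiv.Perm (Fin n)) (r : RT n) :
    act π (algebraMap (RT n) (Lam n) r) = algebraMap (RT n) (Lam n) (permRT π r) := by
  rw [← constLam_algebraMap, act_constLam, permRTΔ_algebraMap, constLam_algebraMap]

theorem act_uu {n : ℕ} (π : Equiv.Perm (Fin n)) (i : Fin n) : act π (uu i) = uu (π i) := by
  rw [uu, act_algebraMap, permRT_ee, map_neg, permWt_wt, uu]

theorem permWt_mul {n : ℕ} (π ρ : Equiv.Perm (Fin n)) (μ : Wt n) :
    permWt (π * ρ) μ = permWt π (permWt ρ μ) := by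
  induction μ using QuotientAddGroup.induction_on with
  | H v => rfl

theorem permRT_mul {n : ℕ} (π ρ : Equiv.Perm (Fin n)) (r : RT n) :
    permRT (π * ρ) r = permRT π (permRT ρ r) := by
  have h : permRT (π * ρ) = (permRT π).comp (permRT ρ) := by
    refine AddMonoidAlgebra.ringHom_ext (fun z => ?_) (fun μ => ?_)
    · exact (map_intCast (permRT (π * ρ)) z).trans
        (map_intCast ((permRT π).comp (permRT ρ)) z).symm
    · change permRT (π * ρ) (ee μ) = permRT π (permRT ρ (ee μ))
      rw [permRT_ee, permRT_ee, permRT_ee, permWt_mul]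
  rw [h]; rfl

theorem permRTΔ_mul {n : ℕ} (π ρ : Equiv.Perm (Fin n)) (r : RTΔ n) :
    permRTΔ (π * ρ) r = permRTΔ π (permRTΔ ρ r) := by
  have h : permRTΔ (π * ρ) = (permRTΔ π).comp (permRTΔ ρ) := by
    refine IsLocalization.ringHom_ext (rootSet n) (RingHom.ext fun r => ?_)
    simp only [RingHom.comp_apply, permRTΔ_algebraMap, permRT_mul]
  rw [h]; rfl

theorem act_mul {n : ℕ} (π ρ : Equiv.Perm (Fin n)) (f : Lam n) :
    act (π * ρ) f = act π (act ρ f) := by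
  refine Subtype.ext (MvPowerSeries.ext fun m => ?_)
  refine (MvPowerSeries.coeff_map (permRTΔ (π * ρ)) m f.1).trans ?_
  refine Eq.trans ?_ (MvPowerSeries.coeff_map (permRTΔ π) m (act ρ f).1).symm
  rw [permRTΔ_mul]
  exact congrArg _ (MvPowerSeries.coeff_map (permRTΔ ρ) m f.1).symm

/-- A natural number as a cyclic index. -/
def ix (n : ℕ) [NeZero n] (k : ℕ) : Fin n := Fin.ofNat n k

theorem ix_val {n : ℕ} [NeZero n] {k : ℕ} (h : k < n) : (ix n k : ℕ) = k := Nat.mod_eq_of_lt h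

theorem ix_ne {n : ℕ} [NeZero n] {k l : ℕ} (hk : k < n) (hl : l < n) (h : k ≠ l) :
    ix n k ≠ ix n l := fun h' => h (by rw [← ix_val hk, ← ix_val hl, h'])

theorem cyc_ix {n : ℕ} [NeZero n] (m k : ℕ) : cyc n m (ix n k) = ix n (k + m) := by
  refine Fin.ext ?_
  simp [cyc, ix, Fin.val_add]

theorem ix_sub {n : ℕ} [NeZero n] (k : ℕ) : ix n (k + 1) - 1 = ix n k := by
  rw [sub_eq_iff_eq_add]
  refine Fin.ext ?_
  simp [ix, Fin.val_add]

theorem cyc_zero_sub {n : ℕ} [NeZero n] (m : ℕ) : cyc n (m + 1) (0 - 1) = ix n m := by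
  change (0 - 1 : Fin n) + ix n (m + 1) = ix n m
  rw [← ix_sub (n := n) m]; abel

theorem TT_spec {n : ℕ} [NeZero n] (i : Fin n) (h : i - 1 ≠ i) (f : Lam n) :
    algebraMap (RT n) (Lam n) (1 - ee (simpleRoot i)) * TT i f = affineRefl i f - f := by
  have hu : IsUnit (algebraMap (RT n) (RTΔ n) (1 - ee (simpleRoot i))) := isUnit_root h
  rw [TT, ← mul_assoc, ← constLam_algebraMap, ← map_mul, Ring.mul_inverse_cancel _ hu, map_one,
    one_mul]

theorem kSchur_rhoWord_succ {n : ℕ} [NeZero n] (l : ℕ) :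
    kSchur (rhoWord n (l + 1)) = TT (ix n l) (kSchur (rhoWord n l)) := by
  simp [kSchur, rhoWord, List.range_succ, ix]

/-- The entries of `betaMat`, in terms of natural numbers. -/
def betaAux (n : ℕ) [NeZero n] (i l : ℕ) : Lam n :=
  algebraMap (RT n) (Lam n) (ee (∑ k ∈ Finset.range l, wt (ix n (i + k)))) * Omega (ix n i) *
    act (cyc n (i + 1)) (kSchur (rhoWord n l))

theorem betaAux_zero {n : ℕ} [NeZero n] (i : ℕ) : betaAux n i 0 = Omega (ix n i) := by
  simp [betaAux, ee_zero, kSchur, rhoWord]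

theorem algebraMap_sub_ee {n : ℕ} (i j : Fin n) :
    algebraMap (RT n) (Lam n) (1 - ee (wt i - wt j)) =
      algebraMap (RT n) (Lam n) (ee (wt i)) * (uu i - uu j) := by
  rw [uu, uu, ← map_sub, ← map_mul, mul_sub, ee_mul_neg, ← ee_add, sub_eq_add_neg (wt i)]

theorem isUnit_uu_sub {n : ℕ} {i j : Fin n} (h : i ≠ j) : IsUnit (uu i - uu j) := by
  have h1 := (isUnit_root h).map (constLam (n := n))
  rw [constLam_algebraMap, algebraMap_sub_ee] at h1
  exact isUnit_of_mul_isUnit_right h1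

theorem betaAux_rec {n : ℕ} [NeZero n] (i l : ℕ) (h : i + l + 1 < n) :
    (uu (ix n (i + l)) - uu (ix n (i + l + 1))) * betaAux n i (l + 1) =
      act (Equiv.swap (ix n (i + l)) (ix n (i + l + 1))) (betaAux n i l) - betaAux n i l := by
  have hl : ix n l - 1 ≠ ix n l := by
    cases l with
    | zero =>
      intro h0
      have h1 : (1 : Fin n) = 0 := by simpa using h0
      have := congrArg Fin.val h1
      rw [Fin.val_one', Nat.mod_eq_of_lt (by omega)] at this
      simp at this
    | succ m => rw [ix_sub]; exact ix_ne (by omega) (by omega) (by omega)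
  have key := congrArg (act (cyc n (i + 1))) (TT_spec (ix n l) hl (kSchur (rhoWord n l)))
  rw [← kSchur_rhoWord_succ, map_mul, act_algebraMap, map_sub (act _), map_sub (permRT _), map_one,
    permRT_ee, simpleRoot, map_sub (permWt _), permWt_wt, permWt_wt] at key
  have hc1 : cyc n (i + 1) (ix n l) = ix n (i + l + 1) := by
    rw [cyc_ix]; congr 1; omega
  have hc0 : cyc n (i + 1) (ix n l - 1) = ix n (i + l) := by
    cases l with
    | zero => exact cyc_zero_sub i
    | succ m => rw [ix_sub, cyc_ix]; congr 1; omega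
  rw [hc1, hc0, algebraMap_sub_ee] at key
  have hsum : algebraMap (RT n) (Lam n) (ee (∑ k ∈ Finset.range (l + 1), wt (ix n (i + k)))) =
      algebraMap (RT n) (Lam n) (ee (∑ k ∈ Finset.range l, wt (ix n (i + k)))) *
        algebraMap (RT n) (Lam n) (ee (wt (ix n (i + l)))) := by
    rw [Finset.sum_range_succ, ee_add, map_mul]
  have main : (uu (ix n (i + l)) - uu (ix n (i + l + 1))) * betaAux n i (l + 1) =
      algebraMap (RT n) (Lam n) (ee (∑ k ∈ Finset.range l, wt (ix n (i + k)))) *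
        Omega (ix n i) * (act (cyc n (i + 1)) (affineRefl (ix n l) (kSchur (rhoWord n l))) -
          act (cyc n (i + 1)) (kSchur (rhoWord n l))) := by
    rw [betaAux, hsum, ← key]; ring
  rw [main, mul_sub]
  refine congrArg₂ _ ?_ rfl
  cases l with
  | zero =>
    have h0 : ix n 0 = 0 := rfl
    have hz : cyc n (i + 1) 0 = ix n (i + 1) := by rw [← h0, cyc_ix, Nat.zero_add]
    have hi : act (cyc n (i + 1)) (Ring.inverse (Omega (0 - 1))) * Omega (ix n i) = 1 := by
      have := congrArg (act (cyc n (i + 1))) (Ring.inverse_mul_cancel _ (isUnit_Omega (0 - 1)))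
      rwa [map_mul, act_Omega, cyc_zero_sub, map_one] at this
    rw [betaAux_zero, act_Omega, h0, affineRefl, if_pos rfl, map_mul, map_mul, act_Omega, hz]
    simp only [kSchur, rhoWord, List.range_zero, List.reverse_nil, List.map_nil, List.foldr_nil,
      map_one, Finset.range_zero, Finset.sum_empty, ee_zero, Nat.add_zero, Equiv.swap_apply_left]
    linear_combination Omega (ix n (i + 1)) * hi
  | succ m =>
    have hm : ix n (m + 1) ≠ 0 := ix_ne (n := n) (l := 0) (by omega) (by omega) (by omega)
    have hπ : cyc n (i + 1) * refl (ix n (m + 1)) =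
        Equiv.swap (ix n (i + (m + 1))) (ix n (i + (m + 1) + 1)) * cyc n (i + 1) := by
      rw [refl, Equiv.mul_swap_eq_swap_mul, hc0, hc1]
    have hfix : ∀ k < m + 1, Equiv.swap (ix n (i + (m + 1))) (ix n (i + (m + 1) + 1))
        (ix n (i + k)) = ix n (i + k) := fun k hk =>
      Equiv.swap_apply_of_ne_of_ne (ix_ne (by omega) (by omega) (by omega))
        (ix_ne (by omega) (by omega) (by omega))
    rw [affineRefl, if_neg hm, ← act_mul, hπ, act_mul, betaAux, map_mul, map_mul, act_Omega,
      act_algebraMap, permRT_ee, map_sum]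
    have h0 : Equiv.swap (ix n (i + (m + 1))) (ix n (i + (m + 1) + 1)) (ix n i) = ix n i :=
      hfix 0 (by omega)
    have h1 : ∑ k ∈ Finset.range (m + 1), permWt (Equiv.swap (ix n (i + (m + 1)))
        (ix n (i + (m + 1) + 1))) (wt (ix n (i + k))) =
        ∑ k ∈ Finset.range (m + 1), wt (ix n (i + k)) :=
      Finset.sum_congr rfl fun k hk => by rw [permWt_wt, hfix k (Finset.mem_range.1 hk)]
    rw [h0, h1]

theorem betaAux_main {n : ℕ} [NeZero n] (l : ℕ) :
    (∀ i, i + l < n → ∀ π : Equiv.Perm (Fin n),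
      (∀ k ≤ l, π (ix n (i + k)) = ix n (i + k)) → act π (betaAux n i l) = betaAux n i l) ∧
    (∀ i, i + l + 1 < n → (uu (ix n i) - uu (ix n (i + l + 1))) * betaAux n i (l + 1) =
      betaAux n (i + 1) l - betaAux n i l) := by
  induction l with
  | zero =>
    refine ⟨fun i hi π hπ => ?_, fun i hi => ?_⟩
    · rw [betaAux_zero, act_Omega]
      have := hπ 0 le_rfl
      rw [Nat.add_zero] at this
      rw [this]
    · have := betaAux_rec (n := n) i 0 hi
      rw [betaAux_zero, act_Omega, Nat.add_zero, Equiv.swap_apply_left] at this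
      rw [Nat.add_zero, this, betaAux_zero, betaAux_zero]
  | succ l ih =>
    obtain ⟨V, D⟩ := ih
    refine ⟨fun i hi π hπ => ?_, fun i hi => ?_⟩
    · have hu := isUnit_uu_sub (ix_ne (n := n) (k := i) (l := i + l + 1) (by omega) (by omega)
        (by omega))
      refine hu.mul_left_cancel ?_
      rw [D i hi, ← V i (by omega) π fun k hk => hπ k (by omega),
        ← V (i + 1) (by omega) π fun k hk => by
          have := hπ (k + 1) (by omega)
          rwa [← Nat.add_assoc, Nat.add_right_comm] at this,
        ← map_sub, ← D i hi, map_mul, map_sub, act_uu, act_uu]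
      have h0 := hπ 0 (by omega)
      have h1 := hπ (l + 1) (by omega)
      rw [Nat.add_zero] at h0
      rw [← Nat.add_assoc] at h1
      rw [h0, h1]
    · have hu := isUnit_uu_sub (ix_ne (n := n) (k := i + l + 1) (l := i + l + 2) (by omega)
        (by omega) (by omega))
      have R1 := betaAux_rec (n := n) i (l + 1) (by omega)
      have R2 := betaAux_rec (n := n) (i + 1) l (by omega)
      have D1 := D i (by omega)
      rw [show i + (l + 1) = i + l + 1 by omega, show i + l + 1 + 1 = i + l + 2 by omega] at R1
      rw [show i + 1 + l = i + l + 1 by omega, show i + l + 1 + 1 = i + l + 2 by omega] at R2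
      have hs : ∀ k ≤ l, Equiv.swap (ix n (i + l + 1)) (ix n (i + l + 2)) (ix n (i + k)) =
          ix n (i + k) := fun k hk =>
        Equiv.swap_apply_of_ne_of_ne (ix_ne (by omega) (by omega) (by omega))
          (ix_ne (by omega) (by omega) (by omega))
      have D2 := congrArg (act (Equiv.swap (ix n (i + l + 1)) (ix n (i + l + 2)))) D1
      have h0 : Equiv.swap (ix n (i + l + 1)) (ix n (i + l + 2)) (ix n i) = ix n i :=
        hs 0 (by omega)
      rw [map_mul, map_sub, map_sub, act_uu, act_uu, h0, Equiv.swap_apply_left,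
        V i (by omega) _ hs] at D2
      rw [show i + (l + 1) + 1 = i + l + 2 by omega]
      refine hu.mul_left_cancel ?_
      linear_combination (uu (ix n i) - uu (ix n (i + l + 2))) * R1 + D2 - D1 - R2

theorem betaMat_eq {n : ℕ} [NeZero n] {i j : Fin n} (h : i ≤ j) :
    betaMat n i j = betaAux n i (j - i) := by
  have hi : ix n i = i := Fin.ext (ix_val i.2)
  have hsum : ∑ k ∈ Finset.Ico i j, wt k = ∑ k ∈ Finset.range ((j : ℕ) - i), wt (ix n (i + k)) := by
    symm
    refine Finset.sum_bij (fun k _ => ix n (i + k)) ?_ ?_ ?_ ?_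
    · intro k hk
      have hk' := Finset.mem_range.1 hk
      have hv : (ix n (i + k) : ℕ) = i + k := ix_val (by omega)
      rw [Finset.mem_Ico, Fin.le_def, Fin.lt_def, hv]
      omega
    · intro k hk k' hk' hkk
      have h1 := Finset.mem_range.1 hk
      have h2 := Finset.mem_range.1 hk'
      by_contra hne
      exact ix_ne (by omega) (by omega) (by omega) hkk
    · intro b hb
      rw [Finset.mem_Ico, Fin.le_def, Fin.lt_def] at hb
      refine ⟨b - i, Finset.mem_range.2 (by omega), Fin.ext ?_⟩
      rw [ix_val (by omega)]; omega
    · intro k _; rfl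
  rw [betaMat, if_pos h, betaAux, hsum, hi]

/-- The homomorphism `β` from the coordinate ring of the centralizer family to symmetric power
series, `β(z_{ij}) = e^{a_i + ⋯ + a_{j-1}} Ω(b_i|y) g_{ρ_{j-i}}(y|ω^i b)`. -/
def beta (n : ℕ) [NeZero n] : OZ n →ₐ[RT n] Lam n :=
  liftZ (betaMat n) (fun i => Ring.inverse (Omega i))
    (fun i j h => if_neg (not_le.2 h))
    (by
      refine Matrix.ext fun i j => ?_
      rw [matAin_mul, mul_matAin]
      rcases lt_or_ge i j with h | h
      · have hij : (i : ℕ) < j := h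
        rw [dif_pos (show (i : ℕ) + 1 < n by omega), dif_pos (show 0 < (j : ℕ) by omega),
          betaMat_eq h.le, betaMat_eq (Fin.le_def.2 (by simp; omega)),
          betaMat_eq (Fin.le_def.2 (by simp; omega))]
        obtain ⟨l, hl⟩ : ∃ l, (j : ℕ) = i + l + 1 := ⟨j - i - 1, by omega⟩
        have D := (betaAux_main (n := n) l).2 i (by omega)
        have hi : ix n i = i := Fin.ext (ix_val i.2)
        have hj : ix n (i + l + 1) = j := Fin.ext (by rw [ix_val (by omega), hl])
        rw [hi, hj, uu, uu] at D
        rw [show (j : ℕ) - i = l + 1 by omega, show (j : ℕ) - (i + 1) = l by omega,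
          show (j : ℕ) - 1 - i = l by omega]
        linear_combination D
      · have h1 : ∀ hh : (i : ℕ) + 1 < n, betaMat n ⟨i + 1, hh⟩ j = 0 := fun hh =>
          if_neg (by rw [Fin.le_def] at h ⊢; simp; omega)
        have h2 : ∀ hh : 0 < (j : ℕ), betaMat n i ⟨j - 1, by omega⟩ = 0 := fun hh =>
          if_neg (by rw [Fin.le_def] at h ⊢; simp; omega)
        have h3 : (if hh : (i : ℕ) + 1 < n then betaMat n ⟨i + 1, hh⟩ j else 0) = 0 := by
          split_ifs with hh
          · exact h1 hh
          · rfl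
        have h4 : (if hh : 0 < (j : ℕ) then betaMat n i ⟨j - 1, by omega⟩ else 0) = 0 := by
          split_ifs with hh
          · exact h2 hh
          · rfl
        rw [h3, h4]
        rcases eq_or_lt_of_le h with rfl | h
        · rfl
        · rw [show betaMat n i j = 0 from if_neg (not_le.2 h), mul_zero, mul_zero])
    (fun i => by
      have hi : ix n i = i := Fin.ext (ix_val i.2)
      rw [betaMat_eq le_rfl, Nat.sub_self, betaAux_zero, hi,
        Ring.mul_inverse_cancel _ (isUnit_Omega i)])

/-- The leading principal minor of size `m` (the whole determinant for `m ≥ n`). -/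
def minor {n : ℕ} {S : Type*} [CommRing S] (m : ℕ) (M : Matrix (Fin n) (Fin n) S) : S :=
  (M.toSquareBlockProp fun i => (i : ℕ) < m).det

/-- `τ_m`, the leading principal minor of size `m` of `Z A P`; in particular `τ_0 = 1`. -/
def tau (n m : ℕ) : OZ n :=
  minor m (matZ n * matAin n (OZ n) * (matP n).map (algebraMap (RT n) (OZ n)))

/-- `σ_m`, the leading principal minor of size `m` of `Z P`; in particular `σ_0 = 1`. -/
def sig (n m : ℕ) : OZ n :=
  minor m (matZ n * (matP n).map (algebraMap (RT n) (OZ n)))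

/-- The multiplicative set generated by the `τ_m` and `σ_m`. Only `1 ≤ m ≤ n - 1` matters, since
`τ_0 = σ_0 = 1` and `τ_n = σ_n = z_{11} ⋯ z_{nn}` is already invertible. -/
def tauSet (n : ℕ) : Submonoid (OZ n) :=
  Submonoid.closure {f | ∃ m ≤ n, f = tau n m ∨ f = sig n m}

theorem tau_mem {n m : ℕ} (h : m ≤ n) : tau n m ∈ tauSet n :=
  Submonoid.subset_closure ⟨m, h, Or.inl rfl⟩

theorem sig_mem {n m : ℕ} (h : m ≤ n) : sig n m ∈ tauSet n :=
  Submonoid.subset_closure ⟨m, h, Or.inr rfl⟩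

/-- The coordinate ring of the open part of the centralizer family, where all `τ_m` and `σ_m` are
invertible. -/
def OZo (n : ℕ) : Type := Localization (tauSet n)

instance instCommRingOZo (n : ℕ) : CommRing (OZo n) :=
  inferInstanceAs (CommRing (Localization (tauSet n)))

instance instAlgebraOZOZo (n : ℕ) : Algebra (OZ n) (OZo n) :=
  inferInstanceAs (Algebra (OZ n) (Localization (tauSet n)))

instance instAlgebraRTOZo (n : ℕ) : Algebra (RT n) (OZo n) :=
  inferInstanceAs (Algebra (RT n) (Localization (tauSet n)))

instance instIsScalarTowerOZo (n : ℕ) : IsScalarTower (RT n) (OZ n) (OZo n) :=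
  inferInstanceAs (IsScalarTower (RT n) (OZ n) (Localization (tauSet n)))

instance instIsLocalizationOZo (n : ℕ) : IsLocalization (tauSet n) (OZo n) :=
  inferInstanceAs (IsLocalization (tauSet n) (Localization (tauSet n)))

/-- The composite `β ∘ σ`: the automorphism `σ` of the coordinate ring, followed by the
realization `β` of its elements as symmetric power series. -/
def betaSigma (n : ℕ) [NeZero n] : OZ n →ₐ[RT n] Lam n := (beta n).comp (sigmaZ n)

/-- The images under `β` of the products of the `σ(τ_m) = σ_m` and `σ(σ_m)`. -/
def lamSet (n : ℕ) [NeZero n] : Submonoid (Lam n) := (tauSet n).map (betaSigma n)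

/-- The ring of symmetric power series with the elements `σ_m` and `σ(σ_m)` inverted. -/
abbrev LamLoc (n : ℕ) [NeZero n] : Type := Localization (lamSet n)

/-- The extension of `β ∘ σ` to the localizations. The map `Φ̃_n` is its composite with `Φ_n`. -/
def betaSigmaLoc (n : ℕ) [NeZero n] : OZo n →+* LamLoc n :=
  IsLocalization.map (M := tauSet n) (S := OZo n) (T := lamSet n) (LamLoc n)
    (betaSigma n : OZ n →+* Lam n) (Submonoid.le_comap_map _)

/-- Extension of a finite sequence by zero. -/
def extZero {S : Type*} [Zero S] {m : ℕ} (f : Fin m → S) (j : ℕ) : S :=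
  if h : j < m then f ⟨j, h⟩ else 0

/-- The polynomial `F_m^{(i)} = ∑_{J ⊆ {1, …, i}, |J| = m} ∏_{j ∈ J, j + 1 ∉ J} (1 - Q_j) ∏_{j ∈ J} z_j`.
Here `z_{j+1}` and `Q_{j+1}` are written `z j` and `Q j`. -/
def todaF {S : Type*} [CommRing S] (z Q : ℕ → S) (i m : ℕ) : S :=
  ∑ J ∈ (Finset.range i).powersetCard m,
    (∏ j ∈ J with j + 1 ∉ J, (1 - Q j)) * ∏ j ∈ J, z j

/-- Coordinates `z_1, …, z_n, Q_1, …, Q_{n-1}` of the phase space of the relativistic Toda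
lattice. -/
inductive YVar (n : ℕ) : Type
  | z (i : Fin n) : YVar n
  | Q (i : Fin (n - 1)) : YVar n

/-- The polynomial ring `R(T)[z, Q]`. -/
abbrev PolyY (n : ℕ) : Type := MvPolynomial (YVar n) (RT n)

/-- The ideal generated by `F_i(z, Q) - e_i(e^{-a_1}, …, e^{-a_n})` for `1 ≤ i ≤ n`, where
`F_i = F_i^{(n)}` and `Q_n = 0`. -/
def relY (n : ℕ) : Ideal (PolyY n) :=
  Ideal.span {f | ∃ i, 1 ≤ i ∧ i ≤ n ∧
    f = todaF (extZero fun j => MvPolynomial.X (YVar.z j))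
        (extZero fun j => MvPolynomial.X (YVar.Q j)) n i -
      MvPolynomial.C ((Finset.univ.val.map fun k : Fin n => ee (-wt k)).esymm i)}

/-- The coordinate ring `R(T)[z, Q] / (F_i(z, Q) - e_i)` of the phase space, which is the
polynomial version of the quantum `K`-ring of the flag variety. -/
def OY (n : ℕ) : Type := PolyY n ⧸ relY n

instance instCommRingOY (n : ℕ) : CommRing (OY n) :=
  inferInstanceAs (CommRing (PolyY n ⧸ relY n))

instance instAlgebraOY (n : ℕ) : Algebra (RT n) (OY n) :=
  inferInstanceAs (Algebra (RT n) (PolyY n ⧸ relY n))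

/-- The quotient map onto the coordinate ring of the phase space. -/
def mkY (n : ℕ) : PolyY n →ₐ[RT n] OY n := Ideal.Quotient.mkₐ (RT n) (relY n)

/-- The multiplicative set generated by `Q_1, …, Q_{n-1}`. -/
def QSet (n : ℕ) : Submonoid (OY n) :=
  Submonoid.closure (Set.range fun i : Fin (n - 1) => mkY n (MvPolynomial.X (YVar.Q i)))

/-- The localization of the coordinate ring of the phase space at `Q_1, …, Q_{n-1}`. -/
def OYo (n : ℕ) : Type := Localization (QSet n)

instance instCommRingOYo (n : ℕ) : CommRing (OYo n) :=
  inferInstanceAs (CommRing (Localization (QSet n)))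

instance instAlgebraOYOYo (n : ℕ) : Algebra (OY n) (OYo n) :=
  inferInstanceAs (Algebra (OY n) (Localization (QSet n)))

instance instAlgebraRTOYo (n : ℕ) : Algebra (RT n) (OYo n) :=
  inferInstanceAs (Algebra (RT n) (Localization (QSet n)))

instance instIsScalarTowerOYo (n : ℕ) : IsScalarTower (RT n) (OY n) (OYo n) :=
  inferInstanceAs (IsScalarTower (RT n) (OY n) (Localization (QSet n)))

instance instIsLocalizationOYo (n : ℕ) : IsLocalization (QSet n) (OYo n) :=
  inferInstanceAs (IsLocalization (QSet n) (Localization (QSet n)))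

/-- The class of a polynomial in `z` and `Q`. -/
def classY {n : ℕ} (f : PolyY n) : OYo n := algebraMap (OY n) (OYo n) (mkY n f)

/-- The variables `z_i`, `η_i` and `Q_i`. -/
inductive GVar (n : ℕ) : Type
  | z (i : Fin n) : GVar n
  | eta (i : Fin n) : GVar n
  | Q (i : Fin (n - 1)) : GVar n

/-- The polynomial ring `ℤ[Q][z, η]`. -/
abbrev PolyG (n : ℕ) : Type := MvPolynomial (GVar n) ℤ

/-- The index `i` of a simple reflection `s_i`, `1 ≤ i ≤ n - 1`, as an index in `1, …, n`. -/
def lo {n : ℕ} (i : Fin (n - 1)) : Fin n := ⟨i, by omega⟩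

/-- The successor `i + 1` of the index of a simple reflection `s_i`. -/
def hi {n : ℕ} (i : Fin (n - 1)) : Fin n := ⟨i + 1, by omega⟩

/-- A permutation acting on the variables `η`. -/
def permEta {n : ℕ} (π : Equiv.Perm (Fin n)) : PolyG n →ₐ[ℤ] PolyG n :=
  MvPolynomial.rename fun v => match v with
    | GVar.z i => GVar.z i
    | GVar.eta i => GVar.eta (π i)
    | GVar.Q i => GVar.Q i

/-- `s_i f - f` is divisible by `η_{i+1} - η_i`. -/
theorem eta_sub_dvd {n : ℕ} (i j : Fin n) (f : PolyG n) :
    MvPolynomial.X (GVar.eta j) - MvPolynomial.X (GVar.eta i) ∣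
      permEta (Equiv.swap i j) f - f := by
  rw [← Ideal.mem_span_singleton, ← Ideal.Quotient.mk_eq_mk_iff_sub_mem]
  set I := Ideal.span {(MvPolynomial.X (GVar.eta j) - MvPolynomial.X (GVar.eta i) : PolyG n)}
  have hij : Ideal.Quotient.mk I (MvPolynomial.X (GVar.eta j)) =
      Ideal.Quotient.mk I (MvPolynomial.X (GVar.eta i)) :=
    Ideal.Quotient.mk_eq_mk_iff_sub_mem _ _ |>.2 (Ideal.mem_span_singleton_self _)
  have h : (Ideal.Quotient.mk I).comp (permEta (Equiv.swap i j) : PolyG n →+* PolyG n) =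
      Ideal.Quotient.mk I := by
    refine MvPolynomial.ringHom_ext (fun r => by simp) (fun v => ?_)
    cases v with
    | z k => simp [permEta]
    | Q k => simp [permEta]
    | eta k =>
      simp only [permEta, RingHom.comp_apply, RingHom.coe_coe, MvPolynomial.rename_X]
      rcases eq_or_ne k i with rfl | h1
      · rw [Equiv.swap_apply_left, hij]
      · rcases eq_or_ne k j with rfl | h2
        · rw [Equiv.swap_apply_right, hij]
        · rw [Equiv.swap_apply_of_ne_of_ne h1 h2]
  exact RingHom.congr_fun h f

/-- The Demazure operator `D_i^Q = 1 + (s_i - 1) / (η_{i+1} ⊖ η_i)`, where `s_i` exchanges `η_i`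
and `η_{i+1}`, and `η_{i+1} ⊖ η_i = (η_{i+1} - η_i) / (1 - η_i)`. -/
def demQ {n : ℕ} (i : Fin (n - 1)) (f : PolyG n) : PolyG n :=
  f + (1 - MvPolynomial.X (GVar.eta (lo i))) * (eta_sub_dvd (lo i) (hi i) f).choose

/-- `ψ_i = ∑_{j=0}^i (-1)^j (1 - η_{n-i})^j F_j^{(i)}(z, Q)` for `1 ≤ i ≤ n - 1`
(here `i` is the number `i + 1`). -/
def psi {n : ℕ} (i : Fin (n - 1)) : PolyG n :=
  ∑ j ∈ Finset.range (i + 2),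
    (-1) ^ j * (1 - MvPolynomial.X (GVar.eta ⟨n - (i + 1) - 1, by omega⟩)) ^ j *
      todaF (extZero fun k => MvPolynomial.X (GVar.z k))
        (extZero fun k => MvPolynomial.X (GVar.Q k)) (i + 1) j

/-- `s_i w > w` in terms of the permutation `w`. -/
def IsAscent {n : ℕ} (w : Equiv.Perm (Fin n)) (i : Fin (n - 1)) : Prop :=
  w.symm (lo i) < w.symm (hi i)

instance instDecidableIsAscent {n : ℕ} (w : Equiv.Perm (Fin n)) :
    DecidablePred (IsAscent w) := fun i =>
  inferInstanceAs (Decidable (w.symm (lo i) < w.symm (hi i)))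

/-- The left ascents of a permutation. -/
def ascents {n : ℕ} (w : Equiv.Perm (Fin n)) : Finset (Fin (n - 1)) :=
  Finset.univ.filter (IsAscent w)

/-- Left multiplication of `w` by the simple reflection `s_i`. -/
def simpleMul {n : ℕ} (i : Fin (n - 1)) (w : Equiv.Perm (Fin n)) : Equiv.Perm (Fin n) :=
  Equiv.swap (lo i) (hi i) * w

/-- A statistic decreasing when the length of a permutation increases. -/
def stat {n : ℕ} (w : Equiv.Perm (Fin n)) : ℕ := ∑ k : Fin n, (k : ℕ) * (w.symm k : ℕ)

theorem stat_simpleMul_lt {n : ℕ} (w : Equiv.Perm (Fin n)) (i : Fin (n - 1))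
    (h : IsAscent w i) : stat (simpleMul i w) < stat w := by
  have hne : lo i ≠ hi i := fun h' => by simpa [lo, hi] using congrArg Fin.val h'
  have hs : ∀ k, (simpleMul i w).symm k = w.symm (Equiv.swap (lo i) (hi i) k) := fun k => rfl
  have hmem : hi i ∈ Finset.univ.erase (lo i) := by simp [hne.symm]
  unfold stat
  simp only [hs]
  rw [← Finset.add_sum_erase _ _ (Finset.mem_univ (lo i)), ← Finset.add_sum_erase _ _ hmem,
    ← Finset.add_sum_erase _ (fun k : Fin n => (k : ℕ) * (w.symm k : ℕ))
      (Finset.mem_univ (lo i)),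
    ← Finset.add_sum_erase _ (fun k : Fin n => (k : ℕ) * (w.symm k : ℕ)) hmem]
  have hrest : ∑ k ∈ (Finset.univ.erase (lo i)).erase (hi i),
      (k : ℕ) * (w.symm (Equiv.swap (lo i) (hi i) k) : ℕ) =
      ∑ k ∈ (Finset.univ.erase (lo i)).erase (hi i), (k : ℕ) * (w.symm k : ℕ) := by
    refine Finset.sum_congr rfl fun k hk => ?_
    simp only [Finset.mem_erase, Finset.mem_univ, and_true] at hk
    rw [Equiv.swap_apply_of_ne_of_ne hk.2 hk.1]
  rw [hrest, Equiv.swap_apply_left, Equiv.swap_apply_right]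
  have h1 : (lo i : ℕ) = i := rfl
  have h2 : (hi i : ℕ) = i + 1 := rfl
  have h3 : (w.symm (lo i) : ℕ) < w.symm (hi i) := h
  rw [h1, h2]
  nlinarith

/-- The quantum double Grothendieck polynomials `𝔊^Q_w(z|η)`: for the longest element (the only
permutation without left ascents) it is `ψ_1 ⋯ ψ_{n-1}`, and `𝔊^Q_w = D_i^Q 𝔊^Q_{s_i w}` if
`s_i w > w`; here the smallest such `i` is used. -/
def groth {n : ℕ} (w : Equiv.Perm (Fin n)) : PolyG n :=
  if h : (ascents w).Nonempty then
    demQ ((ascents w).min' h) (groth (simpleMul ((ascents w).min' h) w))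
  else ∏ i, psi i
termination_by stat w
decreasing_by
  exact stat_simpleMul_lt w _ (Finset.mem_filter.1 ((ascents w).min'_mem h)).2

/-- The substitution `η_i = 1 - e^{a_{n-i+1}}`. -/
def specialize (n : ℕ) : PolyG n →ₐ[ℤ] PolyY n :=
  MvPolynomial.aeval fun v => match v with
    | GVar.z i => MvPolynomial.X (YVar.z i)
    | GVar.eta i => MvPolynomial.C (1 - ee (wt i.rev))
    | GVar.Q i => MvPolynomial.X (YVar.Q i)

/-- The reflection `s_θ`, exchanging `1` and `n`. -/
def sTheta (n : ℕ) [NeZero n] : Equiv.Perm (Fin n) := Equiv.swap 0 (Fin.rev 0)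

/-- `Q^{θ^∨} = Q_1 ⋯ Q_{n-1}`, as `θ^∨` is the sum of all simple coroots. -/
def QTheta (n : ℕ) : QSet n :=
  ∏ i : Fin (n - 1), ⟨mkY n (MvPolynomial.X (YVar.Q i)), Submonoid.subset_closure ⟨i, rfl⟩⟩

/-- The element `Q^{-θ^∨} 𝔊^Q_{s_θ}(z|η)`. -/
def thetaClass (n : ℕ) [NeZero n] : OYo n :=
  IsLocalization.mk' (OYo n) (mkY n (specialize n (groth (sTheta n)))) (QTheta n)

/-- The values that define the `K`-Peterson map `Φ_n`: it sends `z_i` to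
`τ_i σ_{i-1} / (σ_i τ_{i-1})` and `Q_i` to `τ_{i-1} τ_{i+1} / τ_i²`. -/
def IsPhi {n : ℕ} (Φ : OYo n →ₐ[RT n] OZo n) : Prop :=
  (∀ i : Fin n, Φ (classY (MvPolynomial.X (YVar.z i))) =
    IsLocalization.mk' (OZo n) (tau n (i + 1) * sig n i)
      (⟨sig n (i + 1) * tau n i, mul_mem (sig_mem (by omega)) (tau_mem (by omega))⟩ :
        tauSet n)) ∧
  ∀ i : Fin (n - 1), Φ (classY (MvPolynomial.X (YVar.Q i))) =
    IsLocalization.mk' (OZo n) (tau n i * tau n (i + 2))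
      (⟨tau n (i + 1) ^ 2, pow_mem (tau_mem (by omega)) 2⟩ : tauSet n)

end KPeterson

end

noncomputable section

namespace KPeterson

/-! Write u_k = e^{-a_k}.

Existence of Φ_n. The matrix P conjugates A into a companion matrix C (`matA_mul_matP`). Let r_i and
r'_i, numbered from 0, be the rows of the inverses of the lower unitriangular factors of ZP and of
ZAP. Because AZ = ZA and ZAP = ZPC, the two families are related by bidiagonal matrices, r'_i A =
z_i r_i - r_{i+1} and r'_{i+1} = r_{i+1} - z_i Q_i r_i, where z_i and Q_i (also numbered from 0) are
the prescribed quotients of minors (`exists_lax_rows`). The polynomials G_i = ∑_m (-1)^m F_m^{(i)}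
X^{i-m} obey the same recursion, so e_1 G_i(A) = ± r'_i, and the recursion closes up with e_1 G_n(A)
= 0 (`vecMul_aeval_todaPoly`). As e_1 is cyclic, G_n is the characteristic polynomial of A, which is
the system F_m^{(n)} = e_m(u_1, …, u_n) (`todaF_eq_of_vecMul_eq_zero`).

The class of s_θ. The braid relations let 𝔊_w be computed along any chain of ascents
(`groth_eq_demQ`). A weighted antisymmetrization over η_2, …, η_{n-1} absorbs every inner Demazure
operator, while 𝔊_{s_θ} is symmetric in these variables; thus a Vandermonde determinant times
𝔊_{s_θ} is ψ_{n-1} times an explicit determinant (`vandermonde_mul_groth_sTheta`), whose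
specialization is made of the values G_l(u_k) with 1 < k < n.

The functional φ(f) = (f(A)Z)_{1n} kills G_1, …, G_{n-2}, since the first column of AP is the last
basis vector. Hence that determinant divided by the Vandermonde is φ(∏ (u_k - X)) / φ(1)
(`functional_prod_mul_vandermonde`), with φ(1) = τ_1 and φ(∏ (u_k - X)) = (z_11 - z_nn) / (u_n -
u_1) (`functional_prod_mid`). Moreover ψ_{n-1} = τ_n / (τ_{n-1} z_nn u_n) (`eval_toda_last`) and Q_1
⋯ Q_{n-1} = τ_n / (τ_1 τ_{n-1}) (`prod_phiQ`). All τ cancel, leaving u_1 (z_11 - z_nn) / ((u_n -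
u_1) z_nn). Since β ∘ σ sends z_ii to Ω(b_i) / u_i, this becomes (u_n Ω(b_1) - u_1 Ω(b_n)) / ((u_n -
u_1) Ω(b_n)), which is D_0(1). -/

/-! ### Leading principal minors and triangular factorization. -/

open Matrix in
theorem minor_eq_det_submatrix {n m : ℕ} (h : m ≤ n) {S : Type*} [CommRing S]
    (M : Matrix (Fin n) (Fin n) S) :
    minor m M = (M.submatrix (Fin.castLE h) (Fin.castLE h)).det := by
  let e : Fin m ≃ {i : Fin n // (i : ℕ) < m} :=
    { toFun := fun i => ⟨Fin.castLE h i, i.2⟩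
      invFun := fun i => ⟨i.1, i.2⟩
      left_inv := fun _ => rfl
      right_inv := fun _ => rfl }
  exact (Matrix.det_submatrix_equiv_self e _).symm

/-- The first `m` coordinates of a row vector times a leading principal submatrix. -/
theorem vecMul_submatrix_castLE {n m : ℕ} (h : m ≤ n) {S : Type*} [CommRing S]
    (M : Matrix (Fin n) (Fin n) S) (v : Fin n → S) (hv : ∀ j : Fin n, m ≤ j → v j = 0)
    (j : Fin m) :
    Matrix.vecMul (fun i => v (Fin.castLE h i))
      (M.submatrix (Fin.castLE h) (Fin.castLE h)) j = Matrix.vecMul v M (Fin.castLE h j) := by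
  obtain ⟨k, rfl⟩ := Nat.exists_eq_add_of_le h
  have h1 := Fin.sum_univ_add fun i => v i * M i (Fin.castLE h j)
  rw [Finset.sum_eq_zero fun (i : Fin k) _ => by
    rw [hv (Fin.natAdd m i) (by simp), zero_mul], add_zero] at h1
  exact h1.symm

/-- In its first m columns, the product of a row supported on the first m coordinates involves only
the leading block, which is invertible. All identities between rows in the Lax representation follow
from this uniqueness. -/
theorem eq_zero_of_vecMul_minor {n m : ℕ} (h : m ≤ n) {S : Type*} [CommRing S]
    (M : Matrix (Fin n) (Fin n) S) (hM : IsUnit (minor m M)) (v : Fin n → S)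
    (hv : ∀ j : Fin n, m ≤ j → v j = 0)
    (hvM : ∀ j : Fin n, (j : ℕ) < m → Matrix.vecMul v M j = 0) : v = 0 := by
  rw [minor_eq_det_submatrix h] at hM
  have h0 : Matrix.vecMul (fun i => v (Fin.castLE h i))
      (M.submatrix (Fin.castLE h) (Fin.castLE h)) = 0 := by
    ext j
    rw [vecMul_submatrix_castLE h M v hv]
    exact hvM _ j.2
  have h1 := congrArg (fun w => Matrix.vecMul w
    (M.submatrix (Fin.castLE h) (Fin.castLE h))⁻¹) h0
  simp only [Matrix.vecMul_vecMul, Matrix.mul_nonsing_inv _ hM, Matrix.vecMul_one,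
    Matrix.zero_vecMul] at h1
  ext j
  rcases lt_or_ge (j : ℕ) m with hj | hj
  · exact congrFun h1 ⟨j, hj⟩
  · exact hv j hj

/-- The `i`-th row of the inverse of the lower unitriangular factor of a matrix whose leading
principal minor of size `i` is invertible. -/
theorem exists_row {n : ℕ} {S : Type*} [CommRing S] (M : Matrix (Fin n) (Fin n) S) (i : Fin n)
    (hM : IsUnit (minor i M)) :
    ∃ v : Fin n → S, v i = 1 ∧ (∀ j, i < j → v j = 0) ∧
      (∀ j, j < i → Matrix.vecMul v M j = 0) ∧
      minor i M * Matrix.vecMul v M i = minor (i + 1) M := by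
  obtain ⟨c, hc⟩ := hM.exists_right_inv
  have h : (i : ℕ) + 1 ≤ n := i.2
  set B := M.submatrix (Fin.castLE h) (Fin.castLE h) with hB
  have hdet : B.det = minor (i + 1) M := (minor_eq_det_submatrix h M).symm
  have hlast : B.adjugate (Fin.last i) (Fin.last i) = minor i M := by
    rw [Matrix.adjugate_fin_succ_eq_det_submatrix, minor_eq_det_submatrix i.2.le]
    rw [Even.neg_one_pow ⟨_, rfl⟩, one_mul, Fin.succAbove_last]
    rfl
  -- The last row of the adjugate of B, divided by its last entry, the minor of size i. The identity
  -- adj(B) B = det B clears the columns before i and leaves the minor of size i + 1 in column i.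
  let v : Fin n → S := fun j => if hj : (j : ℕ) < i + 1 then
    c * B.adjugate (Fin.last i) ⟨j, hj⟩ else 0
  have hv : ∀ j : Fin n, (i : ℕ) + 1 ≤ j → v j = 0 := fun j hj => dif_neg (by omega)
  have hvc : (fun k => v (Fin.castLE h k)) = c • B.adjugate (Fin.last i) := by
    ext k
    simp only [v, Fin.val_castLE, k.2, dif_pos, Pi.smul_apply, smul_eq_mul]
  have hmul : ∀ j : Fin n, (hj : (j : ℕ) < i + 1) → Matrix.vecMul v M j =
      c * (B.det * (1 : Matrix (Fin (i + 1)) (Fin (i + 1)) S) (Fin.last i) ⟨j, hj⟩) := by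
    intro j hj
    have h1 := vecMul_submatrix_castLE h M v hv ⟨j, hj⟩
    rw [hvc, ← hB, Matrix.smul_vecMul] at h1
    have h2 : Matrix.vecMul (B.adjugate (Fin.last i)) B = (B.adjugate * B) (Fin.last i) := rfl
    rw [h2, Matrix.adjugate_mul] at h1
    exact h1.symm
  refine ⟨v, ?_, fun j hj => hv j hj, fun j hj => ?_, ?_⟩
  · have h1 := congrFun hvc (Fin.last i)
    rw [Pi.smul_apply, hlast, smul_eq_mul, mul_comm c, hc] at h1
    exact h1
  · rw [hmul j (by have : (j : ℕ) < i := hj; omega), Matrix.one_apply_ne, mul_zero, mul_zero]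
    intro h'
    have := congrArg Fin.val h'
    have h2 : (j : ℕ) < i := hj
    simp at this
    omega
  · rw [hmul i (by omega)]
    have h1 : (⟨i, by omega⟩ : Fin ((i : ℕ) + 1)) = Fin.last i := rfl
    rw [h1, Matrix.one_apply_eq, mul_one, ← hdet, ← mul_assoc, hc, one_mul]

theorem minor_zero {n : ℕ} {S : Type*} [CommRing S] (M : Matrix (Fin n) (Fin n) S) :
    minor 0 M = 1 := by
  rw [minor_eq_det_submatrix (Nat.zero_le n), Matrix.det_fin_zero]

theorem minor_one {n : ℕ} [NeZero n] {S : Type*} [CommRing S] (M : Matrix (Fin n) (Fin n) S) :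
    minor 1 M = M 0 0 := by
  rw [minor_eq_det_submatrix (NeZero.one_le), Matrix.det_fin_one]
  rfl

theorem map_minor {n : ℕ} {S S' : Type*} [CommRing S] [CommRing S'] (f : S →+* S') (m : ℕ)
    (M : Matrix (Fin n) (Fin n) S) : minor m (M.map f) = f (minor m M) := by
  rw [minor, minor, RingHom.map_det]
  rfl

/-! ### Elementary symmetric polynomials and the companion form of A. -/

theorem esymm_cons {R : Type*} [CommRing R] (a : R) (s : Multiset R) (m : ℕ) :
    (a ::ₘ s).esymm (m + 1) = s.esymm (m + 1) + a * s.esymm m := by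
  simp [Multiset.esymm, Multiset.powersetCard_cons, Multiset.map_map,
    Multiset.sum_map_mul_left]

theorem esymm_zero {R : Type*} [CommRing R] (s : Multiset R) : s.esymm 0 = 1 := by
  simp [Multiset.esymm]

theorem esymm_of_card_lt {R : Type*} [CommRing R] (s : Multiset R) {m : ℕ}
    (h : Multiset.card s < m) : s.esymm m = 0 := by
  simp [Multiset.esymm, Multiset.powersetCard_eq_empty m h]

/-- `e_m(e^{-a_1}, …, e^{-a_i})`. -/
def elemU (n i m : ℕ) : RT n :=
  ((Finset.univ.filter fun k : Fin n => (k : ℕ) < i).val.map fun k => ee (-wt k)).esymm m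

theorem elemU_succ {n i : ℕ} (h : i < n) (m : ℕ) :
    elemU n (i + 1) (m + 1) = elemU n i (m + 1) + ee (-wt (⟨i, h⟩ : Fin n)) * elemU n i m := by
  have h1 : (Finset.univ.filter fun k : Fin n => (k : ℕ) < i + 1) =
      Finset.cons ⟨i, h⟩ (Finset.univ.filter fun k : Fin n => (k : ℕ) < i) (by simp) := by
    ext k
    simp only [Finset.mem_filter, Finset.mem_univ, true_and, Finset.mem_cons, Fin.ext_iff]
    omega
  rw [elemU, h1, Finset.cons_val, Multiset.map_cons, esymm_cons]
  rfl

theorem elemU_zero (n i : ℕ) : elemU n i 0 = 1 := esymm_zero _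

theorem elemU_of_lt {n i m : ℕ} (h : i < m) : elemU n i m = 0 := by
  refine esymm_of_card_lt _ ?_
  rw [Multiset.card_map, Finset.card_val]
  refine lt_of_le_of_lt ?_ h
  rw [Fin.card_filter_val_lt]
  exact min_le_right _ _

theorem elemU_self (n m : ℕ) :
    elemU n n m = (Finset.univ.val.map fun k : Fin n => ee (-wt k)).esymm m := by
  rw [elemU, Finset.filter_true_of_mem fun k _ => k.2]

theorem matP_apply {n : ℕ} (i j : Fin n) :
    matP n i j = if j ≤ i then elemU n i ((i : ℕ) - j) else 0 := by
  have : (Finset.univ.filter fun k : Fin n => (k : ℕ) < i) = Finset.Iio i := by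
    ext k
    rw [Finset.mem_filter, Finset.mem_Iio, Fin.lt_def]
    exact and_iff_right (Finset.mem_univ k)
  rw [matP, elemU, this]

theorem prod_ee_neg_wt (n : ℕ) : ∏ k : Fin n, ee (-wt k) = (1 : RT n) := by
  have h : ∀ s : Finset (Fin n), ∏ k ∈ s, ee (-wt k) = ee (-∑ k ∈ s, wt k) := by
    intro s
    induction s using Finset.induction_on with
    | empty => simp [ee_zero]
    | insert a s ha ih => rw [Finset.prod_insert ha, Finset.sum_insert ha, ih, ← ee_add, neg_add]
  rw [h]
  have h0 : ∑ k : Fin n, wt k = (0 : Wt n) := by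
    have : ∑ k : Fin n, wt k = (QuotientAddGroup.mk' (AddSubgroup.zmultiples
        (fun _ : Fin n => (1 : ℤ)))) (∑ k : Fin n, Pi.single k 1) := by
      rw [map_sum]; rfl
    rw [this, ← AddMonoidHom.mem_ker, QuotientAddGroup.ker_mk']
    exact AddSubgroup.mem_zmultiples_iff.2 ⟨1, by ext j; simp [Finset.sum_apply, Pi.single_apply]⟩
  rw [h0, neg_zero, ee_zero]

/-- The companion matrix to which `A` is conjugate by `P`. -/
def matC (n : ℕ) : Matrix (Fin n) (Fin n) (RT n) := fun i j =>
  (if (i : ℕ) + 1 = j then -1 else 0) + if (i : ℕ) + 1 = n then elemU n n (n - j) else 0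

theorem mul_matC {n : ℕ} {S : Type*} [CommRing S] [Algebra (RT n) S]
    (v : Fin n → S) (l : Fin n) (hl : (l : ℕ) + 1 = n) (j : Fin n) :
    Matrix.vecMul v ((matC n).map (algebraMap (RT n) S)) j =
      v l * algebraMap (RT n) S (elemU n n (n - j)) -
      (if h : 0 < (j : ℕ) then v ⟨j - 1, by omega⟩ else 0) := by
  have h1 : ∀ k, v k * (matC n).map (algebraMap (RT n) S) k j =
      (if k = l then v l * algebraMap (RT n) S (elemU n n (n - j)) else 0) -
        (if (k : ℕ) + 1 = j then v k else 0) := by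
    intro k
    have hk : (k : ℕ) + 1 = n ↔ k = l := by rw [Fin.ext_iff]; omega
    rw [Matrix.map_apply, matC]
    simp only [hk]
    by_cases h : k = l
    · subst h
      by_cases h' : (k : ℕ) + 1 = j
      · simp only [h', if_true, map_add, map_neg, map_one]
        simp only [← h', hl]
        ring
      · simp [h']
    · by_cases h' : (k : ℕ) + 1 = j <;> simp [h, h']
  rw [Matrix.vecMul, dotProduct, Finset.sum_congr rfl fun k _ => h1 k, Finset.sum_sub_distrib]
  congr 1
  · simp
  · split_ifs with h
    · rw [Finset.sum_eq_single ⟨j - 1, by omega⟩]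
      · rw [if_pos]; simp; omega
      · intro k _ hk
        rw [if_neg]
        rintro h'
        exact hk (Fin.ext (by simp; omega))
      · simp
    · refine Finset.sum_eq_zero fun k _ => if_neg fun h' => h ?_
      omega

/-- Entrywise this is the recursion of elementary symmetric polynomials on adding one variable. In
the last row there is no next row of P to subtract, and the coefficients in the last row of C take
its place. -/
theorem matA_mul_matP {n : ℕ} {S : Type*} [CommRing S] [Algebra (RT n) S] :
    matAin n S * (matP n).map (algebraMap (RT n) S) =
      (matP n).map (algebraMap (RT n) S) * (matC n).map (algebraMap (RT n) S) := by
  ext i j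
  have hl : n - 1 < n := by have := i.2; omega
  have h2 := mul_matC ((matP n).map (algebraMap (RT n) S) i) ⟨n - 1, hl⟩ (by simp; omega) j
  change _ = Matrix.vecMul ((matP n).map (algebraMap (RT n) S) i) _ j
  rw [h2, matAin_mul]
  have e1 : ∀ h : (i : ℕ) + 1 < n, (matP n).map (algebraMap (RT n) S) ⟨i + 1, h⟩ j =
      algebraMap (RT n) S (if (j : ℕ) ≤ i + 1 then elemU n (i + 1) (i + 1 - j) else 0) := fun h => by
    rw [Matrix.map_apply, matP_apply]; rfl
  have e2 : ∀ h : 0 < (j : ℕ), (matP n).map (algebraMap (RT n) S) i ⟨j - 1, by omega⟩ =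
      algebraMap (RT n) S (if (j : ℕ) ≤ i + 1 then elemU n i (i + 1 - j) else 0) := fun h => by
    rw [Matrix.map_apply, matP_apply]
    congr 1
    rw [show (i : ℕ) + 1 - j = i - (j - 1) by omega]
    exact if_congr (by rw [Fin.le_def]; simp) rfl rfl
  -- For j = 0 there is no column j - 1; the right side is then e_{i+1} in i variables, which is
  -- zero.
  have e2' : (if h : 0 < (j : ℕ) then (matP n).map (algebraMap (RT n) S) i ⟨j - 1, by omega⟩
      else 0) = algebraMap (RT n) S (if (j : ℕ) ≤ i + 1 then elemU n i (i + 1 - j) else 0) := by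
    split_ifs with h h' h'
    · rw [e2 h, if_pos h']
    · rw [e2 h, if_neg h']
    · rw [elemU_of_lt (by omega), map_zero]
    · rw [map_zero]
  have e3 : (matP n).map (algebraMap (RT n) S) i ⟨n - 1, hl⟩ =
      if (i : ℕ) + 1 = n then 1 else 0 := by
    rw [Matrix.map_apply, matP_apply]
    have := i.2
    by_cases h : (i : ℕ) + 1 = n
    · rw [if_pos h, if_pos (by rw [Fin.le_def]; simp; omega),
        show (i : ℕ) - (n - 1) = 0 by omega, elemU_zero, map_one]
    · rw [if_neg h, if_neg (by rw [Fin.le_def]; simp; omega), map_zero]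
  have e4 : ee (-wt i) * matP n i j + (if (j : ℕ) ≤ i + 1 then elemU n i (i + 1 - j) else 0) =
      if (j : ℕ) ≤ i + 1 then elemU n (i + 1) (i + 1 - j) else 0 := by
    rw [matP_apply]
    rcases lt_trichotomy (j : ℕ) (i + 1) with h | h | h
    · rw [if_pos h.le, if_pos h.le, if_pos (by rw [Fin.le_def]; omega),
        show (i : ℕ) + 1 - j = i - j + 1 by omega, elemU_succ i.2]
      ring
    · rw [if_pos h.le, if_pos h.le, if_neg (by rw [Fin.le_def]; omega), h, Nat.sub_self,
        elemU_zero, elemU_zero, mul_zero, zero_add]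
    · rw [if_neg (by rw [Fin.le_def]; omega), if_neg (by omega), if_neg (by omega), mul_zero,
        add_zero]
  have e4' := congrArg (algebraMap (RT n) S) e4
  rw [map_add, map_mul] at e4'
  rw [e2', e3, Matrix.map_apply]
  rcases Nat.lt_or_ge ((i : ℕ) + 1) n with h | h
  · rw [dif_pos h, if_neg h.ne, e1 h, ← e4']
    ring
  · have h' : (i : ℕ) + 1 = n := le_antisymm i.2 h
    have e5 : (if (j : ℕ) ≤ i + 1 then elemU n (i + 1) (i + 1 - j) else 0) =
        elemU n n (n - j) := by rw [if_pos (by omega), h']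
    rw [e5] at e4'
    rw [dif_neg (by omega), if_pos h', ← e4']
    ring

theorem det_matP (n : ℕ) : (matP n).det = 1 := by
  rw [Matrix.det_of_isLowerTriangular]
  · refine Finset.prod_eq_one fun i _ => ?_
    rw [matP_apply, if_pos le_rfl, Nat.sub_self, elemU_zero]
  · intro i j h
    rw [matP_apply]
    exact if_neg (not_le.2 h)

/-- The relation e^{a_1 + ⋯ + a_n} = 1 enters here. It makes the lower left corner of C equal to 1,
on which both the Lax representation and the choice of the functional depend. -/
theorem elemU_full {n : ℕ} : elemU n n n = 1 := by
  rw [elemU_self, Finset.esymm_map_val, ← prod_ee_neg_wt n]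
  have : Finset.powersetCard n (Finset.univ : Finset (Fin n)) = {Finset.univ} := by
    have := Finset.powersetCard_self (Finset.univ : Finset (Fin n))
    rwa [Finset.card_fin] at this
  rw [this, Finset.sum_singleton]

/-! ### The polynomials F_m^{(i)} and their generating polynomials. -/

theorem todaF_congr {S : Type*} [CommRing S] (z Q Q' : ℕ → S) (i m : ℕ)
    (h : ∀ j < i, Q j = Q' j) : todaF z Q i m = todaF z Q' i m := by
  refine Finset.sum_congr rfl fun J hJ => ?_
  congr 1
  refine Finset.prod_congr rfl fun j hj => ?_
  rw [h j (Finset.mem_range.1 ((Finset.mem_powersetCard.1 hJ).1 (Finset.mem_filter.1 hj).1))]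

theorem todaF_zero {S : Type*} [CommRing S] (z Q : ℕ → S) (i : ℕ) : todaF z Q i 0 = 1 := by
  simp [todaF]

theorem todaF_of_lt {S : Type*} [CommRing S] (z Q : ℕ → S) {i m : ℕ} (h : i < m) :
    todaF z Q i m = 0 := by
  rw [todaF, Finset.powersetCard_eq_empty.2 (by simpa using h), Finset.sum_empty]

/-- The parameters `Q` with `Q_i` replaced by zero. -/
def cutQ {S : Type*} [Zero S] (Q : ℕ → S) (i j : ℕ) : S := if j + 1 = i then 0 else Q j

/-- Splitting the subsets of `{1, …, i + 1}` according to whether they contain `i + 1`. -/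
theorem todaF_succ {S : Type*} [CommRing S] (z Q : ℕ → S) (i m : ℕ) :
    todaF z Q (i + 1) (m + 1) =
      todaF z Q i (m + 1) + (1 - Q i) * z i * todaF z (cutQ Q i) i m := by
  have hi : i ∉ Finset.range i := by simp
  rw [todaF, Finset.range_add_one, Finset.powersetCard_succ_insert hi, Finset.sum_union, ← todaF]
  · congr 1
    rw [Finset.sum_image, todaF, Finset.mul_sum]
    · refine Finset.sum_congr rfl fun J hJ => ?_
      have hJi : ∀ j ∈ J, j < i := fun j hj =>
        Finset.mem_range.1 ((Finset.mem_powersetCard.1 hJ).1 hj)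
      have hn : i ∉ J := fun h => lt_irrefl _ (hJi i h)
      have hn' : i + 1 ∉ insert i J := by
        simp only [Finset.mem_insert, not_or]
        exact ⟨by omega, fun h => by have := hJi _ h; omega⟩
      rw [Finset.prod_insert hn, Finset.filter_insert, if_pos hn',
        Finset.prod_insert (fun h => hn (Finset.mem_filter.1 h).1)]
      -- Adjoining i provides the index i - 1, if it lies in J, with a successor in the set. Its
      -- factor 1 - Q_{i-1} disappears, as it does when Q_{i-1} is set to zero.
      have : ∏ j ∈ J with j + 1 ∉ insert i J, (1 - Q j) =
          ∏ j ∈ J with j + 1 ∉ J, (1 - cutQ Q i j) := by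
        rw [Finset.prod_filter, Finset.prod_filter]
        refine Finset.prod_congr rfl fun j hj => ?_
        by_cases h1 : j + 1 = i
        · simp [h1, cutQ]
        · simp [h1, cutQ]
      rw [this]
      ring
    · intro J hJ J' hJ' h
      have h1 : i ∉ J := fun h =>
        hi ((Finset.mem_powersetCard.1 hJ).1 h)
      have h2 : i ∉ J' := fun h =>
        hi ((Finset.mem_powersetCard.1 hJ').1 h)
      rw [← Finset.erase_insert h1, ← Finset.erase_insert h2]
      exact congrArg (fun s => Finset.erase s i) h
  · rw [Finset.disjoint_left]
    intro J hJ hJ'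
    obtain ⟨J', -, rfl⟩ := Finset.mem_image.1 hJ'
    exact hi ((Finset.mem_powersetCard.1 hJ).1 (Finset.mem_insert_self _ _))

open Polynomial in
/-- The pair of the polynomials `∑_m (-1)^m F_m^{(i)} X^{i-m}`, first with `Q_i` replaced by zero
and then without this replacement. -/
def todaPoly {S : Type*} [CommRing S] (z Q : ℕ → S) : ℕ → S[X] × S[X]
  | 0 => (1, 1)
  | i + 1 =>
    (X * (todaPoly z Q i).2 - C (z i) * (todaPoly z Q i).1,
      X * (todaPoly z Q i).2 - C (z i) * (todaPoly z Q i).1 + C (z i * Q i) * (todaPoly z Q i).1)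

-- The recursion `todaF_succ` calls both the full sums and those with the last parameter cut, so the
-- two generating polynomials have to be followed together.
open Polynomial in
theorem todaPoly_eq {S : Type*} [CommRing S] (z Q : ℕ → S) (i : ℕ) :
    (todaPoly z Q i).1 = ∑ m ∈ Finset.range (i + 1),
      C ((-1) ^ m * todaF z (cutQ Q i) i m) * X ^ (i - m) ∧
    (todaPoly z Q i).2 = ∑ m ∈ Finset.range (i + 1),
      C ((-1) ^ m * todaF z Q i m) * X ^ (i - m) := by
  induction i with
  | zero => simp [todaPoly, todaF_zero]
  | succ i ih =>
    obtain ⟨h1, h2⟩ := ih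
    -- One recursion step for any Q' that agrees with Q below i. Taking Q' with entry zero at i
    -- gives the first component, and Q' = Q the second.
    have key : ∀ Q' : ℕ → S, (∀ j < i, Q' j = Q j) →
        X * (todaPoly z Q i).2 - C ((1 - Q' i) * z i) * (todaPoly z Q i).1 =
        ∑ m ∈ Finset.range (i + 1 + 1), C ((-1) ^ m * todaF z Q' (i + 1) m) *
          X ^ (i + 1 - m) := by
      intro Q' hQ'
      have e1 : ∀ m, todaF z Q i m = todaF z Q' i m := fun m =>
        todaF_congr _ _ _ _ _ fun j hj => (hQ' j hj).symm
      have e2 : ∀ m, todaF z (cutQ Q i) i m = todaF z (cutQ Q' i) i m := fun m =>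
        todaF_congr _ _ _ _ _ fun j hj => by rw [cutQ, cutQ, hQ' j hj]
      rw [h2, h1, Finset.sum_range_succ' _ (i + 1)]
      simp only [todaF_succ, e1, e2, Nat.add_sub_add_right, todaF_zero, mul_add, C_add, add_mul,
        Finset.sum_add_distrib]
      rw [Finset.sum_range_succ' (fun m => C ((-1) ^ m * todaF z Q' i m) * X ^ (i - m)),
        Finset.sum_range_succ (fun m => C ((-1) ^ (m + 1) * todaF z Q' i (m + 1)) * X ^ (i - m)),
        todaF_of_lt z Q' (Nat.lt_succ_self i), mul_add, Finset.mul_sum, Finset.mul_sum,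
        sub_eq_add_neg, ← Finset.sum_neg_distrib]
      have s1 : ∑ m ∈ Finset.range i, X * (C ((-1) ^ (m + 1) * todaF z Q' i (m + 1)) *
          X ^ (i - (m + 1))) =
          ∑ m ∈ Finset.range i, C ((-1) ^ (m + 1) * todaF z Q' i (m + 1)) * X ^ (i - m) := by
        refine Finset.sum_congr rfl fun m hm => ?_
        have := Finset.mem_range.1 hm
        rw [show i - m = i - (m + 1) + 1 by omega, pow_succ]
        ring
      have s2 : ∑ m ∈ Finset.range (i + 1), -(C ((1 - Q' i) * z i) *
          (C ((-1) ^ m * todaF z (cutQ Q' i) i m) * X ^ (i - m))) =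
          ∑ m ∈ Finset.range (i + 1), C ((-1) ^ (m + 1) *
            ((1 - Q' i) * z i * todaF z (cutQ Q' i) i m)) * X ^ (i - m) := by
        refine Finset.sum_congr rfl fun m _ => ?_
        simp only [C_mul, C_pow, pow_succ]
        simp only [C_neg, C_1]
        ring
      rw [s1, s2]
      simp only [todaF_zero, Nat.sub_zero, pow_zero, mul_one, C_1, one_mul, mul_zero, C_0,
        zero_mul, pow_succ]
      ring
    constructor
    · rw [← key (cutQ Q (i + 1)) (fun j hj => by rw [cutQ, if_neg (by omega)])]
      simp [todaPoly, cutQ]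
    · rw [← key Q (fun j _ => rfl)]
      simp only [todaPoly, C_mul, C_sub, C_1]
      ring

theorem map_todaF {S S' : Type*} [CommRing S] [CommRing S'] (f : S →+* S') (z Q : ℕ → S)
    (i m : ℕ) : f (todaF z Q i m) = todaF (fun j => f (z j)) (fun j => f (Q j)) i m := by
  simp [todaF, map_sum, map_prod]

theorem map_extZero {S S' : Type*} [CommRing S] [CommRing S'] (f : S →+* S') {m : ℕ}
    (g : Fin m → S) (j : ℕ) : f (extZero g j) = extZero (fun k => f (g k)) j := by
  simp only [extZero]
  split_ifs <;> simp

/-! ### The Lax representation. -/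

/-- Multiplication of a row vector by `A`. -/
theorem vecMul_matAin {n : ℕ} {S : Type*} [CommRing S] [Algebra (RT n) S]
    (v : Fin n → S) (j : Fin n) :
    Matrix.vecMul v (matAin n S) j = algebraMap (RT n) S (ee (-wt j)) * v j -
      (if h : 0 < (j : ℕ) then v ⟨j - 1, by omega⟩ else 0) :=
  mul_matAin (fun _ => v) j j

/-- The matrix `P` with entries in an `R(T)`-algebra. -/
def matPin (n : ℕ) (S : Type*) [CommRing S] [Algebra (RT n) S] : Matrix (Fin n) (Fin n) S :=
  (matP n).map (algebraMap (RT n) S)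

/-- The companion matrix with entries in an `R(T)`-algebra. -/
def matCin (n : ℕ) (S : Type*) [CommRing S] [Algebra (RT n) S] : Matrix (Fin n) (Fin n) S :=
  (matC n).map (algebraMap (RT n) S)

theorem matAin_mul_matPin (n : ℕ) (S : Type*) [CommRing S] [Algebra (RT n) S] :
    matAin n S * matPin n S = matPin n S * matCin n S := matA_mul_matP

/-- The Lax representation: the rows `r_i`, `r'_i` of the inverses of the lower unitriangular
factors of `Z P` and `Z A P` are related by the bidiagonal matrices with entries `z_i` and
`z_i Q_i`. -/
theorem exists_lax_rows {n : ℕ} [NeZero n] {S : Type*} [CommRing S] [Algebra (RT n) S]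
    (Z : Matrix (Fin n) (Fin n) S) (hZ : matAin n S * Z = Z * matAin n S)
    (ta sg : ℕ → S) (hta : ∀ m, minor m (Z * matAin n S * matPin n S) = ta m)
    (hsg : ∀ m, minor m (Z * matPin n S) = sg m)
    (uta : ∀ m ≤ n, IsUnit (ta m)) (usg : ∀ m ≤ n, IsUnit (sg m)) (z Q : ℕ → S)
    (hz : ∀ i < n, z i * (sg (i + 1) * ta i) = ta (i + 1) * sg i)
    (hQ : ∀ i, i + 1 < n → Q i * ta (i + 1) ^ 2 = ta i * ta (i + 2)) :
    ∃ r r' : Fin n → Fin n → S, r 0 = Pi.single 0 1 ∧ r' 0 = Pi.single 0 1 ∧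
      (∀ (i : ℕ) (h : i + 1 < n), Matrix.vecMul (r' ⟨i, by omega⟩) (matAin n S) =
        z i • r ⟨i, by omega⟩ - r ⟨i + 1, h⟩) ∧
      (∀ (i : ℕ) (h : i + 1 = n), Matrix.vecMul (r' ⟨i, by omega⟩) (matAin n S) =
        z i • r ⟨i, by omega⟩) ∧
      (∀ (i : ℕ) (h : i + 1 < n), r' ⟨i + 1, h⟩ = r ⟨i + 1, h⟩ - (z i * Q i) • r ⟨i, by omega⟩) ∧
      (∀ i j, j < i → Matrix.vecMul (r' i) (Z * matAin n S * matPin n S) j = 0) ∧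
      (∀ i : Fin n, ta i * Matrix.vecMul (r' i) (Z * matAin n S * matPin n S) i = ta (i + 1)) := by
  have ex : ∀ i : Fin n, _ := fun i => exists_row (Z * matPin n S) i (by
    rw [hsg]; exact usg _ i.2.le)
  have ex' : ∀ i : Fin n, _ := fun i => exists_row (Z * matAin n S * matPin n S) i (by
    rw [hta]; exact uta _ i.2.le)
  choose r r1 r2 r3 r4 using ex
  choose r' r1' r2' r3' r4' using ex'
  simp only [hta, hsg] at r4 r4'
  have base : ∀ v : Fin n → S, v 0 = 1 → (∀ j, 0 < j → v j = 0) → v = Pi.single 0 1 := by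
    intro v h0 h1
    ext j
    rcases eq_or_ne j 0 with rfl | hj
    · rw [h0, Pi.single_eq_same]
    · rw [h1 j (Fin.pos_iff_ne_zero.2 hj), Pi.single_eq_of_ne hj]
  have uniq : ∀ m ≤ n, ∀ v : Fin n → S, (∀ j : Fin n, m ≤ j → v j = 0) →
      (∀ j : Fin n, (j : ℕ) < m → Matrix.vecMul v (Z * matPin n S) j = 0) → v = 0 :=
    fun m hm => eq_zero_of_vecMul_minor hm _ (by rw [hsg]; exact usg _ hm)
  -- Commutation of A with Z turns a statement about r'_i A against ZP into one about r'_i against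
  -- ZAP.
  have hAZ : ∀ v : Fin n → S, Matrix.vecMul (Matrix.vecMul v (matAin n S)) (Z * matPin n S) =
      Matrix.vecMul v (Z * matAin n S * matPin n S) := fun v => by
    rw [Matrix.vecMul_vecMul, ← Matrix.mul_assoc, hZ]
  -- the diagonal comparison of the two factorizations
  have diag : ∀ i : Fin n, Matrix.vecMul (r' i) (Z * matAin n S * matPin n S) i =
      z i * Matrix.vecMul (r i) (Z * matPin n S) i := by
    intro i
    refine (uta i i.2.le).mul_left_cancel ((usg i i.2.le).mul_left_cancel ?_)
    linear_combination sg i * r4' i - hz i i.2 - ta i * z i * r4 i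
  have row' : ∀ i j : Fin n, (i : ℕ) + 1 < j → Matrix.vecMul (r' i) (matAin n S) j = 0 := by
    intro i j hj
    rw [vecMul_matAin, dif_pos (by omega), r2' i j (by rw [Fin.lt_def]; omega),
      r2' i _ (by rw [Fin.lt_def]; simp; omega)]
    simp
  refine ⟨r, r', base _ (r1 0) (r2 0), base _ (r1' 0) (r2' 0), ?_, ?_, ?_, r3', r4'⟩
  · intro i h
    rw [eq_sub_iff_add_eq, ← sub_eq_zero]
    -- At coordinate i + 1 the entry -1 of r'_i A cancels the entry 1 of r_{i+1}, so the difference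
    -- is supported on the first i + 1 coordinates. Its product with ZP vanishes in the first i
    -- columns by triangularity and in column i by `diag`.
    refine uniq (i + 1) (by omega) _ (fun j hj => ?_) (fun j hj => ?_)
    · rw [Pi.sub_apply, Pi.add_apply, Pi.smul_apply,
        r2 ⟨i, by omega⟩ j (by rw [Fin.lt_def]; exact hj), smul_zero, sub_zero]
      rcases eq_or_lt_of_le hj with h' | h'
      · obtain rfl : j = ⟨i + 1, h⟩ := Fin.ext h'.symm
        rw [r1, vecMul_matAin, dif_pos (by simp),
          r2' ⟨i, by omega⟩ ⟨i + 1, h⟩ (by rw [Fin.lt_def]; simp)]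
        have : r' ⟨i, by omega⟩ ⟨i + 1 - 1, by omega⟩ = 1 := r1' ⟨i, by omega⟩
        simp only [this]
        ring
      · rw [row' _ _ (by exact h'), r2 _ j (by rw [Fin.lt_def]; exact h'), add_zero]
    · rw [Matrix.sub_vecMul, Matrix.add_vecMul, hAZ, Matrix.smul_vecMul, Pi.sub_apply,
        Pi.add_apply, Pi.smul_apply, r3 ⟨i + 1, h⟩ j (by rw [Fin.lt_def]; exact hj), add_zero]
      rcases eq_or_lt_of_le (Nat.lt_succ_iff.1 hj) with h' | h'
      · have hin : i < n := by omega
        obtain rfl : j = ⟨i, hin⟩ := Fin.ext h'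
        rw [diag, smul_eq_mul, sub_self]
      · rw [r3' ⟨i, by omega⟩ j (by rw [Fin.lt_def]; exact h'),
          r3 ⟨i, by omega⟩ j (by rw [Fin.lt_def]; exact h'), smul_zero, sub_zero]
  · intro i h
    rw [← sub_eq_zero]
    refine uniq n le_rfl _ (fun j hj => absurd j.2 (by omega)) (fun j _ => ?_)
    rw [Matrix.sub_vecMul, hAZ, Matrix.smul_vecMul, Pi.sub_apply, Pi.smul_apply]
    rcases eq_or_lt_of_le (show (j : ℕ) ≤ i by omega) with h' | h'
    · have hin : i < n := by omega
      obtain rfl : j = ⟨i, hin⟩ := Fin.ext h'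
      rw [diag, smul_eq_mul, sub_self]
    · rw [r3' ⟨i, by omega⟩ j (by rw [Fin.lt_def]; exact h'),
        r3 ⟨i, by omega⟩ j (by rw [Fin.lt_def]; exact h'), smul_zero, sub_zero]
  · intro i h
    -- Since ZAP = ZPC and C shifts columns by one, the vanishing of r'_{i+1} ZAP in the columns up
    -- to i gives that of r'_{i+1} ZP in the columns before i.
    have hC : Matrix.vecMul (Matrix.vecMul (r' ⟨i + 1, h⟩) (Z * matPin n S)) (matCin n S) =
        Matrix.vecMul (r' ⟨i + 1, h⟩) (Z * matAin n S * matPin n S) := by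
      rw [Matrix.vecMul_vecMul, Matrix.mul_assoc, ← matAin_mul_matPin, ← Matrix.mul_assoc]
    set w := Matrix.vecMul (r' ⟨i + 1, h⟩) (Z * matPin n S) with hw
    have hC' : ∀ j : Fin n, _ := fun j =>
      (mul_matC w ⟨n - 1, by omega⟩ (by simp; omega) j).symm.trans (congrFun hC j)
    -- Column 0 of C is the last basis vector, because e_n = 1.
    have hlast : w ⟨n - 1, by omega⟩ = 0 := by
      have h0 := hC' ⟨0, by omega⟩
      rw [r3' ⟨i + 1, h⟩ ⟨0, by omega⟩ (by rw [Fin.lt_def]; simp), dif_neg (by simp), Nat.sub_zero,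
        elemU_full, map_one, mul_one, sub_zero] at h0
      exact h0
    have hstep : ∀ (j : ℕ) (hj : j + 1 < n), w ⟨j, by omega⟩ =
        -Matrix.vecMul (r' ⟨i + 1, h⟩) (Z * matAin n S * matPin n S) ⟨j + 1, hj⟩ := by
      intro j hj
      have h0 := hC' ⟨j + 1, hj⟩
      rw [hlast, zero_mul, dif_pos (by simp), zero_sub] at h0
      rw [← h0, neg_neg]
      rfl
    have hz' := hz i (by omega)
    have hQ' := hQ i h
    have r4a := r4 ⟨i, by omega⟩
    have r4a' := r4' ⟨i + 1, h⟩
    simp only at r4a r4a'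
    refine (sub_eq_zero.1 (uniq (i + 1) (by omega) _ (fun j hj => ?_) (fun j hj => ?_)))
    · rw [Pi.sub_apply, Pi.sub_apply, Pi.smul_apply,
        r2 ⟨i, by omega⟩ j (by rw [Fin.lt_def]; exact hj), smul_zero, sub_zero]
      rcases eq_or_lt_of_le hj with h' | h'
      · obtain rfl : j = ⟨i + 1, h⟩ := Fin.ext h'.symm
        rw [r1, r1', sub_self]
      · rw [r2 _ j (by rw [Fin.lt_def]; exact h'), r2' _ j (by rw [Fin.lt_def]; exact h'),
          sub_zero]
    · rw [Matrix.sub_vecMul, Matrix.sub_vecMul, Matrix.smul_vecMul, Pi.sub_apply,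
        Pi.sub_apply, Pi.smul_apply, r3 ⟨i + 1, h⟩ j (by rw [Fin.lt_def]; exact hj), zero_sub,
        sub_neg_eq_add, ← hw, smul_eq_mul]
      obtain ⟨j, hjn⟩ := j
      rw [hstep j (by simp at hj; omega)]
      rcases eq_or_lt_of_le (Nat.lt_succ_iff.1 hj) with h' | h'
      · simp only at h'
        subst h'
        -- In column i the claim is τ_{i+2} / τ_{i+1} = z_i Q_i σ_{i+1} / σ_i, cleared of
        -- denominators.
        refine (uta (j + 1) h.le).mul_left_cancel ((uta (j + 1) h.le).mul_left_cancel
          ((usg j hjn.le).mul_left_cancel ((uta j hjn.le).mul_left_cancel ?_)))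
        linear_combination (- (ta (j + 1) * sg j * ta j)) * r4a' +
          ta (j + 1) ^ 2 * ta j * z j * Q j * r4a + ta (j + 1) ^ 2 * Q j * hz' +
          ta (j + 1) * sg j * hQ'
      · rw [r3 ⟨i, by omega⟩ _ (by rw [Fin.lt_def]; exact h'),
          r3' ⟨i + 1, h⟩ _ (by rw [Fin.lt_def]; simpa using h')]
        ring

open Polynomial in
/-- The Toda polynomials, evaluated at `A`, produce the rows `r_i` and `r'_i`. -/
theorem vecMul_aeval_todaPoly {n : ℕ} [NeZero n] {S : Type*} [CommRing S]
    (A : Matrix (Fin n) (Fin n) S) (z Q : ℕ → S) (r r' : Fin n → Fin n → S)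
    (h0 : r 0 = Pi.single 0 1) (h0' : r' 0 = Pi.single 0 1)
    (h1 : ∀ (i : ℕ) (h : i + 1 < n), Matrix.vecMul (r' ⟨i, by omega⟩) A =
        z i • r ⟨i, by omega⟩ - r ⟨i + 1, h⟩)
    (h2 : ∀ (i : ℕ) (h : i + 1 = n), Matrix.vecMul (r' ⟨i, by omega⟩) A =
        z i • r ⟨i, by omega⟩)
    (h3 : ∀ (i : ℕ) (h : i + 1 < n),
      r' ⟨i + 1, h⟩ = r ⟨i + 1, h⟩ - (z i * Q i) • r ⟨i, by omega⟩) :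
    (∀ (i : ℕ) (h : i < n),
      Matrix.vecMul (Pi.single 0 1) (aeval A (todaPoly z Q i).1) = (-1 : S) ^ i • r ⟨i, h⟩ ∧
      Matrix.vecMul (Pi.single 0 1) (aeval A (todaPoly z Q i).2) = (-1 : S) ^ i • r' ⟨i, h⟩) ∧
    Matrix.vecMul (Pi.single 0 1) (aeval A (todaPoly z Q n).1) = 0 := by
  have step : ∀ (i : ℕ) (h : i < n),
      Matrix.vecMul (Pi.single 0 1) (aeval A (todaPoly z Q i).1) = (-1 : S) ^ i • r ⟨i, h⟩ →
      Matrix.vecMul (Pi.single 0 1) (aeval A (todaPoly z Q i).2) = (-1 : S) ^ i • r' ⟨i, h⟩ →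
      Matrix.vecMul (Pi.single 0 1) (aeval A (todaPoly z Q (i + 1)).1) =
        (-1 : S) ^ i • (Matrix.vecMul (r' ⟨i, h⟩) A - z i • r ⟨i, h⟩) := by
    intro i h e1 e2
    rw [todaPoly]
    simp only
    rw [mul_comm X, map_sub, map_mul, aeval_X, ← smul_eq_C_mul, map_smul, Matrix.vecMul_sub,
      ← Matrix.vecMul_vecMul, e2, Matrix.vecMul_smul, e1, Matrix.smul_vecMul, smul_sub,
      smul_comm]
  have main : ∀ (i : ℕ) (h : i < n),
      Matrix.vecMul (Pi.single 0 1) (aeval A (todaPoly z Q i).1) = (-1 : S) ^ i • r ⟨i, h⟩ ∧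
      Matrix.vecMul (Pi.single 0 1) (aeval A (todaPoly z Q i).2) = (-1 : S) ^ i • r' ⟨i, h⟩ := by
    intro i
    induction i with
    | zero =>
      intro h
      have e : (⟨0, h⟩ : Fin n) = 0 := rfl
      simp [todaPoly, e, h0, h0']
    | succ i ih =>
      intro h
      obtain ⟨e1, e2⟩ := ih (by omega)
      have e3 : Matrix.vecMul (Pi.single 0 1) (aeval A (todaPoly z Q (i + 1)).1) =
          (-1 : S) ^ (i + 1) • r ⟨i + 1, h⟩ := by
        rw [step i (by omega) e1 e2, h1 i h, pow_succ, mul_neg_one, neg_smul, ← smul_neg]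
        congr 1
        abel
      refine ⟨e3, ?_⟩
      have e4 : (todaPoly z Q (i + 1)).2 =
          (todaPoly z Q (i + 1)).1 + C (z i * Q i) * (todaPoly z Q i).1 := rfl
      rw [e4, map_add, ← smul_eq_C_mul, map_smul, Matrix.vecMul_add, e3, Matrix.vecMul_smul, e1,
        h3 i h, smul_comm, pow_succ, mul_neg_one, neg_smul, neg_smul, smul_sub]
      abel
  refine ⟨main, ?_⟩
  -- For the last row there is no r_{i+1} in the Lax relation, so the final recursion step gives
  -- zero.
  obtain ⟨m, hm⟩ : ∃ m, m + 1 = n := ⟨n - 1, by have := NeZero.pos n; omega⟩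
  have e := main m (by omega)
  have e2 := step m (by omega) e.1 e.2
  rw [h2 m hm, sub_self, smul_zero] at e2
  rw [← e2, hm]

/-! ### Cyclicity of the first basis vector, and the equations of the phase space. -/

theorem single_vecMul_matPin (n : ℕ) [NeZero n] (S : Type*) [CommRing S] [Algebra (RT n) S] :
    Matrix.vecMul (Pi.single 0 1) (matPin n S) = Pi.single 0 1 := by
  rw [Matrix.single_one_vecMul]
  ext j
  rw [Matrix.row_apply, matPin, Matrix.map_apply, matP_apply]
  rcases eq_or_ne j 0 with rfl | hj
  · rw [if_pos le_rfl, Nat.sub_self, elemU_zero, map_one, Pi.single_eq_same]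
  · rw [if_neg (not_le.2 (Fin.pos_iff_ne_zero.2 hj)), map_zero, Pi.single_eq_of_ne hj]

theorem single_vecMul_matCin_pow (n : ℕ) [NeZero n] (S : Type*) [CommRing S] [Algebra (RT n) S]
    (k : ℕ) (hk : k < n) :
    Matrix.vecMul (Pi.single 0 1) (matCin n S ^ k) =
      Pi.single (⟨k, hk⟩ : Fin n) ((-1 : S) ^ k) := by
  induction k with
  | zero => rw [pow_zero, Matrix.vecMul_one, pow_zero]; rfl
  | succ k ih =>
    rw [pow_succ, ← Matrix.vecMul_vecMul, ih (by omega)]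
    ext j
    rw [matCin, mul_matC _ ⟨n - 1, by omega⟩ (by simp; omega) j,
      Pi.single_eq_of_ne (by rw [Ne, Fin.ext_iff]; simp; omega), zero_mul, zero_sub, pow_succ,
      mul_neg_one]
    simp only [Pi.single_apply, Fin.ext_iff]
    split_ifs <;> first | rfl | omega | simp

theorem single_vecMul_matCin_pow_self (n : ℕ) [NeZero n] (S : Type*) [CommRing S]
    [Algebra (RT n) S] (j : Fin n) :
    Matrix.vecMul (Pi.single 0 1) (matCin n S ^ n) j =
      (-1 : S) ^ (n - 1) * algebraMap (RT n) S (elemU n n (n - j)) := by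
  have hn := NeZero.pos n
  conv_lhs => rw [show matCin n S ^ n = matCin n S ^ (n - 1) * matCin n S by
    rw [← pow_succ]; congr 1; omega]
  rw [← Matrix.vecMul_vecMul, single_vecMul_matCin_pow n S (n - 1) (by omega), matCin,
    mul_matC _ ⟨n - 1, by omega⟩ (by simp; omega) j, Pi.single_eq_same]
  split_ifs with h
  · rw [Pi.single_eq_of_ne (by rw [Ne, Fin.ext_iff]; simp; omega), sub_zero]
  · rw [sub_zero]

-- Serves three relations: AP = PC, the commutation of A with Z, and that of A with ZA.
open Polynomial in
theorem aeval_mul_of_mul_eq {n : ℕ} {S : Type*} [CommRing S] {A P C : Matrix (Fin n) (Fin n) S}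
    (h : A * P = P * C) (f : S[X]) : aeval A f * P = P * aeval C f := by
  induction f using Polynomial.induction_on' with
  | add p q hp hq => rw [map_add, map_add, add_mul, mul_add, hp, hq]
  | monomial k a =>
    have hk : A ^ k * P = P * C ^ k := by
      induction k with
      | zero => simp
      | succ k ih => rw [pow_succ, mul_assoc, h, ← mul_assoc, ih, mul_assoc, ← pow_succ]
    rw [← C_mul_X_pow_eq_monomial, map_mul, map_mul, aeval_X_pow, aeval_X_pow, aeval_C, aeval_C,
      mul_assoc, hk, ← mul_assoc, ← mul_assoc, Algebra.commutes]

-- The first row of P is e_1, so the hypothesis carries over to C. There e_1 C^k is, up to sign, the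
-- basis vector at position k for k < n, while e_1 C^n has the e_m as coordinates up to sign. A
-- monic polynomial of degree n that kills e_1 therefore has its coefficients forced.
open Polynomial in
theorem todaF_eq_of_vecMul_eq_zero {n : ℕ} [NeZero n] {S : Type*} [CommRing S]
    [Algebra (RT n) S] (z Q : ℕ → S) (hQ : Q (n - 1) = 0)
    (h : Matrix.vecMul (Pi.single 0 1) (aeval (matAin n S) (todaPoly z Q n).1) = 0) (m : ℕ)
    (h1 : 1 ≤ m) (hm : m ≤ n) : todaF z Q n m = algebraMap (RT n) S (elemU n n m) := by
  have hn := NeZero.pos n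
  have hC := congrArg (fun v => Matrix.vecMul v (matPin n S)) h
  simp only [Matrix.vecMul_vecMul, Matrix.zero_vecMul] at hC
  rw [aeval_mul_of_mul_eq (matAin_mul_matPin n S), ← Matrix.vecMul_vecMul,
    single_vecMul_matPin, (todaPoly_eq z Q n).1] at hC
  -- With the convention Q_n = 0, cutting the last parameter changes nothing.
  have hcut : ∀ m, todaF z (cutQ Q n) n m = todaF z Q n m := fun m =>
    todaF_congr _ _ _ _ _ fun j hj => by
      rw [cutQ]
      split_ifs with h'
      · rw [← hQ]; congr 1; omega
      · rfl
  have hj := congrFun hC ⟨n - m, by omega⟩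
  simp only [hcut, ← smul_eq_C_mul] at hj
  -- At coordinate n - m only the leading power X^n and the term with X^{n-m} contribute.
  rw [Finset.sum_range_succ', map_add, map_sum, Matrix.vecMul_add, Matrix.vecMul_sum,
    Pi.add_apply, Finset.sum_apply, Finset.sum_eq_single (m - 1)] at hj
  · rw [map_smul, map_smul, Matrix.vecMul_smul, Matrix.vecMul_smul, Pi.smul_apply, Pi.smul_apply,
      aeval_X_pow, aeval_X_pow, Nat.sub_add_cancel h1, Nat.sub_zero,
      single_vecMul_matCin_pow_self, todaF_zero,
      single_vecMul_matCin_pow n S (n - m) (by omega), Pi.single_eq_same, smul_eq_mul,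
      smul_eq_mul] at hj
    rw [show n - (⟨n - m, by omega⟩ : Fin n).val = m by simp; omega] at hj
    have e1 : (-1 : S) ^ m * (-1) ^ (n - m) = (-1) ^ n := by
      rw [← pow_add]; congr 1; omega
    have e2 : (-1 : S) ^ (n - 1) = -(-1) ^ n := by
      conv_rhs => rw [show n = n - 1 + 1 by omega, pow_succ]
      ring
    have e3 : (-1 : S) ^ n * (-1) ^ n = 1 := by rw [← mul_pow]; simp
    rw [e2, Pi.zero_apply] at hj
    linear_combination (-1) ^ n * hj - (-1) ^ n * todaF z Q n m * e1 -
      (todaF z Q n m - algebraMap (RT n) S (elemU n n m)) * e3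
  · intro k hk hkm
    have := Finset.mem_range.1 hk
    rw [map_smul, Matrix.vecMul_smul, Pi.smul_apply, aeval_X_pow,
      single_vecMul_matCin_pow n S (n - (k + 1)) (by omega),
      Pi.single_eq_of_ne (by rw [Ne, Fin.ext_iff]; simp; omega), smul_zero]
  · intro h'
    exact absurd (Finset.mem_range.2 (by omega)) h'

/-! ### Construction and uniqueness of Φ_n. -/

/-- `τ_m` as an element of the localized ring. -/
def tauO (n m : ℕ) : OZo n := algebraMap (OZ n) (OZo n) (tau n m)

/-- `σ_m` as an element of the localized ring. -/
def sigO (n m : ℕ) : OZo n := algebraMap (OZ n) (OZo n) (sig n m)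

theorem isUnit_tauO {n m : ℕ} (h : m ≤ n) : IsUnit (tauO n m) :=
  IsLocalization.map_units (OZo n) (⟨_, tau_mem h⟩ : tauSet n)

theorem isUnit_sigO {n m : ℕ} (h : m ≤ n) : IsUnit (sigO n m) :=
  IsLocalization.map_units (OZo n) (⟨_, sig_mem h⟩ : tauSet n)

/-- The value `τ_i σ_{i-1} / (σ_i τ_{i-1})` of `Φ_n` at `z_i`. -/
def phiZ (n : ℕ) (i : Fin n) : OZo n :=
  IsLocalization.mk' (OZo n) (tau n (i + 1) * sig n i)
    (⟨sig n (i + 1) * tau n i, mul_mem (sig_mem (by omega)) (tau_mem (by omega))⟩ : tauSet n)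

/-- The value `τ_{i-1} τ_{i+1} / τ_i²` of `Φ_n` at `Q_i`. -/
def phiQ (n : ℕ) (i : Fin (n - 1)) : OZo n :=
  IsLocalization.mk' (OZo n) (tau n i * tau n (i + 2))
    (⟨tau n (i + 1) ^ 2, pow_mem (tau_mem (by omega)) 2⟩ : tauSet n)

theorem phiZ_spec {n i : ℕ} (h : i < n) :
    extZero (phiZ n) i * (sigO n (i + 1) * tauO n i) = tauO n (i + 1) * sigO n i := by
  rw [extZero, dif_pos h]
  have := IsLocalization.mk'_spec (OZo n) (tau n (i + 1) * sig n i)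
    (⟨sig n (i + 1) * tau n i, mul_mem (sig_mem (by omega)) (tau_mem (by omega))⟩ : tauSet n)
  rw [map_mul, map_mul] at this
  exact this

theorem phiQ_spec {n i : ℕ} (h : i + 1 < n) :
    extZero (phiQ n) i * tauO n (i + 1) ^ 2 = tauO n i * tauO n (i + 2) := by
  rw [extZero, dif_pos (show i < n - 1 by omega)]
  have := IsLocalization.mk'_spec (OZo n) (tau n i * tau n (i + 2))
    (⟨tau n (i + 1) ^ 2, pow_mem (tau_mem (by omega)) 2⟩ : tauSet n)
  rw [map_pow, map_mul] at this
  exact this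

/-- The matrix `Z` with entries in the localized ring. -/
def matZo (n : ℕ) : Matrix (Fin n) (Fin n) (OZo n) := (matZ n).map (algebraMap (OZ n) (OZo n))

theorem map_matAin (n : ℕ) : (matAin n (OZ n)).map (algebraMap (OZ n) (OZo n)) =
    matAin n (OZo n) := by
  ext i j
  simp only [matAin, Matrix.map_apply]
  exact (IsScalarTower.algebraMap_apply _ _ _ _).symm

theorem map_matPin (n : ℕ) : (matPin n (OZ n)).map (algebraMap (OZ n) (OZo n)) =
    matPin n (OZo n) := by
  ext i j
  simp only [matPin, Matrix.map_apply]
  exact (IsScalarTower.algebraMap_apply _ _ _ _).symm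

theorem matZo_comm (n : ℕ) : matAin n (OZo n) * matZo n = matZo n * matAin n (OZo n) := by
  rw [← map_matAin, matZo, ← Matrix.map_mul, matZ_comm, Matrix.map_mul]

theorem minor_matZo_tau (n m : ℕ) :
    minor m (matZo n * matAin n (OZo n) * matPin n (OZo n)) = tauO n m := by
  rw [← map_matAin, ← map_matPin, matZo, ← Matrix.map_mul, ← Matrix.map_mul]
  exact map_minor _ _ _

theorem minor_matZo_sig (n m : ℕ) : minor m (matZo n * matPin n (OZo n)) = sigO n m := by
  rw [← map_matPin, matZo, ← Matrix.map_mul]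
  exact map_minor _ _ _

open Polynomial in
/-- The Lax representation at the point `Φ_n(z), Φ_n(Q)`. -/
theorem exists_rows_phi (n : ℕ) [NeZero n] : ∃ r' : Fin n → Fin n → OZo n,
    (∀ (i : ℕ) (h : i < n), Matrix.vecMul (Pi.single 0 1)
      (aeval (matAin n (OZo n)) (todaPoly (extZero (phiZ n)) (extZero (phiQ n)) i).2) =
        (-1 : OZo n) ^ i • r' ⟨i, h⟩) ∧
    Matrix.vecMul (Pi.single 0 1)
      (aeval (matAin n (OZo n)) (todaPoly (extZero (phiZ n)) (extZero (phiQ n)) n).1) = 0 ∧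
    (∀ i j, j < i →
      Matrix.vecMul (r' i) (matZo n * matAin n (OZo n) * matPin n (OZo n)) j = 0) ∧
    (∀ i : Fin n, tauO n i *
      Matrix.vecMul (r' i) (matZo n * matAin n (OZo n) * matPin n (OZo n)) i =
        tauO n (i + 1)) := by
  obtain ⟨r, r', h0, h0', h1, h2, h3, h4, h5⟩ := exists_lax_rows (matZo n) (matZo_comm n)
    (tauO n) (sigO n) (minor_matZo_tau n) (minor_matZo_sig n) (fun _ => isUnit_tauO)
    (fun _ => isUnit_sigO) (extZero (phiZ n)) (extZero (phiQ n)) (fun _ => phiZ_spec)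
    (fun _ => phiQ_spec)
  obtain ⟨h6, h7⟩ := vecMul_aeval_todaPoly (matAin n (OZo n)) _ _ r r' h0 h0' h1 h2 h3
  exact ⟨r', fun i h => (h6 i h).2, h7, h4, h5⟩

/-- The values of `Φ_n` on the variables `z` and `Q`. -/
def phiVar (n : ℕ) : YVar n → OZo n
  | YVar.z i => phiZ n i
  | YVar.Q i => phiQ n i

/-- The Lax representation at the prescribed values annihilates e_1, which is all that the equations
of the phase space require. -/
theorem aeval_phiVar_relY (n : ℕ) [NeZero n] (f : PolyY n) (hf : f ∈ relY n) :
    MvPolynomial.aeval (phiVar n) f = 0 := by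
  rw [← RingHom.mem_ker]
  refine (Ideal.span_le (I := RingHom.ker (MvPolynomial.aeval (R := RT n) (phiVar n)))).2 ?_ hf
  rintro _ ⟨i, h1, hi, rfl⟩
  obtain ⟨-, -, h, -⟩ := exists_rows_phi n
  rw [SetLike.mem_coe, RingHom.mem_ker, map_sub, sub_eq_zero, MvPolynomial.aeval_C, ← elemU_self,
    ← todaF_eq_of_vecMul_eq_zero _ _ (by simp [extZero]) h i h1 hi]
  refine (map_todaF (MvPolynomial.aeval (R := RT n) (phiVar n) : PolyY n →+* OZo n) _ _ _ _).trans ?_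
  simp only [map_extZero, RingHom.coe_coe, MvPolynomial.aeval_X, phiVar]

/-- The map `Φ_n` before localization. -/
def phiY (n : ℕ) [NeZero n] : OY n →ₐ[RT n] OZo n :=
  Ideal.Quotient.liftₐ (relY n) (MvPolynomial.aeval (phiVar n)) (aeval_phiVar_relY n)

theorem phiY_mkY (n : ℕ) [NeZero n] (f : PolyY n) :
    phiY n (mkY n f) = MvPolynomial.aeval (phiVar n) f := rfl

theorem isUnit_phiQ {n : ℕ} (i : Fin (n - 1)) : IsUnit (phiQ n i) := by
  have h := phiQ_spec (n := n) (i := i) (by omega)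
  rw [extZero, dif_pos i.2] at h
  refine isUnit_of_mul_isUnit_left (y := tauO n (i + 1) ^ 2) ?_
  rw [h]
  exact (isUnit_tauO (by omega)).mul (isUnit_tauO (by omega))

theorem isUnit_phiY_QSet (n : ℕ) [NeZero n] (y : QSet n) : IsUnit (phiY n y) := by
  have h : QSet n ≤ (IsUnit.submonoid (OZo n)).comap (phiY n) := by
    rw [QSet, Submonoid.closure_le]
    rintro _ ⟨i, rfl⟩
    change IsUnit (phiY n (mkY n _))
    rw [phiY_mkY, MvPolynomial.aeval_X]
    exact isUnit_phiQ i
  exact h y.2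

/-- The `K`-Peterson map `Φ_n`. -/
def phi (n : ℕ) [NeZero n] : OYo n →ₐ[RT n] OZo n :=
  IsLocalization.liftAlgHom (M := QSet n) (f := phiY n) (isUnit_phiY_QSet n)

theorem isPhi_phi (n : ℕ) [NeZero n] : IsPhi (phi n) := by
  have h : ∀ f, phi n (classY f) = MvPolynomial.aeval (phiVar n) f := fun f =>
    IsLocalization.lift_eq (M := QSet n) _ _
  exact ⟨fun i => (h _).trans (MvPolynomial.aeval_X _ _),
    fun i => (h _).trans (MvPolynomial.aeval_X _ _)⟩

theorem IsPhi.apply_classY {n : ℕ} {Φ : OYo n →ₐ[RT n] OZo n} (h : IsPhi Φ) (f : PolyY n) :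
    Φ (classY f) = MvPolynomial.aeval (phiVar n) f := by
  let g : PolyY n →ₐ[RT n] OYo n := (IsScalarTower.toAlgHom (RT n) (OY n) (OYo n)).comp (mkY n)
  have : Φ.comp g = MvPolynomial.aeval (phiVar n) := by
    refine MvPolynomial.algHom_ext fun v => ?_
    rw [MvPolynomial.aeval_X]
    cases v with
    | z i => exact h.1 i
    | Q i => exact h.2 i
  exact DFunLike.congr_fun this f

theorem IsPhi.unique {n : ℕ} {Φ Ψ : OYo n →ₐ[RT n] OZo n} (hΦ : IsPhi Φ) (hΨ : IsPhi Ψ) :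
    Φ = Ψ := by
  have : (Φ : OYo n →+* OZo n) = Ψ := by
    refine IsLocalization.ringHom_ext (QSet n) (RingHom.ext fun x => ?_)
    obtain ⟨f, rfl⟩ : ∃ f, mkY n f = x := Ideal.Quotient.mk_surjective x
    exact (hΦ.apply_classY f).trans (hΨ.apply_classY f).symm
  exact AlgHom.coe_ringHom_injective this

/-! ### Demazure operators: braid relations and independence of the chain of ascents. -/

section Demazure

variable {R : Type*} [CommRing R] [IsDomain R]

/-- After multiplication by (a - b)(a - c)(b - c) either side expands over the six elements of the
group generated by s and t. The two expansions differ only in sts against tst, and in a domain the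
factor can be cancelled. -/
theorem demazure_braid {a b c : R} (hab : a - b ≠ 0) (hac : a - c ≠ 0) (hbc : b - c ≠ 0)
    (s t : R →+* R) (sa : s a = b) (sb : s b = a) (sc : s c = c) (ta : t a = a) (tb : t b = c)
    (tc : t c = b) (ss : ∀ f, s (s f) = f) (tt : ∀ f, t (t f) = f)
    (hst : ∀ f, s (t (s f)) = t (s (t f))) (D E : R → R)
    (hD : ∀ f, (a - b) * D f = a * s f - b * f) (hE : ∀ f, (b - c) * E f = b * t f - c * f)
    (f : R) : D (E (D f)) = E (D (E f)) := by
  have D1 : (a - b) * (a - c) * (b - c) * D (E (D f)) = a ^ 2 * b * s (t (s f)) -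
      a ^ 2 * c * s (t f) - a * b ^ 2 * t (s f) + b ^ 2 * c * t f + a * c ^ 2 * s f -
      b * c ^ 2 * f := by
    have h1 := hD f
    have h2 := hE (D f)
    have h3 := hD (E (D f))
    have h4 := congrArg t h1
    have h5 := congrArg s h2
    have h6 := congrArg s h1
    have h7 := congrArg s h4
    simp only [map_mul, map_sub, sa, sb, sc, ta, tb, ss] at h4 h5 h6 h7
    refine mul_left_cancel₀ hab ?_
    linear_combination (a - b) * (a - c) * (b - c) * h3 + a * (a - b) * (b - c) * h5 +
      a ^ 2 * (a - b) * h7 + a * c * (b - c) * h6 - b * (a - c) * (a - b) * h2 -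
      b ^ 2 * (a - b) * h4 + b * c * (a - c) * h1
  have D2 : (a - b) * (a - c) * (b - c) * E (D (E f)) = a ^ 2 * b * t (s (t f)) -
      a ^ 2 * c * s (t f) - a * b ^ 2 * t (s f) + b ^ 2 * c * t f + a * c ^ 2 * s f -
      b * c ^ 2 * f := by
    have h1 := hE f
    have h2 := hD (E f)
    have h3 := hE (D (E f))
    have h4 := congrArg s h1
    have h5 := congrArg t h2
    have h6 := congrArg t h1
    have h7 := congrArg t h4
    simp only [map_mul, map_sub, sb, sc, ta, tb, tc, tt] at h4 h5 h6 h7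
    refine mul_left_cancel₀ hbc ?_
    linear_combination (a - b) * (a - c) * (b - c) * h3 + b * (a - b) * (b - c) * h5 +
      a * b * (b - c) * h7 + b * c * (a - b) * h6 - c * (a - c) * (b - c) * h2 -
      a * c * (b - c) * h4 + b * c * (a - c) * h1
  refine mul_left_cancel₀ (mul_ne_zero (mul_ne_zero hab hac) hbc) ?_
  rw [D1, D2, hst]

theorem demazure_comm {a b c d : R} (hab : a - b ≠ 0) (hcd : c - d ≠ 0)
    (s t : R →+* R) (sc : s c = c) (sd : s d = d) (ta : t a = a) (tb : t b = b)
    (hst : ∀ f, s (t f) = t (s f)) (D E : R → R)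
    (hD : ∀ f, (a - b) * D f = a * s f - b * f) (hE : ∀ f, (c - d) * E f = c * t f - d * f)
    (f : R) : D (E f) = E (D f) := by
  have h1 := hD f
  have h2 := hE f
  have h3 := hD (E f)
  have h4 := hE (D f)
  have h5 := congrArg s h2
  have h6 := congrArg t h1
  simp only [map_mul, map_sub, sc, sd, ta, tb, ← hst] at h5 h6
  refine mul_left_cancel₀ (mul_ne_zero hab hcd) ?_
  linear_combination (c - d) * h3 - (a - b) * h4 + a * h5 - c * h6 - b * h2 + d * h1

end Demazure

/-- The variable `1 - η_i`. -/
def xv {n : ℕ} (i : Fin n) : PolyG n := 1 - MvPolynomial.X (GVar.eta i)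

theorem permEta_xv {n : ℕ} (π : Equiv.Perm (Fin n)) (i : Fin n) :
    permEta π (xv i) = xv (π i) := by
  simp [xv, permEta]

theorem permEta_mul {n : ℕ} (π ρ : Equiv.Perm (Fin n)) (f : PolyG n) :
    permEta (π * ρ) f = permEta π (permEta ρ f) := by
  rw [permEta, permEta, permEta, MvPolynomial.rename_rename]
  congr 2
  ext v
  cases v <;> rfl

theorem permEta_one {n : ℕ} (f : PolyG n) : permEta 1 f = f := by
  have : permEta (1 : Equiv.Perm (Fin n)) = AlgHom.id ℤ _ := by
    refine MvPolynomial.algHom_ext fun v => ?_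
    cases v <;> simp [permEta]
  rw [this, AlgHom.id_apply]

theorem xv_sub_ne_zero {n : ℕ} {i j : Fin n} (h : i ≠ j) : xv i - xv j ≠ 0 := by
  rw [xv, xv, sub_sub_sub_cancel_left, sub_ne_zero]
  intro h'
  have := MvPolynomial.X_injective h'
  exact h (GVar.eta.inj this).symm

theorem lo_ne_hi {n : ℕ} (i : Fin (n - 1)) : lo i ≠ hi i := fun h => by
  simpa [lo, hi] using congrArg Fin.val h

/-- In the variables x_i = 1 - η_i the operator is the isobaric divided difference with numerator
x_i s_i f - x_{i+1} f. In this form the chosen quotient is never needed again. -/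
theorem demQ_spec {n : ℕ} (i : Fin (n - 1)) (f : PolyG n) :
    (xv (lo i) - xv (hi i)) * demQ i f =
      xv (lo i) * permEta (Equiv.swap (lo i) (hi i)) f - xv (hi i) * f := by
  have h := (eta_sub_dvd (lo i) (hi i) f).choose_spec
  rw [demQ]
  simp only [xv] at h ⊢
  linear_combination (-(1 - MvPolynomial.X (GVar.eta (lo i)))) * h

theorem permEta_demQ {n : ℕ} (i : Fin (n - 1)) (f : PolyG n) :
    permEta (Equiv.swap (lo i) (hi i)) (demQ i f) = demQ i f := by
  have h := demQ_spec i f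
  have h' := congrArg (permEta (Equiv.swap (lo i) (hi i))) h
  simp only [map_mul, map_sub, permEta_xv, Equiv.swap_apply_left, Equiv.swap_apply_right,
    ← permEta_mul, Equiv.swap_mul_self, permEta_one] at h'
  refine mul_left_cancel₀ (xv_sub_ne_zero (lo_ne_hi i)) ?_
  linear_combination -h' - h

theorem swap_braid {α : Type*} [DecidableEq α] {a b c : α} (hab : a ≠ b) (hac : a ≠ c)
    (hbc : b ≠ c) : Equiv.swap a b * Equiv.swap b c * Equiv.swap a b =
      Equiv.swap b c * Equiv.swap a b * Equiv.swap b c := by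
  rw [Equiv.swap_mul_swap_mul_swap hab hac, Equiv.swap_comm a b, Equiv.swap_comm b c,
    Equiv.swap_mul_swap_mul_swap hbc.symm hac.symm, Equiv.swap_comm]

theorem demQ_braid {n : ℕ} (i j : Fin (n - 1)) (h : (i : ℕ) + 1 = j) (f : PolyG n) :
    demQ i (demQ j (demQ i f)) = demQ j (demQ i (demQ j f)) := by
  have hij : hi i = lo j := Fin.ext h
  have e1 : lo i ≠ hi i := lo_ne_hi i
  have e2 : hi i ≠ hi j := hij ▸ lo_ne_hi j
  have e3 : lo i ≠ hi j := fun h' => by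
    have := congrArg Fin.val h'; simp [lo, hi] at this; omega
  have hE := demQ_spec j
  rw [← hij] at hE
  refine demazure_braid (xv_sub_ne_zero e1) (xv_sub_ne_zero e3) (xv_sub_ne_zero e2)
    (permEta (Equiv.swap (lo i) (hi i)) : PolyG n →+* PolyG n)
    (permEta (Equiv.swap (hi i) (hi j)) : PolyG n →+* PolyG n)
    ?_ ?_ ?_ ?_ ?_ ?_ ?_ ?_ ?_ (demQ i) (demQ j) (demQ_spec i) hE f
  · simp [permEta_xv]
  · simp [permEta_xv]
  · simp [permEta_xv, Equiv.swap_apply_of_ne_of_ne e3.symm e2.symm]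
  · simp [permEta_xv, Equiv.swap_apply_of_ne_of_ne e1 e3]
  · simp [permEta_xv]
  · simp [permEta_xv]
  · intro f; simp [← permEta_mul, permEta_one]
  · intro f; simp [← permEta_mul, permEta_one]
  · intro f
    simp only [RingHom.coe_coe, ← permEta_mul, ← mul_assoc]
    rw [swap_braid e1 e3 e2]

theorem swap_commute {α : Type*} [DecidableEq α] {a b c d : α} (e1 : a ≠ c) (e2 : a ≠ d)
    (e3 : b ≠ c) (e4 : b ≠ d) :
    Equiv.swap a b * Equiv.swap c d = Equiv.swap c d * Equiv.swap a b := by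
  rw [Equiv.mul_swap_eq_swap_mul, Equiv.swap_apply_of_ne_of_ne e1.symm e3.symm,
    Equiv.swap_apply_of_ne_of_ne e2.symm e4.symm]

theorem demQ_comm {n : ℕ} (i j : Fin (n - 1)) (h : (i : ℕ) + 1 < j) (f : PolyG n) :
    demQ i (demQ j f) = demQ j (demQ i f) := by
  have e1 : lo i ≠ lo j := fun h' => by have := congrArg Fin.val h'; simp [lo] at this; omega
  have e2 : lo i ≠ hi j := fun h' => by have := congrArg Fin.val h'; simp [lo, hi] at this; omega
  have e3 : hi i ≠ lo j := fun h' => by have := congrArg Fin.val h'; simp [lo, hi] at this; omega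
  have e4 : hi i ≠ hi j := fun h' => by have := congrArg Fin.val h'; simp [hi] at this; omega
  refine demazure_comm (xv_sub_ne_zero (lo_ne_hi i)) (xv_sub_ne_zero (lo_ne_hi j))
    (permEta (Equiv.swap (lo i) (hi i)) : PolyG n →+* PolyG n)
    (permEta (Equiv.swap (lo j) (hi j)) : PolyG n →+* PolyG n)
    ?_ ?_ ?_ ?_ ?_ (demQ i) (demQ j) (demQ_spec i) (demQ_spec j) f
  · simp [permEta_xv, Equiv.swap_apply_of_ne_of_ne e1.symm e3.symm]
  · simp [permEta_xv, Equiv.swap_apply_of_ne_of_ne e2.symm e4.symm]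
  · simp [permEta_xv, Equiv.swap_apply_of_ne_of_ne e1 e2]
  · simp [permEta_xv, Equiv.swap_apply_of_ne_of_ne e3 e4]
  · intro f
    simp only [RingHom.coe_coe, ← permEta_mul]
    rw [swap_commute e1 e2 e3 e4]

theorem simpleMul_symm_apply {n : ℕ} (i : Fin (n - 1)) (w : Equiv.Perm (Fin n)) (k : Fin n) :
    (simpleMul i w).symm k = w.symm (Equiv.swap (lo i) (hi i) k) := rfl

/-- `𝔊_w = D_j 𝔊_{s_j w}` for every left ascent `j` of `w`. -/
theorem groth_eq_demQ {n : ℕ} (w : Equiv.Perm (Fin n)) (j : Fin (n - 1)) (hj : IsAscent w j) :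
    groth w = demQ j (groth (simpleMul j w)) := by
  have hne : (ascents w).Nonempty := ⟨j, Finset.mem_filter.2 ⟨Finset.mem_univ _, hj⟩⟩
  -- The definition climbs along the least ascent i. Another ascent j generates with i a group of
  -- rank two, and the claim for longer permutations brings both computations to the top of the same
  -- coset, where the braid or commutation relation identifies them.
  obtain ⟨i, hi'⟩ : ∃ i, i = (ascents w).min' hne := ⟨_, rfl⟩
  have hi : IsAscent w i := by
    rw [hi']; exact (Finset.mem_filter.1 ((ascents w).min'_mem hne)).2
  have hij : i ≤ j := by
    rw [hi']; exact Finset.min'_le _ _ (Finset.mem_filter.2 ⟨Finset.mem_univ _, hj⟩)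
  have hg : groth w = demQ i (groth (simpleMul i w)) := by
    rw [groth, dif_pos hne, ← hi']
  rcases eq_or_lt_of_le hij with rfl | hlt
  · exact hg
  have hlt' : (i : ℕ) < j := hlt
  rcases eq_or_lt_of_le (Nat.succ_le_of_lt hlt') with h | h
  · have hk : KPeterson.hi i = lo j := Fin.ext h
    have e1 : lo i ≠ KPeterson.hi i := lo_ne_hi i
    have e2 : KPeterson.hi i ≠ KPeterson.hi j := hk ▸ lo_ne_hi j
    have e3 : lo i ≠ KPeterson.hi j := fun h' => by
      have := congrArg Fin.val h'; simp [lo, KPeterson.hi] at this; omega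
    -- The inverse of w increases on three consecutive values, so the words i, j, i and j, i, j both
    -- go up in length at each step.
    have a1 : w.symm (lo i) < w.symm (KPeterson.hi i) := hi
    have a2 : w.symm (KPeterson.hi i) < w.symm (KPeterson.hi j) := by rw [hk]; exact hj
    have s1 : Equiv.swap (lo i) (KPeterson.hi i) (KPeterson.hi j) = KPeterson.hi j :=
      Equiv.swap_apply_of_ne_of_ne e3.symm e2.symm
    have s2 : Equiv.swap (KPeterson.hi i) (KPeterson.hi j) (lo i) = lo i :=
      Equiv.swap_apply_of_ne_of_ne e1 e3
    have b1 : IsAscent (simpleMul i w) j := by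
      simp only [IsAscent, simpleMul_symm_apply, ← hk, Equiv.swap_apply_right, s1]
      exact a1.trans a2
    have b2 : IsAscent (simpleMul j (simpleMul i w)) i := by
      simp only [IsAscent, simpleMul_symm_apply, ← hk, Equiv.swap_apply_left, s1, s2]
      exact a2
    have c1 : IsAscent (simpleMul j w) i := by
      simp only [IsAscent, simpleMul_symm_apply, ← hk, Equiv.swap_apply_left, s2]
      exact a1.trans a2
    have c2 : IsAscent (simpleMul i (simpleMul j w)) j := by
      simp only [IsAscent, simpleMul_symm_apply, ← hk, Equiv.swap_apply_right, s1, s2]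
      exact a1
    have hw : simpleMul i (simpleMul j (simpleMul i w)) =
        simpleMul j (simpleMul i (simpleMul j w)) := by
      simp only [simpleMul, ← mul_assoc, ← hk]
      rw [swap_braid e1 e3 e2]
    have d1 := stat_simpleMul_lt w i hi
    have d2 := stat_simpleMul_lt w j hj
    have d3 := stat_simpleMul_lt _ j b1
    have d4 := stat_simpleMul_lt _ i c1
    rw [hg, groth_eq_demQ (simpleMul i w) j b1, groth_eq_demQ _ i b2, hw,
      groth_eq_demQ (simpleMul j w) i c1, groth_eq_demQ _ j c2, demQ_braid i j h]
  · have e1 : lo i ≠ lo j := fun h' => by have := congrArg Fin.val h'; simp [lo] at this; omega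
    have e2 : lo i ≠ KPeterson.hi j := fun h' => by
      have := congrArg Fin.val h'; simp [lo, KPeterson.hi] at this; omega
    have e3 : KPeterson.hi i ≠ lo j := fun h' => by
      have := congrArg Fin.val h'; simp [lo, KPeterson.hi] at this; omega
    have e4 : KPeterson.hi i ≠ KPeterson.hi j := fun h' => by
      have := congrArg Fin.val h'; simp [KPeterson.hi] at this; omega
    have b1 : IsAscent (simpleMul i w) j := by
      simp only [IsAscent, simpleMul_symm_apply, Equiv.swap_apply_of_ne_of_ne e1.symm e3.symm,
        Equiv.swap_apply_of_ne_of_ne e2.symm e4.symm]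
      exact hj
    have c1 : IsAscent (simpleMul j w) i := by
      simp only [IsAscent, simpleMul_symm_apply, Equiv.swap_apply_of_ne_of_ne e1 e2,
        Equiv.swap_apply_of_ne_of_ne e3 e4]
      exact hi
    have hw : simpleMul j (simpleMul i w) = simpleMul i (simpleMul j w) := by
      simp only [simpleMul, ← mul_assoc]
      rw [swap_commute e1 e2 e3 e4]
    have d1 := stat_simpleMul_lt w i hi
    have d2 := stat_simpleMul_lt w j hj
    rw [hg, groth_eq_demQ (simpleMul i w) j b1, groth_eq_demQ (simpleMul j w) i c1, hw,
      demQ_comm i j h]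
termination_by stat w

/-! ### Antisymmetrization over the inner variables η_2, …, η_{n-1}. -/

/-- The embedding of `{2, …, n - 1}` into `{1, …, n}`. -/
def midEmb (m : ℕ) : Fin m ↪ Fin (m + 2) :=
  ⟨fun k => k.castSucc.succ, fun k l h => by simpa using h⟩

theorem midEmb_val {m : ℕ} (k : Fin m) : (midEmb m k : ℕ) = k + 1 := rfl

theorem midEmb_ne_zero {m : ℕ} (k : Fin m) : midEmb m k ≠ 0 := fun h => by
  have := congrArg Fin.val h
  rw [midEmb_val] at this
  exact Nat.succ_ne_zero _ this

theorem midEmb_ne_last {m : ℕ} (k : Fin m) : midEmb m k ≠ Fin.last (m + 1) := fun h => by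
  have := congrArg Fin.val h
  rw [midEmb_val, Fin.val_last] at this
  omega

/-- A permutation of `{2, …, n - 1}` as a permutation of `{1, …, n}`. -/
def midPerm (m : ℕ) : Equiv.Perm (Fin m) →* Equiv.Perm (Fin (m + 2)) :=
  Equiv.Perm.viaEmbeddingHom (midEmb m)

theorem midPerm_apply {m : ℕ} (π : Equiv.Perm (Fin m)) (k : Fin m) :
    midPerm m π (midEmb m k) = midEmb m (π k) :=
  Equiv.Perm.viaEmbedding_apply _ _ _

theorem midPerm_zero {m : ℕ} (π : Equiv.Perm (Fin m)) : midPerm m π 0 = 0 :=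
  Equiv.Perm.viaEmbedding_apply_of_notMem _ _ _ (by
    rintro ⟨k, hk⟩
    exact midEmb_ne_zero k hk)

theorem eq_midEmb {m : ℕ} {k : Fin (m + 2)} (h0 : k ≠ 0) (h1 : k ≠ Fin.last (m + 1)) :
    ∃ l, midEmb m l = k := by
  have h2 : (k : ℕ) ≠ 0 := fun h => h0 (Fin.ext h)
  have h3 : (k : ℕ) ≠ m + 1 := fun h => h1 (Fin.ext h)
  exact ⟨⟨k - 1, by omega⟩, Fin.ext (by rw [midEmb_val]; simp only; omega)⟩

theorem midPerm_last {m : ℕ} (π : Equiv.Perm (Fin m)) :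
    midPerm m π (Fin.last (m + 1)) = Fin.last (m + 1) :=
  Equiv.Perm.viaEmbedding_apply_of_notMem _ _ _ (by
    rintro ⟨k, hk⟩
    exact midEmb_ne_last k hk)

theorem midPerm_swap {m : ℕ} (k l : Fin m) :
    midPerm m (Equiv.swap k l) = Equiv.swap (midEmb m k) (midEmb m l) := by
  ext1 x
  by_cases h0 : x = 0
  · rw [h0, midPerm_zero, Equiv.swap_apply_of_ne_of_ne] <;> exact (midEmb_ne_zero _).symm
  by_cases h1 : x = Fin.last (m + 1)
  · rw [h1, midPerm_last, Equiv.swap_apply_of_ne_of_ne] <;> exact (midEmb_ne_last _).symm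
  obtain ⟨j, rfl⟩ := eq_midEmb h0 h1
  rw [midPerm_apply, (midEmb m).swap_apply]

/-- The variables `1 - η_2, …, 1 - η_{n-1}`. -/
def yv {m : ℕ} (k : Fin m) : PolyG (m + 2) := xv (midEmb m k)

theorem permEta_yv {m : ℕ} (π : Equiv.Perm (Fin m)) (k : Fin m) :
    permEta (midPerm m π) (yv k) = yv (π k) := by
  rw [yv, permEta_xv, midPerm_apply, yv]

/-- The antisymmetrization of `∏ (1 - η_k)^{k-2} f` over the permutations of
`η_2, …, η_{n-1}`. -/
def antiSym {m : ℕ} (f : PolyG (m + 2)) : PolyG (m + 2) :=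
  ∑ π : Equiv.Perm (Fin m), ((Equiv.Perm.sign π : ℤ) : PolyG (m + 2)) *
    (∏ l, yv (π l) ^ (l : ℕ)) * permEta (midPerm m π) f

/-- The summands of D_i f - f at π and at π s_i cancel. Their weights have the exponents k and k + 1
interchanged and opposite signs, D_i f is symmetric under s_i, and what remains is a multiple of the
relation that defines D_i f. -/
theorem antiSym_demQ {m : ℕ} (i : Fin (m + 2 - 1)) (k : ℕ) (hk : k + 1 < m)
    (h0 : lo i = midEmb m ⟨k, by omega⟩) (h1 : hi i = midEmb m ⟨k + 1, hk⟩)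
    (f : PolyG (m + 2)) : antiSym (demQ i f) = antiSym f := by
  rw [antiSym, antiSym, ← sub_eq_zero, ← Finset.sum_sub_distrib]
  set p : Fin m := ⟨k, by omega⟩ with hp
  set q : Fin m := ⟨k + 1, hk⟩ with hq
  have hpq : p ≠ q := by simp [hp, hq]
  refine Finset.sum_ninvolution (fun π => π * Equiv.swap p q) (fun π => ?_) (fun π _ h => ?_)
    (fun _ => Finset.mem_univ _) (fun π => by rw [mul_assoc, Equiv.swap_mul_self, mul_one])
  · have hD := congrArg (permEta (midPerm m π)) (demQ_spec i f)
    rw [map_mul, map_sub, map_sub, map_mul, map_mul, h0, h1, ← yv, ← yv, permEta_yv, permEta_yv,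
      ← midPerm_swap, ← permEta_mul, ← map_mul] at hD
    have hDs : permEta (midPerm m (π * Equiv.swap p q)) (demQ i f) =
        permEta (midPerm m π) (demQ i f) := by
      rw [map_mul, permEta_mul, midPerm_swap, ← h0, ← h1, permEta_demQ]
    -- The factor c collects the positions other than p and q, which π and its partner share.
    obtain ⟨c, hc⟩ : ∃ c : PolyG (m + 2), ∀ ρ : Equiv.Perm (Fin m),
        (∀ l, l ≠ p → l ≠ q → ρ l = π l) →
        ∏ l, yv (ρ l) ^ (l : ℕ) = c * (yv (ρ p) ^ k * yv (ρ q) ^ (k + 1)) := by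
      refine ⟨∏ l ∈ (Finset.univ.erase p).erase q, yv (π l) ^ (l : ℕ), fun ρ hρ => ?_⟩
      rw [← Finset.mul_prod_erase _ _ (Finset.mem_univ p),
        ← Finset.mul_prod_erase (Finset.univ.erase p) _
          (Finset.mem_erase.2 ⟨hpq.symm, Finset.mem_univ q⟩)]
      have : ∏ l ∈ (Finset.univ.erase p).erase q, yv (ρ l) ^ (l : ℕ) =
          ∏ l ∈ (Finset.univ.erase p).erase q, yv (π l) ^ (l : ℕ) := by
        refine Finset.prod_congr rfl fun l hl => ?_
        simp only [Finset.mem_erase, Finset.mem_univ, and_true] at hl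
        rw [hρ l hl.2 hl.1]
      rw [this]
      ring
    have e1 := hc π (fun _ _ _ => rfl)
    have e2 := hc (π * Equiv.swap p q) (fun l hl hl' => by
      rw [Equiv.Perm.mul_apply, Equiv.swap_apply_of_ne_of_ne hl hl'])
    rw [Equiv.Perm.mul_apply, Equiv.Perm.mul_apply, Equiv.swap_apply_left,
      Equiv.swap_apply_right] at e2
    rw [hDs, e1, e2, Equiv.Perm.sign_mul, Equiv.Perm.sign_swap hpq]
    push_cast
    linear_combination (-((Equiv.Perm.sign π : ℤ) : PolyG (m + 2)) * c *
      (yv (π p) * yv (π q)) ^ k) * hD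
  · have := mul_eq_left.1 h
    exact hpq (Equiv.swap_eq_one_iff.1 this)

/-- Each inner simple reflection is an ascent of w, so 𝔊_w lies in the image of each inner Demazure
operator and is invariant under adjacent transpositions, which generate the group. -/
theorem permEta_midPerm_groth {m : ℕ} (w : Equiv.Perm (Fin (m + 2)))
    (hw : ∀ (k : ℕ) (h : k + 1 < m), w.symm (midEmb m ⟨k, by omega⟩) <
      w.symm (midEmb m ⟨k + 1, h⟩)) (π : Equiv.Perm (Fin m)) :
    permEta (midPerm m π) (groth w) = groth w := by
  let N : Submonoid (Equiv.Perm (Fin m)) :=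
    { carrier := {π | permEta (midPerm m π) (groth w) = groth w}
      one_mem' := by rw [Set.mem_ofPred_eq, map_one, permEta_one]
      mul_mem' := fun {a b} ha hb => by
        rw [Set.mem_ofPred_eq] at ha hb ⊢
        rw [map_mul, permEta_mul, hb, ha] }
  have hN : N = ⊤ := by
    cases m with
    | zero =>
      refine top_unique fun π _ => ?_
      rw [Subsingleton.elim π 1]
      exact N.one_mem
    | succ m =>
      rw [eq_top_iff, ← Equiv.Perm.mclosure_swap_castSucc_succ, Submonoid.closure_le]
      rintro _ ⟨i, rfl⟩
      change permEta (midPerm _ _) _ = _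
      let j : Fin (m + 1 + 2 - 1) := ⟨i + 1, by omega⟩
      have h0 : lo j = midEmb (m + 1) i.castSucc := rfl
      have h1 : hi j = midEmb (m + 1) i.succ := rfl
      have hasc : IsAscent w j := by
        rw [IsAscent, h0, h1]
        exact hw i (by omega)
      rw [groth_eq_demQ w j hasc, midPerm_swap, ← h0, ← h1, permEta_demQ]
  have : π ∈ N := hN ▸ Submonoid.mem_top π
  exact this

theorem antiSym_of_invariant {m : ℕ} (f : PolyG (m + 2))
    (hf : ∀ π : Equiv.Perm (Fin m), permEta (midPerm m π) f = f) :
    antiSym f = (Matrix.vandermonde (yv : Fin m → PolyG (m + 2))).det * f := by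
  simp only [antiSym, hf, ← Finset.sum_mul]
  rw [Matrix.det_apply']
  rfl

/-- As the inverse of w exchanges 1 and n, neither s_1 nor s_{n-1} can be an ascent. The climb to
the longest element uses inner reflections only; these keep the two conditions and leave the
antisymmetrization unchanged. -/
theorem antiSym_groth {m : ℕ} (w : Equiv.Perm (Fin (m + 2)))
    (h0 : w.symm 0 = Fin.last (m + 1)) (h1 : w.symm (Fin.last (m + 1)) = 0) :
    antiSym (groth w) = antiSym (∏ i, psi (n := m + 2) i) := by
  by_cases hne : (ascents w).Nonempty
  · obtain ⟨i, hi⟩ := hne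
    have hi' : IsAscent w i := (Finset.mem_filter.1 hi).2
    have hlt : w.symm (lo i) < w.symm (KPeterson.hi i) := hi'
    have hi0 : (i : ℕ) ≠ 0 := fun h => by
      have : lo i = 0 := Fin.ext h
      rw [this, h0] at hlt
      exact absurd hlt (not_lt.2 (Fin.le_last _))
    have him : (i : ℕ) + 1 ≠ m + 1 := fun h => by
      have : KPeterson.hi i = Fin.last (m + 1) := Fin.ext h
      rw [this, h1] at hlt
      exact absurd hlt (Fin.not_lt_zero _)
    have hin := i.2
    obtain ⟨k, hk⟩ : ∃ k, (i : ℕ) = k + 1 := ⟨i - 1, by omega⟩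
    have hlo : lo i = midEmb m ⟨k, by omega⟩ := Fin.ext hk
    have hhi : KPeterson.hi i = midEmb m ⟨k + 1, by omega⟩ :=
      Fin.ext (congrArg (· + 1) hk)
    have hs := stat_simpleMul_lt w i hi'
    rw [groth_eq_demQ w i hi', antiSym_demQ i k (by omega) hlo hhi]
    refine antiSym_groth _ ?_ ?_
    · rw [simpleMul_symm_apply, Equiv.swap_apply_of_ne_of_ne, h0]
      · rw [hlo]; exact (midEmb_ne_zero _).symm
      · rw [hhi]; exact (midEmb_ne_zero _).symm
    · rw [simpleMul_symm_apply, Equiv.swap_apply_of_ne_of_ne, h1]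
      · rw [hlo]; exact (midEmb_ne_last _).symm
      · rw [hhi]; exact (midEmb_ne_last _).symm
  · rw [groth, dif_neg hne]
termination_by stat w

/-- The polynomial `∑_j (-1)^j t^j F_j^{(i)}(z, Q)`. -/
def psiAt {n : ℕ} (i : ℕ) (t : PolyG n) : PolyG n :=
  ∑ j ∈ Finset.range (i + 1), (-1) ^ j * t ^ j *
    todaF (extZero fun k => MvPolynomial.X (GVar.z k))
      (extZero fun k => MvPolynomial.X (GVar.Q k)) i j

theorem psi_eq_psiAt {n : ℕ} (i : Fin (n - 1)) :
    psi i = psiAt (i + 1) (xv ⟨n - (i + 1) - 1, by omega⟩) := rfl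

theorem permEta_psiAt {n : ℕ} (π : Equiv.Perm (Fin n)) (i : ℕ) (t : PolyG n) :
    permEta π (psiAt i t) = psiAt i (permEta π t) := by
  have h : ∀ j, permEta π (todaF (extZero fun k => MvPolynomial.X (GVar.z k))
      (extZero fun k => MvPolynomial.X (GVar.Q k)) i j) =
      todaF (extZero fun k => MvPolynomial.X (GVar.z k))
        (extZero fun k => MvPolynomial.X (GVar.Q k)) i j := fun j => by
    refine (map_todaF (permEta π : PolyG n →+* PolyG n) _ _ _ _).trans ?_
    simp only [map_extZero, RingHom.coe_coe, permEta, MvPolynomial.rename_X]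
  simp only [psiAt, map_sum, map_mul, map_pow, map_neg, map_one, h]

theorem prod_fin_eq_succ {M : Type*} [CommMonoid M] {N m : ℕ} (h : N = m + 1) (f : Fin N → M) :
    ∏ i, f i = f ⟨m, by omega⟩ * ∏ l : Fin m, f ⟨m - 1 - l, by omega⟩ := by
  subst h
  rw [Fin.prod_univ_castSucc, mul_comm, ← Equiv.prod_comp Fin.revPerm]
  congr 1
  refine Finset.prod_congr rfl fun l _ => ?_
  congr 1
  refine Fin.ext ?_
  simp [Fin.val_rev]
  omega

theorem psi_eq {n : ℕ} (i d : ℕ) (h : i < n - 1) (k : Fin n) (hd : d = i + 1)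
    (hk : (k : ℕ) + d + 1 = n) : psi ⟨i, h⟩ = psiAt d (xv k) := by
  subst hd
  rw [psi_eq_psiAt]
  congr 2
  refine Fin.ext ?_
  simp only
  omega

theorem prod_psi (m : ℕ) : ∏ i, psi (n := m + 2) i =
    psiAt (m + 1) (xv 0) * ∏ l : Fin m, psiAt (m - l) (yv l : PolyG (m + 2)) := by
  refine (prod_fin_eq_succ (N := m + 2 - 1) rfl _).trans ?_
  refine congrArg₂ _ (psi_eq m (m + 1) _ 0 rfl (by simp)) ?_
  refine Finset.prod_congr rfl fun l _ => ?_
  exact psi_eq _ _ _ _ (by omega) (by rw [midEmb_val]; omega)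

theorem sTheta_symm_zero (m : ℕ) : (sTheta (m + 2)).symm 0 = Fin.last (m + 1) := by
  rw [sTheta, Equiv.symm_swap, Equiv.swap_apply_left, Fin.rev_zero]

theorem sTheta_symm_last (m : ℕ) : (sTheta (m + 2)).symm (Fin.last (m + 1)) = 0 := by
  rw [sTheta, Equiv.symm_swap, Fin.rev_zero, Equiv.swap_apply_right]

theorem sTheta_symm_midEmb {m : ℕ} (k : Fin m) :
    (sTheta (m + 2)).symm (midEmb m k) = midEmb m k := by
  rw [sTheta, Equiv.symm_swap, Fin.rev_zero,
    Equiv.swap_apply_of_ne_of_ne (midEmb_ne_zero k) (midEmb_ne_last k)]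

/-- A determinantal formula for the quantum double Grothendieck polynomial of `s_θ`. -/
theorem vandermonde_mul_groth_sTheta (m : ℕ) :
    (Matrix.vandermonde (yv : Fin m → PolyG (m + 2))).det * groth (sTheta (m + 2)) =
      psiAt (m + 1) (xv 0) *
        (Matrix.of fun k l : Fin m => (yv k : PolyG (m + 2)) ^ (l : ℕ) *
          psiAt (m - l) (yv k)).det := by
  -- The antisymmetrization of 𝔊_{s_θ} is computed twice: by symmetry in the inner variables, which
  -- gives the Vandermonde factor, and by climbing to the longest element. There ψ_{n-1} involves
  -- η_1 alone and comes out of the sum, while each other ψ involves one inner variable, so the rest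
  -- is a Leibniz expansion.
  rw [← antiSym_of_invariant, antiSym_groth _ (sTheta_symm_zero m) (sTheta_symm_last m), prod_psi,
    antiSym, Matrix.det_apply', Finset.mul_sum]
  · refine Finset.sum_congr rfl fun π _ => ?_
    simp only [map_mul, map_prod, permEta_psiAt, permEta_xv, midPerm_zero, permEta_yv,
      Matrix.of_apply, Finset.prod_mul_distrib]
    ring
  · refine permEta_midPerm_groth _ fun k h => ?_
    rw [sTheta_symm_midEmb, sTheta_symm_midEmb, Fin.lt_def, midEmb_val, midEmb_val]
    simp

/-! ### A functional that kills the G_i, and Vandermonde determinants. -/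

open Polynomial in
theorem monic_todaPoly {S : Type*} [CommRing S] [Nontrivial S] (z Q : ℕ → S) (i : ℕ) :
    ((todaPoly z Q i).1.Monic ∧ (todaPoly z Q i).1.natDegree = i) ∧
      ((todaPoly z Q i).2.Monic ∧ (todaPoly z Q i).2.natDegree = i) := by
  induction i with
  | zero => simp [todaPoly, monic_one]
  | succ i ih =>
    obtain ⟨⟨h1, h2⟩, h3, h4⟩ := ih
    have hX : (X * (todaPoly z Q i).2).Monic := monic_X.mul h3
    have hXd : (X * (todaPoly z Q i).2).natDegree = i + 1 := by
      rw [natDegree_X_mul h3.ne_zero, h4]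
    have hC : ∀ (c : S) (p : S[X]), p.Monic → p.natDegree = i + 1 →
        (p + C c * (todaPoly z Q i).1).Monic ∧
          (p + C c * (todaPoly z Q i).1).natDegree = i + 1 := by
      intro c p hp hpd
      have hlt : (C c * (todaPoly z Q i).1).natDegree < p.natDegree := by
        rw [hpd]
        exact lt_of_le_of_lt (natDegree_C_mul_le _ _) (by omega)
      exact ⟨hp.add_of_left (degree_lt_degree hlt),
        (natDegree_add_eq_left_of_natDegree_lt hlt).trans hpd⟩
    have hD := hC (-z i) _ hX hXd
    rw [C_neg, neg_mul, ← sub_eq_add_neg] at hD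
    exact ⟨hD, hC _ _ hD.1 hD.2⟩

open Polynomial in
/-- If the functional `φ` annihilates `G_1, …, G_m`, then it is determined on polynomials of
degree at most `m` by its value at `1`. -/
theorem functional_prod_mul_vandermonde {S : Type*} [CommRing S] {m : ℕ} (G : ℕ → S[X])
    (hG0 : G 0 = 1) (hmonic : ∀ i, (G i).Monic) (hdeg : ∀ i, (G i).natDegree = i)
    (φ : S[X] →ₗ[S] S) (hφ : ∀ i, 1 ≤ i → i ≤ m → φ (G i) = 0) (lam : Fin m → S) :
    φ (∏ k, (C (lam k) - X)) * (Matrix.vandermonde lam).det =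
      φ 1 * (Matrix.of fun k l : Fin m => (G (l + 1)).eval (lam k)).det := by
  nontriviality S
  -- The points are X, λ_1, …, λ_m over the ring S[X]. Monic G_j give the same determinant as
  -- powers, and the expansion along the row of X is a combination of the G_j with coefficients in
  -- S. Applying φ to it leaves only G_0 = 1.
  let v : Fin (m + 1) → S[X] := Fin.cons X fun k => C (lam k)
  have h1 := Matrix.det_eval_matrixOfPolynomials_eq_det_vandermonde v
    (fun j => (G j).map C) (fun j => by rw [natDegree_map_eq_of_injective C_injective, hdeg])
    (fun j => (hmonic j).map C)
  have h2 : (Matrix.vandermonde v).det =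
      (∏ k, (C (lam k) - X)) * C (Matrix.vandermonde lam).det := by
    rw [Matrix.det_vandermonde, Matrix.det_vandermonde, Fin.prod_univ_succ, Fin.prod_Ioi_zero]
    simp only [Fin.prod_Ioi_succ, map_prod, map_sub, v, Fin.cons_succ, Fin.cons_zero]
  rw [h2, Matrix.det_succ_row_zero] at h1
  have h3 := congrArg φ h1
  rw [mul_comm, ← smul_eq_C_mul, map_smul, map_sum, Fin.sum_univ_succ,
    Finset.sum_eq_zero (s := Finset.univ)] at h3
  · rw [smul_eq_mul, mul_comm] at h3
    rw [h3, add_zero]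
    have h4 : ((Matrix.of fun i j : Fin (m + 1) => ((G j).map C).eval (v i)).submatrix Fin.succ
        (Fin.succAbove 0)).det =
        C (Matrix.of fun k l : Fin m => (G (l + 1)).eval (lam k)).det := by
      rw [RingHom.map_det]
      congr 1
      ext1 k l
      simp [v, eval_map, eval₂_at_apply]
    rw [h4]
    simp only [Matrix.of_apply, v, Fin.cons_zero, Fin.val_zero, hG0, pow_zero,
      Polynomial.map_one, eval_one, one_mul]
    rw [← mul_one (C _), ← smul_eq_C_mul, map_smul, smul_eq_mul, mul_comm]
  · intro j _
    have h4 : ((Matrix.of fun i j : Fin (m + 1) => ((G j).map C).eval (v i)).submatrix Fin.succ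
        (Fin.succAbove j.succ)).det =
        C (Matrix.of fun k l : Fin m => (G (j.succ.succAbove l)).eval (lam k)).det := by
      rw [RingHom.map_det]
      congr 1
      ext1 k l
      simp [v, eval_map, eval₂_at_apply]
    rw [h4]
    have h5 : ((G j.succ).map C).eval (v 0) = G j.succ := by
      simp [v, eval_map, eval₂_eq_sum_range, ← as_sum_range_C_mul_X_pow]
    rw [Matrix.of_apply, h5]
    have h6 : (-1 : S[X]) ^ (j.succ : ℕ) = C ((-1) ^ (j.succ : ℕ)) := by simp
    rw [h6, mul_comm, ← smul_eq_C_mul, map_smul, ← smul_eq_C_mul, map_smul,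
      hφ _ (by simp) (by simp), smul_zero, smul_zero]

open Polynomial in
theorem vecMul_aeval_of_eigen {n : ℕ} {S : Type*} [CommRing S]
    {A : Matrix (Fin n) (Fin n) S} {v : Fin n → S} {c : S}
    (h : Matrix.vecMul v A = c • v) (f : S[X]) :
    Matrix.vecMul v (aeval A f) = f.eval c • v := by
  induction f using Polynomial.induction_on' with
  | add p q hp hq => rw [map_add, Matrix.vecMul_add, hp, hq, eval_add, add_smul]
  | monomial k a =>
    have hk : Matrix.vecMul v (A ^ k) = c ^ k • v := by
      induction k with
      | zero => simp
      | succ k ih =>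
        rw [pow_succ, ← Matrix.vecMul_vecMul, ih, Matrix.smul_vecMul, h, smul_smul, pow_succ]
    rw [← smul_X_eq_monomial, map_smul, aeval_X_pow, Matrix.vecMul_smul, hk, eval_smul, eval_pow,
      eval_X, smul_smul, smul_eq_mul]

/-! ### Matrix entries of polynomials in A. -/

section Chains

variable {n : ℕ} {S : Type*} [CommRing S] [Algebra (RT n) S]

/-- `e^{-a_i}` in an `R(T)`-algebra, extended by zero. -/
def uS (n : ℕ) (S : Type*) [CommRing S] [Algebra (RT n) S] : ℕ → S :=
  extZero fun i : Fin n => algebraMap (RT n) S (ee (-wt i))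

theorem uS_of_lt {k : ℕ} (h : k < n) : uS n S k = algebraMap (RT n) S (ee (-wt ⟨k, h⟩)) :=
  dif_pos h

theorem single_vecMul_matAin {k : ℕ} (h : k + 1 < n) :
    Matrix.vecMul (Pi.single (⟨k, by omega⟩ : Fin n) 1) (matAin n S) =
      uS n S k • Pi.single (⟨k, by omega⟩ : Fin n) 1 - Pi.single ⟨k + 1, h⟩ 1 := by
  ext j
  rw [vecMul_matAin, Pi.sub_apply, Pi.smul_apply, uS_of_lt (show k < n by omega), smul_eq_mul]
  congr 1
  · by_cases hj : j = ⟨k, by omega⟩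
    · rw [hj]
    · rw [Pi.single_eq_of_ne hj, mul_zero, mul_zero]
  · simp only [Pi.single_apply, Fin.ext_iff]
    split_ifs <;> first | rfl | omega

theorem single_last_vecMul_matAin {k : ℕ} (h : k + 1 = n) :
    Matrix.vecMul (Pi.single (⟨k, by omega⟩ : Fin n) 1) (matAin n S) =
      uS n S k • Pi.single (⟨k, by omega⟩ : Fin n) 1 := by
  ext j
  rw [vecMul_matAin, Pi.smul_apply, uS_of_lt (show k < n by omega), smul_eq_mul]
  have : (if h : 0 < (j : ℕ) then
      (Pi.single (⟨k, by omega⟩ : Fin n) 1 : Fin n → S) ⟨j - 1, by omega⟩ else 0) = 0 := by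
    split_ifs with hj
    · exact Pi.single_eq_of_ne (by rw [Ne, Fin.ext_iff]; simp; omega) _
    · rfl
  rw [this, sub_zero]
  by_cases hj : j = ⟨k, by omega⟩
  · rw [hj]
  · rw [Pi.single_eq_of_ne hj, mul_zero, mul_zero]

theorem matAin_mulVec_single {k : ℕ} (h : k + 1 < n) :
    Matrix.mulVec (matAin n S) (Pi.single ⟨k + 1, h⟩ 1) =
      uS n S (k + 1) • Pi.single ⟨k + 1, h⟩ 1 - Pi.single (⟨k, by omega⟩ : Fin n) 1 := by
  ext i
  rw [Matrix.mulVec_single_one, Matrix.col_apply, matAin, Matrix.map_apply, matA, Pi.sub_apply,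
    Pi.smul_apply, uS_of_lt h, smul_eq_mul]
  have hk : k < n := by omega
  by_cases h1 : i = ⟨k + 1, h⟩
  · subst h1
    have : (⟨k + 1, h⟩ : Fin n) ≠ ⟨k, hk⟩ := by rw [Ne, Fin.ext_iff]; simp
    rw [if_pos rfl, Pi.single_eq_same, Pi.single_eq_of_ne this, mul_one, sub_zero]
  · rw [if_neg h1, Pi.single_eq_of_ne h1, mul_zero, zero_sub]
    by_cases h2 : i = ⟨k, hk⟩
    · subst h2
      rw [if_pos rfl, Pi.single_eq_same, map_neg, map_one]
    · rw [if_neg fun h' => h2 (Fin.ext (by simpa using h')), Pi.single_eq_of_ne h2, map_zero,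
        neg_zero]

-- A - u_k takes the basis row at position k to minus the next one, so the product walks along the
-- basis.
open Polynomial in
theorem single_vecMul_prod [NeZero n] (k : ℕ) (h : k < n) :
    Matrix.vecMul (Pi.single 0 1) (aeval (matAin n S) (∏ i ∈ Finset.range k, (X - C (uS n S i)))) =
      (-1 : S) ^ k • Pi.single (⟨k, h⟩ : Fin n) 1 := by
  induction k with
  | zero =>
    have e : (⟨0, h⟩ : Fin n) = 0 := rfl
    simp [e]
  | succ k ih =>
    rw [Finset.prod_range_succ, map_mul, ← Matrix.vecMul_vecMul, ih (by omega), map_sub, aeval_X,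
      aeval_C, Matrix.smul_vecMul, Matrix.vecMul_sub, single_vecMul_matAin h,
      Algebra.algebraMap_eq_smul_one, Matrix.vecMul_smul, Matrix.vecMul_one, sub_sub_cancel_left,
      pow_succ, mul_neg_one, neg_smul, smul_neg]

-- The mirror image on columns: the walk starts at the last basis vector and moves down.
open Polynomial in
theorem prod_mulVec_single (k l : ℕ) (h : k + l + 1 = n) :
    Matrix.mulVec (aeval (matAin n S) (∏ i ∈ Finset.range k, (X - C (uS n S (n - 1 - i)))))
      (Pi.single (⟨n - 1, by omega⟩ : Fin n) 1) =
      (-1 : S) ^ k • Pi.single (⟨l, by omega⟩ : Fin n) 1 := by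
  induction k generalizing l with
  | zero =>
    have e : (⟨n - 1, by omega⟩ : Fin n) = ⟨l, by omega⟩ := Fin.ext (by simp; omega)
    rw [Finset.range_zero, Finset.prod_empty, map_one, Matrix.one_mulVec, pow_zero, one_smul, e]
  | succ k ih =>
    have e : n - 1 - k = l + 1 := by omega
    rw [Finset.prod_range_succ, mul_comm, map_mul, ← Matrix.mulVec_mulVec, ih (l + 1) (by omega),
      map_sub, aeval_X, aeval_C, Matrix.mulVec_smul, Matrix.sub_mulVec,
      matAin_mulVec_single (by omega), Algebra.algebraMap_eq_smul_one, Matrix.smul_mulVec,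
      Matrix.one_mulVec, e, sub_sub_cancel_left, pow_succ, mul_neg_one, neg_smul, smul_neg]

end Chains

open Polynomial in
/-- The values at `∏_{1 < k < n} (X - e^{-a_k})` of the functional `f ↦ (f(A) Z)_{1n}`. -/
theorem functional_prod_mid {m : ℕ} {S : Type*} [CommRing S] [Algebra (RT (m + 2)) S]
    (Z : Matrix (Fin (m + 2)) (Fin (m + 2)) S)
    (hZ : matAin (m + 2) S * Z = Z * matAin (m + 2) S) :
    (uS (m + 2) S (m + 1) - uS (m + 2) S 0) *
      (aeval (matAin (m + 2) S) (∏ i ∈ Finset.range m, (X - C (uS (m + 2) S (i + 1)))) * Z)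
        0 (Fin.last (m + 1)) =
      (-1) ^ (m + 1) * (Z (Fin.last (m + 1)) (Fin.last (m + 1)) - Z 0 0) := by
  set q : S[X] := ∏ i ∈ Finset.range m, (X - C (uS (m + 2) S (i + 1))) with hq
  set A := matAin (m + 2) S with hA
  -- Let q be the product over the inner eigenvalues. On the left (X - u_1) q moves e_1 to ± e_n, on
  -- the right (X - u_n) q moves e_n to ± e_1, so both corner entries are diagonal entries of Z. The
  -- two polynomials differ by (u_n - u_1) q.
  have h1 : (aeval A ((X - C (uS (m + 2) S 0)) * q) * Z) 0 (Fin.last (m + 1)) =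
      (-1) ^ (m + 1) * Z (Fin.last (m + 1)) (Fin.last (m + 1)) := by
    have e : (X - C (uS (m + 2) S 0)) * q =
        ∏ i ∈ Finset.range (m + 1), (X - C (uS (m + 2) S i)) := by
      rw [Finset.prod_range_succ', mul_comm]
    have h := congrArg (fun v => Matrix.vecMul v Z (Fin.last (m + 1)))
      (single_vecMul_prod (n := m + 2) (S := S) (m + 1) (by omega))
    simp only [Matrix.smul_vecMul, Matrix.single_one_vecMul] at h
    rw [e]
    exact h
  have h2 : (aeval A ((X - C (uS (m + 2) S (m + 1))) * q) * Z) 0 (Fin.last (m + 1)) =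
      (-1) ^ (m + 1) * Z 0 0 := by
    have e : (X - C (uS (m + 2) S (m + 1))) * q =
        ∏ i ∈ Finset.range (m + 1), (X - C (uS (m + 2) S (m + 2 - 1 - i))) := by
      rw [← Finset.prod_range_reflect, Finset.prod_range_succ, mul_comm, hq]
      congr 1
      · refine Finset.prod_congr rfl fun i hi => ?_
        have := Finset.mem_range.1 hi
        rw [show m + 2 - 1 - (m + 1 - 1 - i) = i + 1 by omega]
      · simp
    have h := congrArg (fun v => Matrix.mulVec Z v 0)
      (prod_mulVec_single (n := m + 2) (S := S) (m + 1) 0 (by omega))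
    simp only [Matrix.mulVec_smul, Matrix.mulVec_single_one] at h
    rw [aeval_mul_of_mul_eq hZ, e]
    exact h
  have h3 : aeval A ((X - C (uS (m + 2) S 0)) * q) * Z -
      aeval A ((X - C (uS (m + 2) S (m + 1))) * q) * Z =
      (uS (m + 2) S (m + 1) - uS (m + 2) S 0) • (aeval A q * Z) := by
    rw [← sub_mul, ← map_sub, ← sub_mul, sub_sub_sub_cancel_left, ← C_sub, ← smul_eq_C_mul,
      map_smul, smul_mul_assoc]
  have h4 := congrFun (congrFun h3 0) (Fin.last (m + 1))
  rw [Matrix.sub_apply, Matrix.smul_apply, h1, h2, smul_eq_mul] at h4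
  rw [← h4]
  ring

open Polynomial in
/-- The value of `G_{n-1}` at `e^{-a_n}`. -/
theorem eval_toda_last {m : ℕ} {S : Type*} [CommRing S] [Algebra (RT (m + 2)) S]
    (Z : Matrix (Fin (m + 2)) (Fin (m + 2)) S)
    (hZ : matAin (m + 2) S * Z = Z * matAin (m + 2) S)
    (hup : ∀ i j, j < i → Z i j = 0) (G : S[X]) (r : Fin (m + 2) → S) (t t' : S)
    (hG : Matrix.vecMul (Pi.single 0 1) (aeval (matAin (m + 2) S) G) = (-1 : S) ^ (m + 1) • r)
    (hr : ∀ j < Fin.last (m + 1),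
      Matrix.vecMul r (Z * matAin (m + 2) S * matPin (m + 2) S) j = 0)
    (hr' : t * Matrix.vecMul r (Z * matAin (m + 2) S * matPin (m + 2) S) (Fin.last (m + 1)) = t') :
    t * (G.eval (uS (m + 2) S (m + 1)) * Z (Fin.last (m + 1)) (Fin.last (m + 1)) *
      uS (m + 2) S (m + 1)) = t' * uS (m + 2) S (m + 1) ^ (m + 1) := by
  set A := matAin (m + 2) S with hA
  set P := matPin (m + 2) S with hP
  set u := uS (m + 2) S (m + 1) with hu
  set L := Fin.last (m + 1) with hL
  set f : S[X] := ∏ i ∈ Finset.range (m + 1), (X - C (uS (m + 2) S i)) with hf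
  have hf0 : Matrix.vecMul (Pi.single 0 1) (aeval A f) = (-1 : S) ^ (m + 1) • Pi.single L 1 :=
    single_vecMul_prod (n := m + 2) (S := S) (m + 1) (by omega)
  have hAL : Matrix.vecMul (Pi.single L 1) A = u • Pi.single L 1 :=
    single_last_vecMul_matAin (n := m + 2) (S := S) rfl
  have hZL : Matrix.vecMul (Pi.single L 1) Z = Z L L • Pi.single L 1 := by
    rw [Matrix.single_one_vecMul]
    ext j
    rw [Matrix.row_apply, Pi.smul_apply, smul_eq_mul]
    rcases eq_or_ne j L with rfl | hj
    · rw [Pi.single_eq_same, mul_one]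
    · rw [Pi.single_eq_of_ne hj, mul_zero, hup _ _ (lt_of_le_of_ne (Fin.le_last _) hj)]
  -- the last column of `f(A)` is an eigenvector
  set v : Fin (m + 2) → S := Matrix.mulVec (aeval A f) (Pi.single L 1) with hv
  have hAv : Matrix.mulVec A v = u • v := by
    have hA' : A.IsUpperTriangular := fun i j (h : j < i) => by
      have h1 : i ≠ j := h.ne'
      have h2 : ¬ ((i : ℕ) + 1 = j) := by have : (j : ℕ) < i := h; omega
      simp [hA, matAin, matA, h1, h2]
    have hchar : A.charpoly = f * (X - C u) := by
      rw [Matrix.charpoly_of_isUpperTriangular _ hA', hf, hu,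
        ← Finset.prod_range_succ (fun i => X - C (uS (m + 2) S i)), Finset.prod_range]
      refine Finset.prod_congr rfl fun i _ => ?_
      rw [uS_of_lt i.2, hA, matAin, Matrix.map_apply, matA, if_pos rfl]
    have h0 := A.aeval_self_charpoly
    rw [hchar, mul_comm, map_mul, map_sub, aeval_X, aeval_C] at h0
    have h1 := congrArg (fun M => Matrix.mulVec M (Pi.single L 1)) h0
    simp only [← Matrix.mulVec_mulVec, Matrix.zero_mulVec] at h1
    rw [← hv, Matrix.sub_mulVec, Algebra.algebraMap_eq_smul_one, Matrix.smul_mulVec,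
      Matrix.one_mulVec, sub_eq_zero] at h1
    exact h1
  have hv0 : v 0 = (-1) ^ (m + 1) := by
    have h := congrFun hf0 L
    rw [Matrix.single_one_vecMul, Pi.smul_apply, Pi.single_eq_same, smul_eq_mul, mul_one] at h
    rw [hv, Matrix.mulVec_single_one]
    exact h
  -- the same eigenvector in the basis in which `A` becomes a companion matrix
  have hPdet : IsUnit P.det := by
    have : P.det = 1 := by
      rw [hP, matPin, ← RingHom.mapMatrix_apply, ← RingHom.map_det, det_matP, map_one]
    rw [this]; exact isUnit_one
  set w : Fin (m + 2) → S := Matrix.mulVec P⁻¹ v with hw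
  have hPw : Matrix.mulVec P w = v := by
    rw [hw, Matrix.mulVec_mulVec, Matrix.mul_nonsing_inv _ hPdet, Matrix.one_mulVec]
  have hCw : Matrix.mulVec (matCin (m + 2) S) w = u • w := by
    have h1 : Matrix.mulVec P (Matrix.mulVec (matCin (m + 2) S) w) = Matrix.mulVec P (u • w) := by
      rw [Matrix.mulVec_mulVec, hP, ← matAin_mul_matPin, ← Matrix.mulVec_mulVec, ← hP, hPw,
        Matrix.mulVec_smul, hPw, ← hA, hAv]
    have h2 := congrArg (Matrix.mulVec P⁻¹) h1
    simpa only [Matrix.mulVec_mulVec, ← Matrix.mul_assoc, Matrix.nonsing_inv_mul _ hPdet,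
      Matrix.one_mul, Matrix.one_mulVec] using h2
  have hw0 : w 0 = (-1) ^ (m + 1) := by
    have h1 := congrArg (fun x => dotProduct x w) (single_vecMul_matPin (m + 2) S)
    simp only [← Matrix.dotProduct_mulVec, ← hP, hPw, single_one_dotProduct] at h1
    rw [← h1, hv0]
  -- All rows of C but the last only shift, so the coordinates of an eigenvector form a geometric
  -- progression.
  have hwk : ∀ (k : ℕ) (h : k < m + 2), w ⟨k, h⟩ = (-u) ^ k * (-1) ^ (m + 1) := by
    intro k
    induction k with
    | zero => intro h; rw [pow_zero, one_mul, ← hw0]; rfl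
    | succ k ih =>
      intro h
      have h1 := congrFun hCw ⟨k, by omega⟩
      have h2 : Matrix.mulVec (matCin (m + 2) S) w ⟨k, by omega⟩ = -w ⟨k + 1, h⟩ := by
        rw [Matrix.mulVec, dotProduct, Finset.sum_eq_single ⟨k + 1, h⟩]
        · rw [matCin, Matrix.map_apply, matC, if_pos rfl, if_neg (by simp; omega)]
          simp
        · intro j _ hj
          have : ¬ (k + 1 = (j : ℕ)) := fun h' => hj (Fin.ext h'.symm)
          rw [matCin, Matrix.map_apply, matC, if_neg this, if_neg (by simp; omega)]
          simp
        · simp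
      rw [h2, Pi.smul_apply, ih (by omega), smul_eq_mul] at h1
      rw [pow_succ]
      linear_combination -h1
  -- two evaluations of the same matrix entry
  have hX1 : dotProduct (Matrix.vecMul (Matrix.vecMul (Pi.single 0 1) (aeval A G)) (Z * A)) v =
      (-1) ^ (m + 1) * (Matrix.vecMul r (Z * A * P) L * u ^ (m + 1)) := by
    -- First evaluation: r ZAP is concentrated in the last column, where w has the entry u^{n-1}.
    rw [hG, Matrix.smul_vecMul, smul_dotProduct, smul_eq_mul, ← hPw, Matrix.dotProduct_mulVec,
      Matrix.vecMul_vecMul, dotProduct, Finset.sum_eq_single L]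
    · have h1 := hwk (m + 1) (by omega)
      have h2 : ((-1 : S) ^ (m + 1)) * (-1) ^ (m + 1) = 1 := by rw [← mul_pow]; simp
      have h3 : w L = u ^ (m + 1) := by
        rw [hL]
        refine h1.trans ?_
        rw [neg_pow, mul_right_comm, h2, one_mul]
      rw [h3]
    · intro j _ hj
      rw [hr j (lt_of_le_of_ne (Fin.le_last _) hj), zero_mul]
    · simp
  have hX2 : dotProduct (Matrix.vecMul (Matrix.vecMul (Pi.single 0 1) (aeval A G)) (Z * A)) v =
      (-1) ^ (m + 1) * (G.eval u * Z L L * u) := by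
    -- Second evaluation: f(A) is brought to the front, and e_1 f(A) = ± e_n is a left eigenvector
    -- of G(A), of the upper triangular Z, and of A.
    have hcomm : aeval A G * (Z * A * aeval A f) = aeval A f * aeval A G * Z * A := by
      have h1 : A * (Z * A) = Z * A * A := by rw [← mul_assoc, hZ]
      rw [← aeval_mul_of_mul_eq h1 f, ← mul_assoc, ← map_mul, mul_comm G f, map_mul,
        ← mul_assoc]
    rw [hv, Matrix.dotProduct_mulVec, Matrix.vecMul_vecMul, Matrix.vecMul_vecMul, hcomm,
      ← Matrix.vecMul_vecMul, ← Matrix.vecMul_vecMul, ← Matrix.vecMul_vecMul, hf0,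
      Matrix.smul_vecMul, Matrix.smul_vecMul, Matrix.smul_vecMul, vecMul_aeval_of_eigen hAL,
      Matrix.smul_vecMul, Matrix.smul_vecMul, hZL, Matrix.smul_vecMul, hAL]
    simp [mul_assoc]
  have h2 : ((-1 : S) ^ (m + 1)) * (-1) ^ (m + 1) = 1 := by rw [← mul_pow]; simp
  have h3 := hX2.symm.trans hX1
  have h4 : G.eval u * Z L L * u = Matrix.vecMul r (Z * A * P) L * u ^ (m + 1) := by
    linear_combination (-1) ^ (m + 1) * h3 - (G.eval u * Z L L * u -
      Matrix.vecMul r (Z * A * P) L * u ^ (m + 1)) * h2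
  rw [h4, ← hr']
  ring

/-! ### Specialization of η and the determinant of the values G_l(u_k). -/

theorem det_reverse {m : ℕ} {S : Type*} [CommRing S] (M : Matrix (Fin m) (Fin m) S) :
    (Matrix.of fun k l => M k l.rev).det = Equiv.Perm.sign (Fin.revPerm (n := m)) * M.det :=
  Matrix.det_permute' Fin.revPerm M

section Specialize

variable {m : ℕ}

/-- The composite of the specialization of `η`, the quotient map and `Φ_n`. -/
def evG (n : ℕ) : PolyG n →+* OZo n :=
  (MvPolynomial.aeval (R := RT n) (phiVar n) : PolyY n →+* OZo n).comp
    (specialize n : PolyG n →+* PolyY n)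

theorem evG_apply {n : ℕ} (f : PolyG n) :
    evG n f = MvPolynomial.aeval (R := RT n) (phiVar n) (specialize n f) := rfl

theorem evG_z {n : ℕ} (i : Fin n) : evG n (MvPolynomial.X (GVar.z i)) = phiZ n i := by
  simp [evG_apply, specialize, phiVar]

theorem evG_Q {n : ℕ} (i : Fin (n - 1)) : evG n (MvPolynomial.X (GVar.Q i)) = phiQ n i := by
  simp [evG_apply, specialize, phiVar]

theorem evG_xv {n : ℕ} (i : Fin n) :
    evG n (xv i) = algebraMap (RT n) (OZo n) (ee (wt i.rev)) := by
  simp [evG_apply, specialize, xv]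

theorem evG_xv_mul {n : ℕ} (i : Fin n) : evG n (xv i) * uS n (OZo n) (i.rev : ℕ) = 1 := by
  rw [evG_xv, uS_of_lt i.rev.2, ← map_mul, ee_mul_neg, map_one]

/-- The sum ψ is the reversed polynomial of G_i, so its value at t = u^{-1} is that of G_i at u up
to the power u^i. -/
theorem evG_psiAt {n : ℕ} (i : ℕ) (t : PolyG n) (u : OZo n) (h : evG n t * u = 1) :
    u ^ i * evG n (psiAt i t) =
      (todaPoly (extZero (phiZ n)) (extZero (phiQ n)) i).2.eval u := by
  rw [(todaPoly_eq _ _ i).2, Polynomial.eval_finsetSum, psiAt, map_sum, Finset.mul_sum]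
  refine Finset.sum_congr rfl fun j hj => ?_
  have hji : j ≤ i := by have := Finset.mem_range.1 hj; omega
  have hF : evG n (todaF (extZero fun k => MvPolynomial.X (GVar.z k))
      (extZero fun k => MvPolynomial.X (GVar.Q k)) i j) =
      todaF (extZero (phiZ n)) (extZero (phiQ n)) i j := by
    rw [map_todaF]
    simp only [map_extZero, evG_z, evG_Q]
  have hu : u ^ i * evG n t ^ j = u ^ (i - j) := by
    rw [← Nat.sub_add_cancel hji, pow_add, mul_assoc, ← mul_pow, mul_comm u, h, one_pow, mul_one,
      Nat.sub_add_cancel hji]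
  rw [map_mul, map_mul, map_pow, map_pow, map_neg, map_one, hF, Polynomial.eval_mul,
    Polynomial.eval_C, Polynomial.eval_pow, Polynomial.eval_X, ← hu]
  ring

/-- The points `e^{-a_k}`, `1 < k < n`, in reverse order. -/
def midPt (m : ℕ) (k : Fin m) : OZo (m + 2) := uS (m + 2) (OZo (m + 2)) (m - k)

theorem evG_yv_mul (k : Fin m) : evG (m + 2) (yv k) * midPt m k = 1 := by
  have h := evG_xv_mul (midEmb m k)
  have : ((midEmb m k).rev : ℕ) = m - k := by
    rw [Fin.val_rev, midEmb_val]; omega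
  rwa [this] at h

/-- The polynomials `∑_m (-1)^m F_m^{(i)} X^{i-m}` at the image of `Φ_n`. -/
def phiPoly (n i : ℕ) : Polynomial (OZo n) := (todaPoly (extZero (phiZ n)) (extZero (phiQ n)) i).2

/-- The determinantal formula in the inverse variables. Rows are scaled by u^{m-1} in the
Vandermonde matrix and by u^m in the other one, and the columns are reversed in both. The signs
agree and cancel; the surplus power of u is the product on the left. -/
theorem prod_mul_vandermonde_mul_groth (m : ℕ) :
    (∏ k, midPt m k) * (Matrix.vandermonde (midPt m)).det *
        evG (m + 2) (groth (sTheta (m + 2))) =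
      evG (m + 2) (psiAt (m + 1) (xv 0)) *
        (Matrix.of fun k l : Fin m => (phiPoly (m + 2) (l + 1)).eval (midPt m k)).det := by
  have h := congrArg (evG (m + 2)) (vandermonde_mul_groth_sTheta m)
  rw [map_mul, map_mul, RingHom.map_det, RingHom.map_det] at h
  have hV : (∏ k, midPt m k ^ (m - 1)) * ((evG (m + 2)).mapMatrix
      (Matrix.vandermonde (yv : Fin m → PolyG (m + 2)))).det =
      (Equiv.Perm.sign (Fin.revPerm (n := m)) : ℤ) * (Matrix.vandermonde (midPt m)).det := by
    rw [← Matrix.det_mul_column, ← det_reverse]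
    congr 1
    ext k l
    simp only [Matrix.of_apply, RingHom.mapMatrix_apply, Matrix.map_apply,
      Matrix.vandermonde_apply, map_pow]
    have hl := l.2
    rw [show m - 1 = (l.rev : ℕ) + l by rw [Fin.val_rev]; omega, pow_add, mul_assoc, ← mul_pow,
      mul_comm (midPt m k) (evG _ _), evG_yv_mul, one_pow, mul_one]
  have hG : (∏ k, midPt m k ^ m) * ((evG (m + 2)).mapMatrix
      (Matrix.of fun k l : Fin m => (yv k : PolyG (m + 2)) ^ (l : ℕ) *
          psiAt (m - l) (yv k))).det =
      (Equiv.Perm.sign (Fin.revPerm (n := m)) : ℤ) *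
        (Matrix.of fun k l : Fin m => (phiPoly (m + 2) (l + 1)).eval (midPt m k)).det := by
    rw [← Matrix.det_mul_column, ← det_reverse]
    congr 1
    ext k l
    simp only [Matrix.of_apply, RingHom.mapMatrix_apply, Matrix.map_apply, map_mul, map_pow]
    have hl := l.2
    rw [show (l.rev : ℕ) + 1 = m - l by rw [Fin.val_rev]; omega, phiPoly,
      ← evG_psiAt (m - l) (yv k) (midPt m k) (evG_yv_mul k)]
    conv_lhs => rw [show midPt m k ^ m = midPt m k ^ (m - l) * midPt m k ^ (l : ℕ) by
      rw [← pow_add]; congr 1; omega]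
    have : midPt m k ^ (l : ℕ) * evG (m + 2) (yv k) ^ (l : ℕ) = 1 := by
      rw [← mul_pow, mul_comm, evG_yv_mul, one_pow]
    linear_combination (midPt m k ^ (m - l) * evG (m + 2) (psiAt (m - l) (yv k))) * this
  have hp : ∏ k, midPt m k ^ m = (∏ k, midPt m k) * ∏ k, midPt m k ^ (m - 1) := by
    rw [← Finset.prod_mul_distrib]
    refine Finset.prod_congr rfl fun k _ => ?_
    rw [← pow_succ']
    congr 1
    -- An index k exists only if m ≥ 1, which makes the truncated exponent m - 1 harmless.
    have := k.2
    omega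
  have hs : ((Equiv.Perm.sign (Fin.revPerm (n := m)) : ℤ) : OZo (m + 2)) *
      (Equiv.Perm.sign (Fin.revPerm (n := m)) : ℤ) = 1 := by
    rw [← Int.cast_mul, ← Units.val_mul, Int.units_mul_self]
    simp
  set s : OZo (m + 2) := ((Equiv.Perm.sign (Fin.revPerm (n := m)) : ℤ) : OZo (m + 2))
  have h1 : s * ((∏ k, midPt m k) * (Matrix.vandermonde (midPt m)).det *
        evG (m + 2) (groth (sTheta (m + 2)))) = s * (evG (m + 2) (psiAt (m + 1) (xv 0)) *
        (Matrix.of fun k l : Fin m => (phiPoly (m + 2) (l + 1)).eval (midPt m k)).det) := by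
    rw [hp] at hG
    linear_combination (∏ k, midPt m k) * (∏ k, midPt m k ^ (m - 1)) * h -
      (∏ k, midPt m k) * evG (m + 2) (groth (sTheta (m + 2))) * hV +
      evG (m + 2) (psiAt (m + 1) (xv 0)) * hG
  have h2 := congrArg (s * ·) h1
  simpa only [← mul_assoc, hs, one_mul] using h2

end Specialize

/-! ### The image of the class of s_θ under Φ_n. -/

/-- Each Q is a quotient of two successive ratios τ_{i+1} / τ_i, so the product telescopes; τ_0 = 1.
-/
theorem prod_phiQ (n k : ℕ) (h : k < n) :
    (∏ i ∈ Finset.range k, extZero (phiQ n) i) * (tauO n 1 * tauO n k) = tauO n (k + 1) := by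
  have h0 : tauO n 0 = 1 := by rw [tauO, tau, minor_zero, map_one]
  induction k with
  | zero => rw [Finset.range_zero, Finset.prod_empty, h0, one_mul, mul_one]
  | succ k ih =>
    have h1 := ih (by omega)
    have h2 := phiQ_spec h
    rw [Finset.prod_range_succ]
    refine (isUnit_tauO (show k + 1 ≤ n by omega)).mul_left_cancel ?_
    linear_combination (∏ i ∈ Finset.range k, extZero (phiQ n) i) * tauO n 1 * h2 +
      tauO n (k + 2) * h1

/-- AP = PC, column 0 of C is the last basis vector because e_n = 1, and the lower unitriangular P
fixes that vector. So column 0 of ZAP is the last column of Z, which explains the choice of the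
corner entry as functional. -/
theorem vecMul_matAin_mul_matPin_zero {m : ℕ} {S : Type*} [CommRing S] [Algebra (RT (m + 2)) S]
    (v : Fin (m + 2) → S) :
    Matrix.vecMul v (matAin (m + 2) S * matPin (m + 2) S) 0 = v (Fin.last (m + 1)) := by
  rw [matAin_mul_matPin, ← Matrix.vecMul_vecMul, matCin,
    mul_matC _ (Fin.last (m + 1)) (by simp) 0, dif_neg (by simp), sub_zero, Fin.val_zero, Nat.sub_zero,
    elemU_full, map_one, mul_one, Matrix.vecMul, dotProduct,
    Finset.sum_eq_single (Fin.last (m + 1))]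
  · rw [matPin, Matrix.map_apply, matP_apply, if_pos le_rfl, Nat.sub_self, elemU_zero, map_one,
      mul_one]
  · intro k _ hk
    rw [matPin, Matrix.map_apply, matP_apply, if_neg fun h => hk (le_antisymm (Fin.le_last k) h),
      map_zero, mul_zero]
  · simp

theorem tau_one_eq (m : ℕ) : tauO (m + 2) 1 = matZo (m + 2) 0 (Fin.last (m + 1)) := by
  rw [← minor_matZo_tau, minor_one, Matrix.mul_assoc]
  exact vecMul_matAin_mul_matPin_zero (matZo (m + 2) 0)

open Polynomial in
/-- The functional `f ↦ (f(A) Z)_{1n}`. -/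
def cornerFun (m : ℕ) : (OZo (m + 2))[X] →ₗ[OZo (m + 2)] OZo (m + 2) :=
  Matrix.entryLinearMap _ _ 0 (Fin.last (m + 1)) ∘ₗ
    LinearMap.mulRight (OZo (m + 2)) (matZo (m + 2)) ∘ₗ
      (aeval (matAin (m + 2) (OZo (m + 2)))).toLinearMap

open Polynomial in
theorem cornerFun_apply (m : ℕ) (f : (OZo (m + 2))[X]) :
    cornerFun m f =
      (aeval (matAin (m + 2) (OZo (m + 2))) f * matZo (m + 2)) 0 (Fin.last (m + 1)) := rfl

theorem cornerFun_one (m : ℕ) : cornerFun m 1 = tauO (m + 2) 1 := by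
  rw [cornerFun_apply, map_one, Matrix.one_mul, tau_one_eq]

/-- The value is, up to sign, the entry of r'_i ZAP in column 0, where the row vanishes as soon as i
≥ 1. -/
theorem cornerFun_phiPoly (m i : ℕ) (h1 : 1 ≤ i) (h : i ≤ m) :
    cornerFun m (phiPoly (m + 2) i) = 0 := by
  obtain ⟨r', hr, -, h0, -⟩ := exists_rows_phi (m + 2)
  have e := congrArg (fun v => Matrix.vecMul v (matZo (m + 2)) (Fin.last (m + 1)))
    (hr i (by omega))
  simp only [Matrix.single_one_vecMul, Matrix.smul_vecMul] at e
  refine e.trans ?_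
  rw [Pi.smul_apply, ← vecMul_matAin_mul_matPin_zero (Matrix.vecMul _ _), Matrix.vecMul_vecMul, ← Matrix.mul_assoc,
    h0 ⟨i, by omega⟩ 0 (by rw [Fin.lt_def, Fin.val_zero]; exact h1), smul_zero]

open Polynomial in
theorem cornerFun_prod_mul_vandermonde (m : ℕ) :
    cornerFun m (∏ k, (C (midPt m k) - X)) * (Matrix.vandermonde (midPt m)).det =
      tauO (m + 2) 1 *
        (Matrix.of fun k l : Fin m => (phiPoly (m + 2) (l + 1)).eval (midPt m k)).det := by
  nontriviality OZo (m + 2)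
  rw [← cornerFun_one]
  exact functional_prod_mul_vandermonde (phiPoly (m + 2)) rfl
    (fun i => (monic_todaPoly _ _ i).2.1) (fun i => (monic_todaPoly _ _ i).2.2) _
    (cornerFun_phiPoly m) _

open Polynomial in
theorem sub_mul_cornerFun_prod (m : ℕ) :
    (uS (m + 2) (OZo (m + 2)) (m + 1) - uS (m + 2) (OZo (m + 2)) 0) *
      cornerFun m (∏ k, (C (midPt m k) - X)) =
      matZo (m + 2) 0 0 - matZo (m + 2) (Fin.last (m + 1)) (Fin.last (m + 1)) := by
  have h := functional_prod_mid (matZo (m + 2)) (matZo_comm (m + 2))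
  rw [← cornerFun_apply] at h
  have e : ∏ k, (C (midPt m k) - X) = (-1 : OZo (m + 2)) ^ m •
      ∏ i ∈ Finset.range m, (X - C (uS (m + 2) (OZo (m + 2)) (i + 1))) := by
    rw [← Finset.prod_range_reflect, Finset.prod_range, smul_eq_C_mul, map_pow, map_neg, map_one]
    have : (-1 : (OZo (m + 2))[X]) ^ m = ∏ _k : Fin m, (-1) := by simp
    rw [this, ← Finset.prod_mul_distrib]
    refine Finset.prod_congr rfl fun k _ => ?_
    rw [midPt, show m - 1 - (k : ℕ) + 1 = m - k by omega]
    ring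
  have h2 : ((-1 : OZo (m + 2)) ^ m) * (-1) ^ m = 1 := by rw [← mul_pow]; simp
  rw [e, map_smul, smul_eq_mul, mul_left_comm, h, pow_succ]
  linear_combination (matZo (m + 2) 0 0 -
    matZo (m + 2) (Fin.last (m + 1)) (Fin.last (m + 1))) * h2

theorem matZo_upper (n : ℕ) (i j : Fin n) (h : j < i) : matZo n i j = 0 := by
  rw [matZo, Matrix.map_apply, matZ_upper n h, map_zero]

/-- The variable η_1 specializes to 1 - e^{a_n}, so `eval_toda_last` evaluates ψ_{n-1}; the unit
u_n^{n-1} cancels. -/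
theorem tauO_mul_evG_psiAt (m : ℕ) :
    tauO (m + 2) (m + 1) * evG (m + 2) (psiAt (m + 1) (xv 0)) *
      matZo (m + 2) (Fin.last (m + 1)) (Fin.last (m + 1)) * uS (m + 2) (OZo (m + 2)) (m + 1) =
      tauO (m + 2) (m + 2) := by
  obtain ⟨r', hr, -, h0, h1⟩ := exists_rows_phi (m + 2)
  have hlast := h1 (Fin.last (m + 1))
  rw [Fin.val_last] at hlast
  have h := eval_toda_last (matZo (m + 2)) (matZo_comm (m + 2)) (matZo_upper (m + 2))
    (phiPoly (m + 2) (m + 1)) (r' (Fin.last (m + 1))) (tauO (m + 2) (m + 1)) (tauO (m + 2) (m + 2))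
    (hr (m + 1) (by omega)) (h0 _) hlast
  have hu := evG_xv_mul (0 : Fin (m + 2))
  rw [Fin.rev_zero, Fin.val_last] at hu
  have hunit : IsUnit (uS (m + 2) (OZo (m + 2)) (m + 1) ^ (m + 1)) :=
    (IsUnit.of_mul_eq_one _ (by rw [mul_comm]; exact hu)).pow _
  rw [phiPoly, ← evG_psiAt (m + 1) (xv 0) _ hu] at h
  refine hunit.mul_left_cancel ?_
  linear_combination h

theorem uS_zero_mul_prod_midPt (m : ℕ) :
    uS (m + 2) (OZo (m + 2)) 0 * (∏ k, midPt m k) * uS (m + 2) (OZo (m + 2)) (m + 1) = 1 := by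
  have h := congrArg (algebraMap (RT (m + 2)) (OZo (m + 2))) (prod_ee_neg_wt (m + 2))
  rw [map_prod, map_one] at h
  have h2 : ∀ k : Fin (m + 2), algebraMap (RT (m + 2)) (OZo (m + 2)) (ee (-wt k)) =
      uS (m + 2) (OZo (m + 2)) k := fun k => (uS_of_lt k.2).symm
  simp only [h2] at h
  rw [← Finset.prod_range, Finset.prod_range_succ, Finset.prod_range_succ',
    ← Finset.prod_range_reflect, Finset.prod_range] at h
  rw [← h, mul_comm (uS _ _ 0)]
  congr 2
  refine Finset.prod_congr rfl fun k _ => ?_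
  rw [midPt, show m - 1 - (k : ℕ) + 1 = m - k by omega]

theorem IsPhi.thetaClass_mul {n : ℕ} [NeZero n] {Φ : OYo n →ₐ[RT n] OZo n} (h : IsPhi Φ) :
    Φ (thetaClass n) * ∏ i ∈ Finset.range (n - 1), extZero (phiQ n) i =
      evG n (groth (sTheta n)) := by
  have h1 := congrArg Φ (IsLocalization.mk'_spec (OYo n)
    (mkY n (specialize n (groth (sTheta n)))) (QTheta n))
  rw [map_mul] at h1
  refine Eq.trans ?_ (h1.trans (h.apply_classY _))
  refine congrArg₂ _ rfl ?_
  rw [QTheta, Submonoid.coe_finsetProd, map_prod, map_prod, Finset.prod_range]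
  refine Finset.prod_congr rfl fun i _ => ?_
  refine Eq.trans ?_ (h.apply_classY _).symm
  rw [MvPolynomial.aeval_X, extZero, dif_pos i.2]
  rfl

/-- The Vandermonde factor stays on both sides: differences of the e^{-a_k} are inverted only later,
in R(T)^Δ. -/
theorem vandermonde_mul_thetaClass {m : ℕ} {Φ : OYo (m + 2) →ₐ[RT (m + 2)] OZo (m + 2)}
    (h : IsPhi Φ) :
    (Matrix.vandermonde (midPt m)).det * (Φ (thetaClass (m + 2)) *
      (uS (m + 2) (OZo (m + 2)) (m + 1) - uS (m + 2) (OZo (m + 2)) 0) *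
        matZo (m + 2) (Fin.last (m + 1)) (Fin.last (m + 1))) =
      (Matrix.vandermonde (midPt m)).det * (uS (m + 2) (OZo (m + 2)) 0 *
        (matZo (m + 2) 0 0 - matZo (m + 2) (Fin.last (m + 1)) (Fin.last (m + 1)))) := by
  have E1 := prod_mul_vandermonde_mul_groth m
  have E2 := cornerFun_prod_mul_vandermonde m
  have E5 := sub_mul_cornerFun_prod m
  have H34 := tauO_mul_evG_psiAt m
  have Hu := uS_zero_mul_prod_midPt m
  have HΘ : Φ (thetaClass (m + 2)) * ∏ i ∈ Finset.range (m + 1), extZero (phiQ (m + 2)) i =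
      evG (m + 2) (groth (sTheta (m + 2))) := h.thetaClass_mul
  have HQ := prod_phiQ (m + 2) (m + 1) (by omega)
  refine (isUnit_tauO (show m + 2 ≤ m + 2 by omega)).mul_left_cancel ?_
  generalize (Matrix.vandermonde (midPt m)).det = V at *
  generalize (Matrix.of fun k l : Fin m => (phiPoly (m + 2) (l + 1)).eval (midPt m k)).det = d at *
  generalize (∏ k, midPt m k) = p at *
  generalize (∏ i ∈ Finset.range (m + 1), extZero (phiQ (m + 2)) i) = q at *
  generalize cornerFun m _ = a at *
  generalize evG (m + 2) (groth (sTheta (m + 2))) = g at *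
  generalize evG (m + 2) (psiAt (m + 1) (xv 0)) = ψ at *
  generalize Φ (thetaClass (m + 2)) = Θ at *
  generalize uS (m + 2) (OZo (m + 2)) (m + 1) = ul at *
  generalize uS (m + 2) (OZo (m + 2)) 0 = u0 at *
  generalize matZo (m + 2) (Fin.last (m + 1)) (Fin.last (m + 1)) = zl at *
  generalize matZo (m + 2) 0 0 = z0 at *
  generalize tauO (m + 2) (m + 2) = t at *
  generalize tauO (m + 2) (m + 1) = t' at *
  generalize tauO (m + 2) 1 = t1 at *
  -- The elimination in words: t Θ = t1 t' g by the product of the Q; multiplying by u0 p ul = 1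
  -- brings in p V g = ψ d; then t' ψ zl ul = t, t1 d = a V and (ul - u0) a = z0 - zl.
  linear_combination -(V * Θ * (ul - u0) * zl) * HQ + V * (ul - u0) * zl * t1 * t' * HΘ -
    V * (ul - u0) * zl * t1 * t' * g * Hu + u0 * ul * (ul - u0) * zl * t1 * t' * E1 +
    u0 * (ul - u0) * t1 * d * H34 - u0 * (ul - u0) * t * E2 + u0 * t * V * E5

/-! ### Passage to symmetric power series. -/

theorem betaSigmaLoc_algebraMap {n : ℕ} [NeZero n] (x : OZ n) :
    betaSigmaLoc n (algebraMap (OZ n) (OZo n) x) =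
      algebraMap (Lam n) (LamLoc n) (betaSigma n x) :=
  IsLocalization.map_eq _ x

theorem betaSigmaLoc_uS {n : ℕ} [NeZero n] {k : ℕ} (h : k < n) :
    betaSigmaLoc n (uS n (OZo n) k) = algebraMap (Lam n) (LamLoc n) (uu ⟨k, h⟩) := by
  rw [uS_of_lt h, IsScalarTower.algebraMap_apply (RT n) (OZ n) (OZo n), betaSigmaLoc_algebraMap,
    AlgHom.commutes, uu]

/-- Each factor is a difference e^{-a_i} - e^{-a_j} with i ≠ j, a unit multiple of some 1 - e^α, and
so invertible over R(T)^Δ. -/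
theorem isUnit_betaSigmaLoc_vandermonde (m : ℕ) :
    IsUnit (betaSigmaLoc (m + 2) (Matrix.vandermonde (midPt m)).det) := by
  rw [Matrix.det_vandermonde, map_prod]
  refine IsUnit.prod_iff.2 fun i _ => ?_
  rw [map_prod]
  refine IsUnit.prod_iff.2 fun j hj => ?_
  have hij : i < j := Finset.mem_Ioi.1 hj
  have := j.2
  rw [map_sub, midPt, midPt, betaSigmaLoc_uS (by omega), betaSigmaLoc_uS (by omega), ← map_sub]
  refine (isUnit_uu_sub fun h => ?_).map _
  have := congrArg Fin.val h
  simp only at this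
  omega

/-- By triangularity σ multiplies z_ii by e^{a_i}, and β(z_ii) = Ω(b_i) because g of the empty word
is 1. -/
theorem uu_mul_betaSigma_matZ {n : ℕ} [NeZero n] (i : Fin n) :
    uu i * betaSigma n (matZ n i i) = Omega i := by
  have h : matZAinv n i i = matZ n i i * algebraMap (RT n) (OZ n) ((matA n)⁻¹ i i) := by
    rw [matZAinv, Matrix.mul_apply, Finset.sum_eq_single i, Matrix.map_apply]
    · intro k _ hk
      rcases lt_or_gt_of_ne hk with hk | hk
      · rw [matZ_upper n hk, zero_mul]
      · rw [Matrix.map_apply, inv_matA_upper n hk, map_zero, mul_zero]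
    · simp
  have hi : ix n i = i := Fin.ext (ix_val i.2)
  have hb : beta n (matZ n i i) = Omega i := by
    refine (liftZ_matZ _ _ _ _ _ i i).trans ?_
    rw [betaMat_eq le_rfl, Nat.sub_self, betaAux_zero, hi]
  have h2 := congrArg (algebraMap (RT n) (Lam n)) (inv_matA_diag n i)
  rw [map_mul, map_one] at h2
  have hs : sigmaZ n (matZ n i i) = matZAinv n i i := liftZ_matZ _ _ _ _ _ i i
  rw [betaSigma, AlgHom.comp_apply, hs, h, map_mul, AlgHom.commutes, hb, uu]
  linear_combination Omega i * h2

theorem sub_mul_kSchurClosed_zero {n : ℕ} [NeZero n] (h : (0 - 1 : Fin n) ≠ 0) :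
    (uu (0 - 1) - uu 0) * kSchurClosed [0] * Omega (0 - 1) =
      uu (0 - 1) * Omega 0 - uu 0 * Omega (0 - 1 : Fin n) := by
  have h1 := TT_spec (n := n) 0 h 1
  rw [simpleRoot, algebraMap_sub_ee, affineRefl, if_pos rfl, map_one, mul_one] at h1
  have h2 := Ring.inverse_mul_cancel _ (isUnit_Omega (0 - 1 : Fin n))
  have h3 := congrArg (algebraMap (RT n) (Lam n)) (ee_mul_neg (wt (0 - 1 : Fin n)))
  rw [map_mul, map_one, ← uu] at h3
  change _ * (TT 0 1 + 1) * _ = _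
  linear_combination uu (0 - 1) * Omega (0 - 1) * h1 + uu (0 - 1) * Omega 0 * h2 -
    (uu (0 - 1) - uu 0) * TT 0 1 * Omega (0 - 1) * h3

/-- The formal end of the argument: once V has become a unit it is cancelled, and the two relations
agree after one multiplication by u_n. -/
theorem map_eq_map_of_relations {R L S : Type*} [CommRing R] [CommRing L] [CommRing S]
    (g : R →+* S) (f : L →+* S) {V θ v0 vl z0 zl : R} {D u0 ul w0 wl Ω0 Ωl : L}
    (hR : V * (θ * (vl - v0) * zl) = V * (v0 * (z0 - zl)))
    (hL : (ul - u0) * D * Ωl = ul * Ω0 - u0 * Ωl) (h0 : u0 * w0 = Ω0) (hl : ul * wl = Ωl)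
    (hV : IsUnit (g V)) (hu : IsUnit (ul - u0)) (hΩ : IsUnit Ωl)
    (hv0 : g v0 = f u0) (hvl : g vl = f ul) (hz0 : g z0 = f w0) (hzl : g zl = f wl) :
    g θ = f D := by
  have h1 := congrArg g hR
  rw [map_mul g V, map_mul g V] at h1
  have h2 := hV.mul_left_cancel h1
  have h3 := congrArg f hL
  subst h0 hl
  refine ((hu.mul hΩ).map f).mul_left_cancel ?_
  simp only [map_mul, map_sub, hv0, hvl, hz0, hzl] at h2 h3 ⊢
  linear_combination f ul * h2 - h3

theorem betaSigmaLoc_thetaClass {m : ℕ} {Φ : OYo (m + 2) →ₐ[RT (m + 2)] OZo (m + 2)}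
    (h : IsPhi Φ) :
    betaSigmaLoc (m + 2) (Φ (thetaClass (m + 2))) =
      algebraMap (Lam (m + 2)) (LamLoc (m + 2)) (kSchurClosed [0]) := by
  -- Subtraction is cyclic, so the index 0 - 1 in the definition of s_0 stands for n.
  have hl : (0 - 1 : Fin (m + 2)) = Fin.last (m + 1) := by
    rw [sub_eq_iff_eq_add, Fin.last_add_one]
  have hne : Fin.last (m + 1) ≠ 0 := Fin.last_pos.ne'
  have hL := sub_mul_kSchurClosed_zero (n := m + 2) (hl ▸ hne)
  rw [hl] at hL
  have hz : ∀ i, betaSigmaLoc (m + 2) (matZo (m + 2) i i) =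
      algebraMap (Lam (m + 2)) (LamLoc (m + 2)) (betaSigma (m + 2) (matZ (m + 2) i i)) :=
    fun i => betaSigmaLoc_algebraMap _
  have hv0 : betaSigmaLoc (m + 2) (uS (m + 2) (OZo (m + 2)) 0) =
      algebraMap (Lam (m + 2)) (LamLoc (m + 2)) (uu 0) := betaSigmaLoc_uS (by omega)
  have hvl : betaSigmaLoc (m + 2) (uS (m + 2) (OZo (m + 2)) (m + 1)) =
      algebraMap (Lam (m + 2)) (LamLoc (m + 2)) (uu (Fin.last (m + 1))) :=
    betaSigmaLoc_uS (by omega)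
  exact map_eq_map_of_relations (S := LamLoc (m + 2)) (betaSigmaLoc (m + 2))
    (algebraMap (Lam (m + 2)) (LamLoc (m + 2))) (vandermonde_mul_thetaClass h) hL
    (uu_mul_betaSigma_matZ 0) (uu_mul_betaSigma_matZ (Fin.last (m + 1)))
    (isUnit_betaSigmaLoc_vandermonde m) (isUnit_uu_sub hne) (isUnit_Omega _) hv0 hvl (hz _) (hz _)

end KPeterson

end

theorem mainTheorem7 (n : ℕ) [NeZero n] (hn : 2 ≤ n) :
    (∃! Φ : KPeterson.OYo n →ₐ[KPeterson.RT n] KPeterson.OZo n, KPeterson.IsPhi Φ) ∧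
    ∀ Φ : KPeterson.OYo n →ₐ[KPeterson.RT n] KPeterson.OZo n, KPeterson.IsPhi Φ →
      KPeterson.betaSigmaLoc n (Φ (KPeterson.thetaClass n)) =
        algebraMap (KPeterson.Lam n) (KPeterson.LamLoc n) (KPeterson.kSchurClosed [0]) := by
  obtain ⟨m, rfl⟩ : ∃ m, n = m + 2 := ⟨n - 2, by omega⟩
  exact ⟨⟨KPeterson.phi (m + 2), KPeterson.isPhi_phi (m + 2),
    fun Ψ hΨ => hΨ.unique (KPeterson.isPhi_phi (m + 2))⟩,
    fun Φ hΦ => KPeterson.betaSigmaLoc_thetaClass hΦ⟩
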